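/- Let $(M,\omega)$ be a symplectic manifold of dimension $2m$ (everything smooth), let $\mathbb{T}M=TM\oplus T^*M$ with the split form $b(u+\sigma,v+\tau)=\tau(u)+\sigma(v)$ and the Courant bracket $[u+\sigma,v+\tau]=[u,v]+\mathcal{L}_u\tau-\mathcal{L}_v\sigma-\frac12 d(\tau(u)-\sigma(v))$. Put $\omega^\flat(u)=\omega(u,\cdot)$ and, for $k=\pm1$, $I_k=\begin{pmatrix}0&k(\omega^\flat)^{-1}\\ \omega^\flat&0\end{pmatrix}$. An endomorphism $T$ with $T^2=\pm\mathrm{id}$ is called split if its two eigenspaces (for the eigenvalues $\pm1$, respectively $\pm i$ in the complexification) have the same dimension. Let $\lambda,\ell\in\{1,-1\}$. An integrable $(\lambda,\ell)$-structure on $(M,\omega)$ is a smooth section $S$ of $\mathrm{End}(\mathbb{T}M)$ such that at every point (i) $S^2=\lambda\,\mathrm{id}$, $S$ is split and skew-symmetric for $b$, $SI_{\lambda\ell}=I_{\lambda\ell}S$, and $I_{\lambda\ell}S$ is split, and such that (ii) for each of the two eigenvalues $\pm\sqrt{\lambda}$, the set of smooth sections of the corresponding eigenbundle of $S$ (in the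 complexification of $\mathbb{T}M$ if $\lambda=-1$) is closed under the Courant bracket (extended $\mathbb{C}$-bilinearly if $\lambda=-1$). For $0\le n\le m$, an integrable $(-1,1;n)$-structure is an integrable $(-1,1)$-structure $S$ for which the symmetric form $\beta_S(x,y)=b(I_{-1}Sx,y)$ has signature $(4n,4m-4n)$ at every point. Let $\mathcal{B}(\lambda,\ell)\subset\mathrm{End}(\mathbb{T}M)$ be the set of all endomorphisms of fibres $\mathbb{T}_pM$, $p\in M$, that satisfy (i), and let $\mathcal{B}(-1,1;n)\subset\mathcal{B}(-1,1)$ be the subset of those for which $\beta_S$ has signature $(4n,4m-4n)$. **Theorem.** Each of $\mathcal{B}(1,1)$, $\mathcal{B}(1,-1)$, $\mathcal{B}(-1,1;n)$ $(0\le n\le m)$ and $\mathcal{B}(-1,-1)$ is a smooth fibre subbundle of $\mathrm{End}(\mathbb{T}M)$ over $M$ with typical fibre the homogeneous space $G/H$ given by the following table. | structure | $G$ | $H$ | |---|---|---| | $(1,1)$ | $GL(2m,\mathbb{R})$ | $GL(m,\mathbb{R})\times GL(m,\mathbb{R})$ | | $(1,-1)$ | $U(m,m)$ | $GL(m,\mathbb{C})$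 | | $(-1,1;n)$ | $U(m,m)$ | $U(n,m-n)\times U(m-n,n)$ | | $(-1,-1)$ | $GL(2m,\mathbb{R})$ | $GL(m,\mathbb{C})$ | Here $GL(m,\mathbb{R})\times GL(m,\mathbb{R})\subset GL(2m,\mathbb{R})$ is embedded block-diagonally; $GL(m,\mathbb{C})\subset U(m,m)$ by $A\mapsto\mathrm{diag}(A,(\overline{A}^t)^{-1})$ with respect to two complementary isotropic subspaces; $U(n,m-n)\times U(m-n,n)\subset U(m,m)$ through the orthogonal sum $\mathbb{C}^{m,m}=\mathbb{C}^{n,m-n}\oplus\mathbb{C}^{m-n,n}$; and $GL(m,\mathbb{C})\subset GL(2m,\mathbb{R})$ through $\mathbb{C}^m=\mathbb{R}^{2m}$. The integrable $(1,1)$-, $(1,-1)$-, $(-1,1;n)$- and $(-1,-1)$-structures on $(M,\omega)$ are smooth sections of the corresponding bundle; more precisely, they are exactly those smooth sections of it that satisfy (ii). -/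

import Mathlib

open scoped Manifold ContDiff Bundle Matrix
open Bundle

noncomputable section

/-! ## Linear algebra of `T ⊕ T*` -/

section LinearAlgebra

/-- A real endomorphism `T` with `T² = id` or `T² = -id` is *split* if its two eigenspaces (the
`±1`-eigenspaces if `T² = id`, the `±i`-eigenspaces in the complexification if `T² = -id`) have
the same dimension. -/
def IsSplit {V : Type*} [AddCommGroup V] [Module ℝ V] (T : V →ₗ[ℝ] V) : Prop :=
  (T ∘ₗ T = LinearMap.id ∧
    Module.finrank ℝ (Module.End.eigenspace T (1 : ℝ)) =
      Module.finrank ℝ (Module.End.eigenspace T (-1 : ℝ))) ∨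
  (T ∘ₗ T = -LinearMap.id ∧
    Module.finrank ℂ (Module.End.eigenspace (LinearMap.baseChange ℂ T) Complex.I) =
      Module.finrank ℂ (Module.End.eigenspace (LinearMap.baseChange ℂ T) (-Complex.I)))

variable {T : Type*} [AddCommGroup T] [Module ℝ T] [TopologicalSpace T] [IsTopologicalAddGroup T]
  [ContinuousSMul ℝ T]

/-- The canonical split form `b(u + σ, v + τ) = τ(u) + σ(v)` on `T ⊕ T*`. -/
def pairing (T : Type*) [AddCommGroup T] [Module ℝ T] [TopologicalSpace T]
    [IsTopologicalAddGroup T] [ContinuousSMul ℝ T] : LinearMap.BilinForm ℝ (T × (T →L[ℝ] ℝ)) :=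
  LinearMap.mk₂ ℝ (fun x y => y.2 x.1 + x.2 y.1)
    (fun x x' y => by simp; ring) (fun c x y => by simp; ring)
    (fun x y y' => by simp; ring) (fun c x y => by simp; ring)

/-- The endomorphism `I_k = (0, k (Ω♭)⁻¹; Ω♭, 0)` of `T ⊕ T*`, where `Ω♭ u = Ω(u, ·)`. -/
def opI (Ω : T →L[ℝ] T →L[ℝ] ℝ) (k : ℝ) : (T × (T →L[ℝ] ℝ)) →L[ℝ] (T × (T →L[ℝ] ℝ)) :=
  ((k • Ω.inverse) ∘L ContinuousLinearMap.snd ℝ T (T →L[ℝ] ℝ)).prod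
    (Ω ∘L ContinuousLinearMap.fst ℝ T (T →L[ℝ] ℝ))

/-- For a nondegenerate form on a finite-dimensional space, `ContinuousLinearMap.inverse` is the
true inverse of `Ω♭`, so that `opI` contains no junk value. -/
theorem inverse_flat [T2Space T] [FiniteDimensional ℝ T] (Ω : T →L[ℝ] T →L[ℝ] ℝ)
    (h : ∀ u, (∀ v, Ω u v = 0) → u = 0) :
    (∀ u, Ω.inverse (Ω u) = u) ∧ ∀ σ, Ω (Ω.inverse σ) = σ := by
  have hinj : Function.Injective Ω.toLinearMap := by
    rw [injective_iff_map_eq_zero]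
    intro u hu
    exact h u fun v => by
      have := congrArg (fun f : T →L[ℝ] ℝ => f v) hu
      simpa using this
  let c : (T →L[ℝ] ℝ) ≃ₗ[ℝ] (T →ₗ[ℝ] ℝ) := LinearMap.toContinuousLinearMap.symm
  have hfin : FiniteDimensional ℝ (T →L[ℝ] ℝ) := LinearEquiv.finiteDimensional c.symm
  have hdim : Module.finrank ℝ T = Module.finrank ℝ (T →L[ℝ] ℝ) := by
    rw [c.finrank_eq]; exact (Subspace.dual_finrank_eq (K := ℝ) (V := T)).symm
  let e : T ≃ₗ[ℝ] (T →L[ℝ] ℝ) := LinearEquiv.ofInjectiveOfFinrankEq Ω.toLinearMap hinj hdim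
  let e' : T ≃L[ℝ] (T →L[ℝ] ℝ) := e.toContinuousLinearEquiv
  have he : Ω = (e' : T →L[ℝ] (T →L[ℝ] ℝ)) := by
    ext u v; rfl
  rw [he, ContinuousLinearMap.inverse_equiv]
  exact ⟨fun u => by simp, fun σ => by simp⟩

/-- The form `β_S(x, y) = b(I₋ S x, y)` on `T ⊕ T*`. -/
def betaForm (Ω : T →L[ℝ] T →L[ℝ] ℝ) (S : (T × (T →L[ℝ] ℝ)) →L[ℝ] (T × (T →L[ℝ] ℝ))) :
    LinearMap.BilinForm ℝ (T × (T →L[ℝ] ℝ)) :=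
  pairing T ∘ₗ (opI Ω (-1) ∘L S).toLinearMap

/-- The real bilinear form `β` (symmetric, in all uses) has signature `(p, q)`. -/
def HasSignature {V : Type*} [AddCommGroup V] [Module ℝ V] (β : LinearMap.BilinForm ℝ V)
    (p q : ℕ) : Prop :=
  sigPos (LinearMap.BilinMap.toQuadraticMap β) = p ∧
    sigNeg (LinearMap.BilinMap.toQuadraticMap β) = q

/-- The real number `±1` given by a sign. -/
abbrev sgn (s : ℤˣ) : ℝ := ((s : ℤ) : ℝ)

/-- `S² = lam · id`, `S` is split and `S` is skew-symmetric for `b`. -/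
structure IsLinearGenStructure (lam : ℤˣ)
    (S : (T × (T →L[ℝ] ℝ)) →L[ℝ] (T × (T →L[ℝ] ℝ))) : Prop where
  sq : S ∘L S = sgn lam • ContinuousLinearMap.id ℝ (T × (T →L[ℝ] ℝ))
  split : IsSplit S.toLinearMap
  skew : ∀ x y, pairing T (S x) y = -pairing T x (S y)

/-- `S` commutes with `I_{lam ell}` and `I_{lam ell} S` is split. -/
structure IsCompatibleWith (Ω : T →L[ℝ] T →L[ℝ] ℝ) (lam ell : ℤˣ)
    (S : (T × (T →L[ℝ] ℝ)) →L[ℝ] (T × (T →L[ℝ] ℝ))) : Prop where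
  comm : S ∘L opI Ω (sgn (lam * ell)) = opI Ω (sgn (lam * ell)) ∘L S
  split : IsSplit (opI Ω (sgn (lam * ell)) ∘L S).toLinearMap

/-- The set `σ(lam, ell)` of endomorphisms of `T ⊕ T*`. -/
def slashFiber (Ω : T →L[ℝ] T →L[ℝ] ℝ) (lam ell : ℤˣ) :
    Set ((T × (T →L[ℝ] ℝ)) →L[ℝ] (T × (T →L[ℝ] ℝ))) :=
  {S | IsLinearGenStructure lam S ∧ IsCompatibleWith Ω lam ell S}

/-- The set `σ(-1, 1; n)` of those `S ∈ σ(-1, 1)` for which `β_S` has signature `(4n, 4m - 4n)`,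
where `dim T = 2m`. -/
def slashFiberSig (Ω : T →L[ℝ] T →L[ℝ] ℝ) (m n : ℕ) :
    Set ((T × (T →L[ℝ] ℝ)) →L[ℝ] (T × (T →L[ℝ] ℝ))) :=
  {S | S ∈ slashFiber Ω (-1) 1 ∧ HasSignature (betaForm Ω S) (4 * n) (4 * m - 4 * n)}

end LinearAlgebra

/-! ## The extended tangent bundle, symplectic forms and the Courant bracket -/

section Manifold

/-- The model fibre of `𝕋M = TM ⊕ T*M`. -/
abbrev ETModel (d : ℕ) : Type :=
  EuclideanSpace ℝ (Fin d) × (EuclideanSpace ℝ (Fin d) →L[ℝ] ℝ)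

/-- The fibre at `p` of the extended tangent bundle `𝕋M = TM ⊕ T*M`. -/
abbrev ET (d : ℕ) {M : Type*} [TopologicalSpace M] [ChartedSpace (EuclideanSpace ℝ (Fin d)) M]
    (p : M) : Type :=
  TangentSpace (𝓡 d) p × (TangentSpace (𝓡 d) p →L[ℝ] ℝ)

/-- The total space of the vector bundle `End(𝕋M)`. -/
abbrev EndTotal (d : ℕ) (M : Type*) [TopologicalSpace M]
    [ChartedSpace (EuclideanSpace ℝ (Fin d)) M] : Type _ :=
  TotalSpace (ETModel d →L[ℝ] ETModel d) (fun p : M => ET d p →L[ℝ] ET d p)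

variable {d : ℕ} {M : Type*} [TopologicalSpace M] [ChartedSpace (EuclideanSpace ℝ (Fin d)) M]

/-- Smooth vector fields. -/
def IsSmoothVectorField [IsManifold (𝓡 d) ∞ M] (X : ∀ p : M, TangentSpace (𝓡 d) p) : Prop :=
  ContMDiff (𝓡 d) ((𝓡 d).prod 𝓘(ℝ, EuclideanSpace ℝ (Fin d))) ∞
    (fun p => TotalSpace.mk' (EuclideanSpace ℝ (Fin d)) p (X p))

/-- Smooth sections of `𝕋M`. -/
def IsSmoothET [IsManifold (𝓡 d) ∞ M] (x : ∀ p : M, ET d p) : Prop :=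
  ContMDiff (𝓡 d) ((𝓡 d).prod 𝓘(ℝ, ETModel d)) ∞
    (fun p => (TotalSpace.mk' (ETModel d) p (x p) : TotalSpace (ETModel d) (fun p : M => ET d p)))

/-- Smooth sections of `End(𝕋M)`. -/
def IsSmoothEnd [IsManifold (𝓡 d) ∞ M] (S : ∀ p : M, ET d p →L[ℝ] ET d p) : Prop :=
  ContMDiff (𝓡 d) ((𝓡 d).prod 𝓘(ℝ, ETModel d →L[ℝ] ETModel d)) ∞
    (fun p => (TotalSpace.mk' (ETModel d →L[ℝ] ETModel d) p (S p) : EndTotal d M))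

/-- The differential of a real function. -/
def dFun (f : M → ℝ) (p : M) : TangentSpace (𝓡 d) p →L[ℝ] ℝ :=
  mfderiv (𝓡 d) 𝓘(ℝ, ℝ) f p

variable (d M) in
/-- A symplectic form on `M`: a smooth, alternating, nondegenerate two-form `Ω` with `dΩ = 0`,
where `dΩ` is given by its values on vector fields. -/
structure SymplecticForm [IsManifold (𝓡 d) ∞ M] where
  /-- The bilinear form on each tangent space. -/
  form (p : M) : TangentSpace (𝓡 d) p →L[ℝ] TangentSpace (𝓡 d) p →L[ℝ] ℝ
  smooth : ContMDiff (𝓡 d)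
    ((𝓡 d).prod 𝓘(ℝ, EuclideanSpace ℝ (Fin d) →L[ℝ] EuclideanSpace ℝ (Fin d) →L[ℝ] ℝ)) ∞
    (fun p => TotalSpace.mk' (EuclideanSpace ℝ (Fin d) →L[ℝ] EuclideanSpace ℝ (Fin d) →L[ℝ] ℝ)
      p (form p))
  alternating (p : M) (u : TangentSpace (𝓡 d) p) : form p u u = 0
  nondegenerate (p : M) (u : TangentSpace (𝓡 d) p) : (∀ v, form p u v = 0) → u = 0
  closed (X Y Z : ∀ p : M, TangentSpace (𝓡 d) p) :
    IsSmoothVectorField X → IsSmoothVectorField Y → IsSmoothVectorField Z → ∀ p : M,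
      dFun (fun q => form q (Y q) (Z q)) p (X p) + dFun (fun q => form q (Z q) (X q)) p (Y p)
        + dFun (fun q => form q (X q) (Y q)) p (Z p)
        - form p (VectorField.mlieBracket (𝓡 d) X Y p) (Z p)
        - form p (VectorField.mlieBracket (𝓡 d) Y Z p) (X p)
        - form p (VectorField.mlieBracket (𝓡 d) Z X p) (Y p) = 0

/-- The Lie derivative `L_u τ` of a one-form at `p`. In the chart at `p`, with `û`, `τ̂` the
coordinate expressions of `u` and `τ`, it is `(L_u τ)(w) = (Dτ̂(û))(w) + τ̂(Dû(w))`, that is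
`(L_u τ)_j = u^i ∂_i τ_j + τ_i ∂_j u^i`. -/
def lieDerivForm (u : ∀ p : M, TangentSpace (𝓡 d) p) (τ : ∀ p : M, TangentSpace (𝓡 d) p →L[ℝ] ℝ)
    (p : M) : TangentSpace (𝓡 d) p →L[ℝ] ℝ :=
  let φ := extChartAt (𝓡 d) p
  let û : EuclideanSpace ℝ (Fin d) → EuclideanSpace ℝ (Fin d) :=
    VectorField.mpullback 𝓘(ℝ, EuclideanSpace ℝ (Fin d)) (𝓡 d) φ.symm u
  let τ' : EuclideanSpace ℝ (Fin d) → (EuclideanSpace ℝ (Fin d) →L[ℝ] ℝ) := fun y =>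
    (τ (φ.symm y)) ∘L (mfderiv 𝓘(ℝ, EuclideanSpace ℝ (Fin d)) (𝓡 d) φ.symm y)
  let L : EuclideanSpace ℝ (Fin d) →L[ℝ] ℝ :=
    fderiv ℝ τ' (φ p) (û (φ p)) + τ' (φ p) ∘L fderiv ℝ û (φ p)
  L ∘L (mfderiv (𝓡 d) 𝓘(ℝ, EuclideanSpace ℝ (Fin d)) φ p)

/-- The Courant bracket
`[u + σ, v + τ] = [u, v] + L_u τ - L_v σ - (1/2) d(τ(u) - σ(v))`. -/
def courant (x y : ∀ p : M, ET d p) (p : M) : ET d p :=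
  (VectorField.mlieBracket (𝓡 d) (fun q => (x q).1) (fun q => (y q).1) p,
    lieDerivForm (fun q => (x q).1) (fun q => (y q).2) p
      - lieDerivForm (fun q => (y q).1) (fun q => (x q).2) p
      - (1 / 2 : ℝ) • dFun (fun q => (y q).2 (x q).1 - (x q).2 (y q).1) p)

/-- The smooth sections of the `δ`-eigenspace of `S` are closed under the Courant bracket. -/
def IsRealInvolutive [IsManifold (𝓡 d) ∞ M] (S : ∀ p : M, ET d p →L[ℝ] ET d p) (δ : ℝ) : Prop :=
  ∀ x y : ∀ p : M, ET d p, IsSmoothET x → IsSmoothET y →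
    (∀ p, S p (x p) = δ • x p) → (∀ p, S p (y p) = δ • y p) →
    ∀ p, S p (courant x y p) = δ • courant x y p

/-- `x + i x'` is in the `δ i`-eigenspace (`δ = ±1`) of the complexification of `S`. -/
def IsComplexEigensection (S : ∀ p : M, ET d p →L[ℝ] ET d p) (δ : ℝ) (x x' : ∀ p : M, ET d p) :
    Prop :=
  ∀ p, S p (x p) = -(δ • x' p) ∧ S p (x' p) = δ • x p

/-- The smooth sections `x + i x'` of the `δ i`-eigenspace (`δ = ±1`) of `S` in the
complexification of `𝕋M` are closed under the `ℂ`-bilinear extension of the Courant bracket. -/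
def IsComplexInvolutive [IsManifold (𝓡 d) ∞ M] (S : ∀ p : M, ET d p →L[ℝ] ET d p) (δ : ℝ) :
    Prop :=
  ∀ x x' y y' : ∀ p : M, ET d p,
    IsSmoothET x → IsSmoothET x' → IsSmoothET y → IsSmoothET y' →
    IsComplexEigensection S δ x x' → IsComplexEigensection S δ y y' →
    IsComplexEigensection S δ (fun p => courant x y p - courant x' y' p)
      (fun p => courant x y' p + courant x' y p)

/-- Sections of the `±√lam`-eigenspaces of `S` are closed under the Courant bracket. -/
def IsCourantInvolutive [IsManifold (𝓡 d) ∞ M] (lam : ℤˣ) (S : ∀ p : M, ET d p →L[ℝ] ET d p) :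
    Prop :=
  if lam = 1 then IsRealInvolutive S 1 ∧ IsRealInvolutive S (-1)
  else IsComplexInvolutive S 1 ∧ IsComplexInvolutive S (-1)

/-- Generalized complex (`lam = -1`) or generalized paracomplex (`lam = 1`) structures. -/
structure IsGenStructure [IsManifold (𝓡 d) ∞ M] (lam : ℤˣ) (S : ∀ p : M, ET d p →L[ℝ] ET d p) :
    Prop where
  smooth : IsSmoothEnd S
  linear : ∀ p, IsLinearGenStructure lam (S p)
  involutive : IsCourantInvolutive lam S

/-- Integrable `(lam, ell)`-structures on `(M, Ω)`: generalized complex (`lam = -1`) or paracomplex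
(`lam = 1`) structures `S` commuting with `I_{lam ell}` and such that `I_{lam ell} S` is split. -/
structure IsSlashStructure [IsManifold (𝓡 d) ∞ M] (Ω : SymplecticForm d M) (lam ell : ℤˣ)
    (S : ∀ p : M, ET d p →L[ℝ] ET d p) : Prop where
  gen : IsGenStructure lam S
  compatible : ∀ p, IsCompatibleWith (Ω.form p) lam ell (S p)

/-- Integrable `(-1, 1; n)`-structures on `(M, Ω)`, where `dim M = 2m`. -/
structure IsSlashStructureSig {m : ℕ} {M : Type*} [TopologicalSpace M]
    [ChartedSpace (EuclideanSpace ℝ (Fin (2 * m))) M] [IsManifold (𝓡 (2 * m)) ∞ M]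
    (Ω : SymplecticForm (2 * m) M) (n : ℕ)
    (S : ∀ p : M, ET (2 * m) p →L[ℝ] ET (2 * m) p) : Prop where
  slash : IsSlashStructure Ω (-1) 1 S
  sig : ∀ p, HasSignature (betaForm (Ω.form p) (S p)) (4 * n) (4 * m - 4 * n)

/-! ## The bundles -/

/-- The subset of `End(𝕋M)` with fibre `σ(lam, ell)` at each point. -/
def slashBundle [IsManifold (𝓡 d) ∞ M] (Ω : SymplecticForm d M) (lam ell : ℤˣ) :
    Set (EndTotal d M) :=
  {e | e.2 ∈ slashFiber (Ω.form e.1) lam ell}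

/-- The subset of `End(𝕋M)` with fibre `σ(-1, 1; n)` at each point. -/
def slashBundleSig {m : ℕ} {M : Type*} [TopologicalSpace M]
    [ChartedSpace (EuclideanSpace ℝ (Fin (2 * m))) M] [IsManifold (𝓡 (2 * m)) ∞ M]
    (Ω : SymplecticForm (2 * m) M) (n : ℕ) : Set (EndTotal (2 * m) M) :=
  {e | e.2 ∈ slashFiberSig (Ω.form e.1) m n}

/-- `S` is a smooth section of the subbundle `B` of `End(𝕋M)`. -/
def IsSmoothSectionOf [IsManifold (𝓡 d) ∞ M] (B : Set (EndTotal d M))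
    (S : ∀ p : M, ET d p →L[ℝ] ET d p) : Prop :=
  IsSmoothEnd S ∧ ∀ p, (TotalSpace.mk' (ETModel d →L[ℝ] ETModel d) p (S p) : EndTotal d M) ∈ B

variable {V : Type*} [NormedAddCommGroup V] [NormedSpace ℝ V] {G : Type*} [Group G]

/-- Smoothness of a map `f : U × G/H → End(𝕋M)`, `U ⊆ M` open. Here `G` is a Lie group that is an
embedded submanifold of the vector space `V` by `ρ`, and `G/H` has its usual smooth structure, for
which `G → G/H` is a submersion: `f` is smooth if and only if its lift to `U × G` is. -/
def SmoothFromQuotient [IsManifold (𝓡 d) ∞ M] (ρ : G → V) (H : Subgroup G) (U : Set M)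
    (f : U × (G ⧸ H) → EndTotal d M) : Prop :=
  ∃ F : M × V → EndTotal d M,
    ContMDiffOn ((𝓡 d).prod 𝓘(ℝ, V)) ((𝓡 d).prod 𝓘(ℝ, ETModel d →L[ℝ] ETModel d)) ∞ F
      (U ×ˢ Set.range ρ) ∧
    ∀ (p : U) (g : G), F ((p : M), ρ g) = f (p, (g : G ⧸ H))

/-- Smoothness of a map `f : B → G/H` on a submanifold `B` of `End(𝕋M)`, with `G` and `G/H` as in
`SmoothFromQuotient`: near every point, `f` lifts to a smooth map to `G`. -/
def SmoothToQuotient [IsManifold (𝓡 d) ∞ M] (ρ : G → V) (H : Subgroup G) (B : Set (EndTotal d M))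
    (f : B → G ⧸ H) : Prop :=
  ∀ e₀ : B, ∃ W : Set (EndTotal d M), IsOpen W ∧ (e₀ : EndTotal d M) ∈ W ∧
    ∃ γ : EndTotal d M → G,
      ContMDiffOn ((𝓡 d).prod 𝓘(ℝ, ETModel d →L[ℝ] ETModel d)) 𝓘(ℝ, V) ∞ (fun e => ρ (γ e))
        (B ∩ W) ∧
      ∀ e : B, (e : EndTotal d M) ∈ W → f e = (γ e : G ⧸ H)

/-- `B ⊆ End(𝕋M)` is a smooth fibre bundle over `M` (a subbundle of `End(𝕋M)`) with typical fibre
the homogeneous space `G/H`: over a neighbourhood `U` of each point of `M` there is a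
diffeomorphism `U × G/H ≃ B|_U` over `U`. -/
def IsFiberBundleWithFiber [IsManifold (𝓡 d) ∞ M] (B : Set (EndTotal d M)) (ρ : G → V)
    (H : Subgroup G) : Prop :=
  ∀ p₀ : M, ∃ U : Set M, IsOpen U ∧ p₀ ∈ U ∧
    ∃ Φ : U × (G ⧸ H) ≃ ({e | e ∈ B ∧ e.proj ∈ U} : Set (EndTotal d M)),
      (∀ x, (Φ x : EndTotal d M).proj = (x.1 : M)) ∧
      SmoothFromQuotient ρ H U (fun x => (Φ x : EndTotal d M)) ∧
      SmoothToQuotient ρ H {e | e ∈ B ∧ e.proj ∈ U} (fun e => (Φ.symm e).2)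

end Manifold

/-! ## The groups -/

section Groups

/-- The inclusion of `GL(ι, 𝕜)` into the (normed) space of matrices. -/
def glIncl {ι 𝕜 : Type*} [Fintype ι] [DecidableEq ι] [CommRing 𝕜] (g : GL ι 𝕜) : ι → ι → 𝕜 :=
  fun i j => (g : Matrix ι ι 𝕜) i j

/-- The matrix `diag(1, …, 1, -1, …, -1)`. -/
def sigMatrix (ι κ : Type*) [DecidableEq ι] [DecidableEq κ] : Matrix (ι ⊕ κ) (ι ⊕ κ) ℂ :=
  Matrix.fromBlocks 1 0 0 (-1)

/-- The indefinite unitary group `U(p, q)`, `p = |ι|`, `q = |κ|`: the matrices preserving the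
Hermitian form `z̄ᵗ z' - w̄ᵗ w'`. -/
def indefiniteUnitary (ι κ : Type*) [Fintype ι] [Fintype κ] [DecidableEq ι] [DecidableEq κ] :
    Subgroup (GL (ι ⊕ κ) ℂ) where
  carrier := {g | (g.val)ᴴ * sigMatrix ι κ * g.val = sigMatrix ι κ}
  one_mem' := by simp
  mul_mem' {a b} ha hb := by
    change (a.val * b.val)ᴴ * sigMatrix ι κ * (a.val * b.val) = sigMatrix ι κ
    change (a.val)ᴴ * sigMatrix ι κ * a.val = sigMatrix ι κ at ha
    change (b.val)ᴴ * sigMatrix ι κ * b.val = sigMatrix ι κ at hb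
    calc _ = (b.val)ᴴ * ((a.val)ᴴ * sigMatrix ι κ * a.val) * b.val := by
            simp only [Matrix.conjTranspose_mul, Matrix.mul_assoc]
      _ = _ := by rw [ha, hb]
  inv_mem' {a} ha := by
    change (a⁻¹.val)ᴴ * sigMatrix ι κ * a⁻¹.val = sigMatrix ι κ
    change (a.val)ᴴ * sigMatrix ι κ * a.val = sigMatrix ι κ at ha
    have h1 : a.val * a⁻¹.val = 1 := Units.mul_inv a
    have h2 : (a⁻¹.val)ᴴ * (a.val)ᴴ = 1 := by
      rw [← Matrix.conjTranspose_mul, h1, Matrix.conjTranspose_one]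
    calc _ = (a⁻¹.val)ᴴ * ((a.val)ᴴ * sigMatrix ι κ * a.val) * a⁻¹.val := by rw [ha]
      _ = ((a⁻¹.val)ᴴ * (a.val)ᴴ) * sigMatrix ι κ * (a.val * a⁻¹.val) := by
            simp only [Matrix.mul_assoc]
      _ = _ := by rw [h1, h2, Matrix.one_mul, Matrix.mul_one]

/-- `U(p, q)` with `ι = Fin p`, `κ = Fin q`. -/
abbrev unitaryGrp (p q : ℕ) : Subgroup (GL (Fin p ⊕ Fin q) ℂ) :=
  indefiniteUnitary (Fin p) (Fin q)

/-- The inclusion of `U(p, q)` into the (normed) space of matrices. -/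
def unitaryIncl (p q : ℕ) (g : unitaryGrp p q) : Fin p ⊕ Fin q → Fin p ⊕ Fin q → ℂ :=
  glIncl (g : GL (Fin p ⊕ Fin q) ℂ)

/-- The inclusion `GL(m, ℝ) × GL(m, ℝ) → GL(2m, ℝ)`, `(A, B) ↦ diag(A, B)`. -/
def glProdHom (m : ℕ) : GL (Fin m) ℝ × GL (Fin m) ℝ →* GL (Fin m ⊕ Fin m) ℝ :=
  MonoidHom.toHomUnits
    { toFun := fun x => Matrix.fromBlocks (x.1 : Matrix (Fin m) (Fin m) ℝ) 0 0
        (x.2 : Matrix (Fin m) (Fin m) ℝ)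
      map_one' := by simp
      map_mul' := fun x y => by simp [Matrix.fromBlocks_multiply] }

/-- The inclusion `GL(m, ℂ) → GL(2m, ℝ)`, `X + iY ↦ (X, -Y; Y, X)`. -/
def glRealHom (m : ℕ) : GL (Fin m) ℂ →* GL (Fin m ⊕ Fin m) ℝ :=
  MonoidHom.toHomUnits
    { toFun := fun A => Matrix.fromBlocks
        ((A : Matrix (Fin m) (Fin m) ℂ).map Complex.re)
        (-(A : Matrix (Fin m) (Fin m) ℂ).map Complex.im)
        ((A : Matrix (Fin m) (Fin m) ℂ).map Complex.im)
        ((A : Matrix (Fin m) (Fin m) ℂ).map Complex.re)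
      map_one' := by
        rw [← Matrix.fromBlocks_one]
        congr 1 <;> ext i j <;> by_cases h : i = j <;> simp [h, Matrix.one_apply]
      map_mul' := fun A B => by
        rw [Matrix.fromBlocks_multiply]
        congr 1 <;> ext i j <;>
          simp [Matrix.mul_apply, Finset.sum_sub_distrib, Finset.sum_add_distrib] <;> ring }

/-- `A ↦ ½ (A + A', A - A'; A - A', A + A')` with `A' = (Āᵗ)⁻¹`. -/
def glUnitaryAux (m : ℕ) : GL (Fin m) ℂ →* GL (Fin m ⊕ Fin m) ℂ :=
  MonoidHom.toHomUnits
    { toFun := fun A => Matrix.fromBlocks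
        ((1 / 2 : ℂ) • (A.val + (A⁻¹.val)ᴴ)) ((1 / 2 : ℂ) • (A.val - (A⁻¹.val)ᴴ))
        ((1 / 2 : ℂ) • (A.val - (A⁻¹.val)ᴴ)) ((1 / 2 : ℂ) • (A.val + (A⁻¹.val)ᴴ))
      map_one' := by
        rw [← Matrix.fromBlocks_one]
        congr 1 <;> ext i j <;> simp <;> ring
      map_mul' := fun A B => by
        have h : ((A * B)⁻¹.val)ᴴ = (A⁻¹.val)ᴴ * (B⁻¹.val)ᴴ := by
          rw [mul_inv_rev, Units.val_mul, Matrix.conjTranspose_mul]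
        rw [h, Units.val_mul, Matrix.fromBlocks_multiply]
        congr 1 <;> ext i j <;>
          simp [Matrix.mul_apply, Finset.mul_sum, ← Finset.sum_add_distrib,
            ← Finset.sum_sub_distrib] <;>
          refine Finset.sum_congr rfl fun k _ => ?_ <;> ring }

/-- The inclusion `GL(m, ℂ) → U(m, m)`. In the basis `(e_j + f_j)/√2, (e_j - f_j)/√2` of isotropic
vectors it is `A ↦ diag(A, (Āᵗ)⁻¹)`. -/
def glUnitaryHom (m : ℕ) : GL (Fin m) ℂ →* unitaryGrp m m :=
  MonoidHom.codRestrict (glUnitaryAux m) (unitaryGrp m m) (fun A => by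
    change ((glUnitaryAux m A).val)ᴴ * sigMatrix _ _ * (glUnitaryAux m A).val = sigMatrix _ _
    have h1 : (A.val)ᴴ * (A⁻¹.val)ᴴ = 1 := by
      rw [← Matrix.conjTranspose_mul, Units.inv_mul, Matrix.conjTranspose_one]
    have h2 : A⁻¹.val * A.val = 1 := Units.inv_mul A
    have hv : (glUnitaryAux m A).val = Matrix.fromBlocks
        ((1 / 2 : ℂ) • (A.val + (A⁻¹.val)ᴴ)) ((1 / 2 : ℂ) • (A.val - (A⁻¹.val)ᴴ))
        ((1 / 2 : ℂ) • (A.val - (A⁻¹.val)ᴴ)) ((1 / 2 : ℂ) • (A.val + (A⁻¹.val)ᴴ)) := rfl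
    rw [hv, sigMatrix, Matrix.fromBlocks_conjTranspose, Matrix.fromBlocks_multiply,
      Matrix.fromBlocks_multiply]
    have hc : star (1 / 2 : ℂ) = 1 / 2 := by simp
    simp only [Matrix.conjTranspose_smul, Matrix.conjTranspose_add, Matrix.conjTranspose_sub,
      Matrix.conjTranspose_conjTranspose, hc, Matrix.mul_one, Matrix.mul_zero, add_zero, zero_add,
      Matrix.mul_neg, Matrix.neg_mul, Matrix.smul_mul, Matrix.mul_smul, Matrix.add_mul,
      Matrix.mul_add, Matrix.sub_mul, Matrix.mul_sub, h1, h2]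
    congr 1 <;> module)

/-- The coordinates `ℂ^{n, m-n} ⊕ ℂ^{m-n, n} ≃ ℂ^{m, m}` (positive directions to positive ones,
negative directions to negative ones). -/
def splitEquiv (m n : ℕ) (h : n ≤ m) :
    (Fin n ⊕ Fin (m - n)) ⊕ (Fin (m - n) ⊕ Fin n) ≃ Fin m ⊕ Fin m :=
  (Equiv.sumSumSumComm _ _ _ _).trans
    (Equiv.sumCongr
      (finSumFinEquiv.trans (finCongr (Nat.add_sub_cancel' h)))
      (finSumFinEquiv.trans (finCongr (Nat.sub_add_cancel h))))

/-- `(A, B) ↦ diag(A, B)` in the coordinates of `splitEquiv`. -/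
def unitaryProdAux (m n : ℕ) (h : n ≤ m) :
    unitaryGrp n (m - n) × unitaryGrp (m - n) n →* GL (Fin m ⊕ Fin m) ℂ :=
  MonoidHom.toHomUnits
    { toFun := fun x => Matrix.reindex (splitEquiv m n h) (splitEquiv m n h)
        (Matrix.fromBlocks x.1.val.val 0 0 x.2.val.val)
      map_one' := by simp
      map_mul' := fun x y => by
        simp [Matrix.submatrix_mul_equiv, Matrix.fromBlocks_multiply] }

/-- The inclusion `U(n, m-n) × U(m-n, n) → U(m, m)` given by the orthogonal sum
`ℂ^{n, m-n} ⊕ ℂ^{m-n, n} ≃ ℂ^{m, m}` of Hermitian spaces. -/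
def unitaryProdHom (m n : ℕ) (h : n ≤ m) :
    unitaryGrp n (m - n) × unitaryGrp (m - n) n →* unitaryGrp m m :=
  MonoidHom.codRestrict (unitaryProdAux m n h) (unitaryGrp m m) (fun x => by
    change ((unitaryProdAux m n h x).val)ᴴ * sigMatrix _ _ * (unitaryProdAux m n h x).val =
      sigMatrix _ _
    have hv : (unitaryProdAux m n h x).val =
      Matrix.reindex (splitEquiv m n h) (splitEquiv m n h)
        (Matrix.fromBlocks x.1.val.val 0 0 x.2.val.val) := rfl
    have hs : sigMatrix (Fin m) (Fin m) =
      Matrix.reindex (splitEquiv m n h) (splitEquiv m n h)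
        (Matrix.fromBlocks (sigMatrix (Fin n) (Fin (m - n))) 0 0
          (sigMatrix (Fin (m - n)) (Fin n))) := by
      rw [← Equiv.symm_apply_eq]
      ext i j
      rcases i with (i | i) | (i | i) <;> rcases j with (j | j) | (j | j) <;>
        simp [sigMatrix, splitEquiv, Matrix.one_apply, Fin.ext_iff] <;> omega
    have hx1 : (x.1.val.val)ᴴ * sigMatrix _ _ * x.1.val.val = sigMatrix _ _ := x.1.2
    have hx2 : (x.2.val.val)ᴴ * sigMatrix _ _ * x.2.val.val = sigMatrix _ _ := x.2.2
    rw [hv, hs]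
    simp only [Matrix.reindex_apply, Matrix.conjTranspose_submatrix, Matrix.submatrix_mul_equiv,
      Matrix.fromBlocks_conjTranspose, Matrix.fromBlocks_multiply, Matrix.conjTranspose_zero,
      Matrix.mul_zero, Matrix.zero_mul, add_zero, zero_add, hx1, hx2])

end Groups

end

/-!
That integrable structures are the smooth sections satisfying (ii) is a matter of unfolding
definitions. The content of the theorem is that the subsets `𝓑` of `End(𝕋M)` are smooth fibre
bundles with fibre `G/H`. The proof has three parts.

**From a point to the manifold.** Near each point there is a smooth frame of `TM` in which the
symplectic form is constant (`SymplecticForm.exists_frame`): the endomorphism comparing the form at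
`p` with the form at the base point is self-adjoint for the latter and near the identity, so its
smooth square root (`exists_smooth_sqrt`) gives the required isometry. Condition (i) is natural
under symplectic isomorphisms, so in such a frame the fibres of `𝓑` do not depend on the point. It
remains to describe one fibre as a homogeneous space in the smooth sense, that is, as an orbit of
`G` under conjugation whose orbit map has smooth local sections (`IsHomogeneousModel`,
`isFiberBundleWithFiber_of_model`).

**Linear algebra.** An endomorphism of square `-1` of a real space is always split, and an
involution is split exactly when its trace vanishes (`isSplit_iff_trace`).

If `λℓ = 1`, then `I₊` is an involution whose eigenspaces are the graphs of `±ω♭`. They are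
isotropic for `b`, hence in duality (`exists_splitForm_equiv`), and a skew operator commuting with
`I₊` is of the form `(A, -Aᵀ)` for a `2m × 2m` matrix `A`. Condition (i) says that `A` is a
traceless involution or a complex structure, and each of these is a single conjugacy class of
`GL(2m, ℝ)`.

If `λℓ = -1`, then `I₋` is a complex structure which together with `b` makes `T ⊕ T*` a Hermitian
space. The form is neutral because `(u, σ) ↦ (u, -σ)` negates it, so the space is `ℂ^{m,m}`
(`exists_unitary_equiv`). Now `S` is a complex-linear, traceless, skew-adjoint operator of square
`λ`. For `λ = 1` its eigenspaces are isotropic and in duality; for `λ = -1` they are orthogonal, and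
the signatures of the Hermitian form on them are determined by that of `β_S`. In either case `S` is
conjugate under `U(m, m)` to a normal form (`exists_unitary_conj_swap`,
`exists_unitary_conj_splitInvolution`).

**Local sections.** If `x` is near `x₀` and `x² = x₀² = ε` with `ε = ±1`, then `h = (1 + ε x x₀)/2`
is invertible and `x h = h x₀`, so `h` conjugates `x₀` into `x` and depends smoothly on `x`
(`isHomogeneousModel_gl`). For the unitary groups `h` is replaced by its unitary part
`h (h† h)^(-1/2)`, where `h†` is the adjoint for the Hermitian form (`isHomogeneousModel_unitary`).
-/

/-! ### Smooth square roots near the identity -/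

section SquareRoot

open Topology Filter

/-- In a Banach algebra squaring is a local diffeomorphism at `1`, since its derivative there is
`2 • id`. -/
theorem exists_smooth_sqrt (𝔸 : Type*) [NormedRing 𝔸] [NormedAlgebra ℝ 𝔸] [CompleteSpace 𝔸] :
    ∃ (s : 𝔸 → 𝔸) (W O : Set 𝔸), IsOpen W ∧ 1 ∈ W ∧ IsOpen O ∧ 1 ∈ O ∧
      ContDiffOn ℝ ∞ s W ∧ s 1 = 1 ∧ (∀ y ∈ W, s y * s y = y) ∧
      ∀ a ∈ O, s (a * a) = a := by
  have hf : ContDiff ℝ ∞ (fun a : 𝔸 => a * a) := contDiff_id.mul contDiff_id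
  let f' : 𝔸 ≃L[ℝ] 𝔸 := ContinuousLinearEquiv.smulLeft (Units.mk0 (2 : ℝ) two_ne_zero)
  have hf' : HasFDerivAt (fun a : 𝔸 => a * a) (f' : 𝔸 →L[ℝ] 𝔸) 1 := by
    have h := (hasFDerivAt_id (𝕜 := ℝ) (1 : 𝔸)).mul' (hasFDerivAt_id (𝕜 := ℝ) (1 : 𝔸))
    refine HasFDerivAt.congr_fderiv h ?_
    ext a
    change (1 : 𝔸) * a + a * 1 = (2 : ℝ) • a
    rw [one_mul, mul_one, two_smul]
  have h1 : (∞ : WithTop ℕ∞) ≠ 0 := by simp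
  have hc : ContDiffAt ℝ ∞ (fun a : 𝔸 => a * a) 1 := hf.contDiffAt
  let Φ := hc.toOpenPartialHomeomorph _ hf' h1
  have hΦ : ∀ a, Φ a = a * a := fun a => by
    rw [show (Φ : 𝔸 → 𝔸) = _ from hc.toOpenPartialHomeomorph_coe hf' h1]
  have hsrc : (1 : 𝔸) ∈ Φ.source := hc.mem_toOpenPartialHomeomorph_source hf' h1
  have htgt : (1 : 𝔸) ∈ Φ.target := by
    have := Φ.map_source hsrc
    rwa [hΦ, mul_one] at this
  have hs1 : Φ.symm 1 = 1 := by
    have := Φ.left_inv hsrc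
    rwa [hΦ, mul_one] at this
  have hsm : ContDiffAt ℝ ∞ Φ.symm 1 := by
    refine Φ.contDiffAt_symm (f₀' := f') htgt ?_ ?_
    · rw [hs1, show (Φ : 𝔸 → 𝔸) = _ from hc.toOpenPartialHomeomorph_coe hf' h1]; exact hf'
    · rw [show (Φ : 𝔸 → 𝔸) = _ from hc.toOpenPartialHomeomorph_coe hf' h1]; exact hf.contDiffAt
  -- The derivative stays invertible near `1`, so the inverse is smooth at all nearby points.
  have hinv : ∀ᶠ a : 𝔸 in 𝓝 1, ∃ g : 𝔸 ≃L[ℝ] 𝔸,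
      (g : 𝔸 →L[ℝ] 𝔸) = fderiv ℝ (fun a : 𝔸 => a * a) a := by
    have hcont : ContinuousAt (fun a : 𝔸 => fderiv ℝ (fun a : 𝔸 => a * a) a) 1 :=
      (hf.continuous_fderiv h1).continuousAt
    have hmem : Set.range ((↑) : (𝔸 ≃L[ℝ] 𝔸) → 𝔸 →L[ℝ] 𝔸) ∈
        𝓝 (fderiv ℝ (fun a : 𝔸 => a * a) 1) := by
      rw [hf'.fderiv]
      exact ContinuousLinearEquiv.nhds f'
    exact hcont hmem
  have hev : ∀ᶠ y : 𝔸 in 𝓝 1, y ∈ Φ.target ∧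
      ∃ g : 𝔸 ≃L[ℝ] 𝔸, (g : 𝔸 →L[ℝ] 𝔸) = fderiv ℝ (fun a : 𝔸 => a * a) (Φ.symm y) := by
    refine Filter.Eventually.and (Φ.open_target.mem_nhds htgt) ?_
    have : Tendsto Φ.symm (𝓝 1) (𝓝 1) := by
      simpa [ContinuousAt, hs1] using hsm.continuousAt
    exact this hinv
  obtain ⟨W, hWsub, hWo, hW1⟩ := mem_nhds_iff.1 hev
  refine ⟨Φ.symm, W, Φ.source, hWo, hW1, Φ.open_source, hsrc, ?_, hs1, ?_, ?_⟩
  · intro y hy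
    obtain ⟨hyt, g, hg⟩ := hWsub hy
    refine (Φ.contDiffAt_symm (f₀' := g) hyt ?_ ?_).contDiffWithinAt
    · rw [show (Φ : 𝔸 → 𝔸) = _ from hc.toOpenPartialHomeomorph_coe hf' h1, hg]
      exact (hf.differentiable h1 _).hasFDerivAt
    · rw [show (Φ : 𝔸 → 𝔸) = _ from hc.toOpenPartialHomeomorph_coe hf' h1]; exact hf.contDiffAt
  · intro y hy
    rw [← hΦ]; exact Φ.right_inv (hWsub hy).1
  · intro a ha
    rw [← hΦ]; exact Φ.left_inv ha

/-- A square root `s` as in `exists_smooth_sqrt` commutes, near `1`, with every continuous map `φ`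
that respects squares. -/
theorem sqrt_fixed {𝔸 : Type*} [NormedRing 𝔸] {s : 𝔸 → 𝔸} {W O : Set 𝔸} (hW : IsOpen W)
    (hW1 : 1 ∈ W) (hO : IsOpen O) (hO1 : 1 ∈ O) (hs : ContinuousOn s W) (hs1 : s 1 = 1)
    (hsq : ∀ y ∈ W, s y * s y = y) (huniq : ∀ a ∈ O, s (a * a) = a) {φ : 𝔸 → 𝔸}
    (hφ : Continuous φ) (hφ1 : φ 1 = 1) (hφsq : ∀ a, φ (a * a) = φ a * φ a) :
    ∀ᶠ y in 𝓝 (1 : 𝔸), φ y = y → φ (s y) = s y := by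
  have hWn : W ∈ 𝓝 (1 : 𝔸) := hW.mem_nhds hW1
  have hc : ContinuousAt (fun y => φ (s y)) 1 :=
    hφ.continuousAt.comp (hs.continuousAt hWn)
  have hc' : ∀ᶠ y in 𝓝 (1 : 𝔸), φ (s y) ∈ O := by
    refine hc (hO.mem_nhds ?_)
    simpa only [hs1, hφ1] using hO1
  filter_upwards [hWn, hc'] with y hyW hyO hy
  rw [← huniq _ hyO, ← hφsq, hsq y hyW, hy]

end SquareRoot

/-! ### Isometries of symplectic forms and smooth symplectic frames -/

section SymplecticFrames

open Topology Filter

/-- The isomorphism `T ⊕ T* ≃ T' ⊕ T'*` induced by an isomorphism `T ≃ T'`. -/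
noncomputable def extendedEquiv {T T' : Type*} [AddCommGroup T] [Module ℝ T] [TopologicalSpace T]
    [IsTopologicalAddGroup T] [ContinuousSMul ℝ T] [AddCommGroup T'] [Module ℝ T']
    [TopologicalSpace T'] [IsTopologicalAddGroup T'] [ContinuousSMul ℝ T'] (f : T ≃L[ℝ] T') :
    (T × (T →L[ℝ] ℝ)) ≃L[ℝ] (T' × (T' →L[ℝ] ℝ)) :=
  f.prodCongr (f.arrowCongr (ContinuousLinearEquiv.refl ℝ ℝ))

set_option synthInstance.maxHeartbeats 200000 in
/-- Nearby symplectic forms on a vector space are isometric to a fixed one, by isometries that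
depend smoothly on the form: if `η = η₀ (N ·, ·)`, then the square root of `N` does it, as it is
self-adjoint for `η₀`. -/
theorem exists_smooth_isometry {E : Type*} [NormedAddCommGroup E] [NormedSpace ℝ E]
    [FiniteDimensional ℝ E] (η₀ : E →L[ℝ] E →L[ℝ] ℝ) (halt : ∀ u, η₀ u u = 0)
    (hnd : ∀ u, (∀ v, η₀ u v = 0) → u = 0) :
    ∃ (W : Set (E →L[ℝ] E →L[ℝ] ℝ)) (R R' : (E →L[ℝ] E →L[ℝ] ℝ) → (E →L[ℝ] E)),
      IsOpen W ∧ η₀ ∈ W ∧ ContDiffOn ℝ ∞ R W ∧ ContDiffOn ℝ ∞ R' W ∧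
      (∀ η ∈ W, R η * R' η = 1 ∧ R' η * R η = 1) ∧
      ∀ η ∈ W, (∀ u, η u u = 0) → ∀ u v, η₀ (R η u) (R η v) = η u v := by
  have : CompleteSpace E := FiniteDimensional.complete ℝ E
  obtain ⟨hl, hr⟩ := inverse_flat η₀ hnd
  obtain ⟨s, W₀, O, hW₀, hW1, hO, hO1, hs, hs1, hsq, huniq⟩ := exists_smooth_sqrt (E →L[ℝ] E)
  have hinj : ∀ u u', (∀ v, η₀ u v = η₀ u' v) → u = u' := fun u u' h =>
    sub_eq_zero.1 (hnd _ fun v => by simp [h v])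
  let pre : (E →L[ℝ] E) →L[ℝ] ((E →L[ℝ] ℝ) →L[ℝ] (E →L[ℝ] ℝ)) :=
    (ContinuousLinearMap.compL ℝ E E ℝ).flip
  let φ : (E →L[ℝ] E) → (E →L[ℝ] E) := fun A => η₀.inverse ∘L pre A ∘L η₀
  have hφ : ∀ A u v, η₀ (φ A u) v = η₀ u (A v) := fun A u v => by
    change η₀ (η₀.inverse (pre A (η₀ u))) v = _
    rw [hr]; rfl
  have hφc : Continuous φ := by fun_prop
  have hφ1 : φ 1 = 1 := by
    ext1 u
    exact hinj _ _ fun v => by rw [hφ]; rfl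
  have hφsq : ∀ A, φ (A * A) = φ A * φ A := fun A => by
    ext1 u
    exact hinj _ _ fun v => by
      change _ = η₀ (φ A (φ A u)) v
      rw [hφ, hφ, hφ]; rfl
  let N : (E →L[ℝ] E →L[ℝ] ℝ) → (E →L[ℝ] E) := fun η => η₀.inverse ∘L η
  have hNη : ∀ η u v, η₀ (N η u) v = η u v := fun η u v => by
    change η₀ (η₀.inverse (η u)) v = _
    rw [hr]
  have hN : ContDiff ℝ ∞ N :=
    contDiff_const.clm_comp contDiff_id
  have hN0 : N η₀ = 1 := by
    ext1 u
    exact hl u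
  have hev : ∀ᶠ y in 𝓝 (1 : E →L[ℝ] E), (φ y = y → φ (s y) = s y) ∧ y ∈ W₀ ∧ IsUnit (s y) := by
    refine (sqrt_fixed hW₀ hW1 hO hO1 hs.continuousOn hs1 hsq huniq hφc hφ1 hφsq).and
      (Filter.Eventually.and (hW₀.mem_nhds hW1) ?_)
    have hc : ContinuousAt s 1 := hs.continuousOn.continuousAt (hW₀.mem_nhds hW1)
    refine hc (Units.isOpen.mem_nhds ?_)
    rw [hs1]; exact isUnit_one
  obtain ⟨W₁, hW₁, hW₁o, hW₁1⟩ := mem_nhds_iff.1 hev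
  have hR : ContDiffOn ℝ ∞ (fun η => s (N η)) (N ⁻¹' W₁) :=
    hs.comp hN.contDiffOn fun η hη => (hW₁ hη).2.1
  refine ⟨N ⁻¹' W₁, fun η => s (N η), fun η => Ring.inverse (s (N η)),
    hW₁o.preimage hN.continuous, ?_, hR, ?_, ?_, ?_⟩
  · change N η₀ ∈ W₁
    rwa [hN0]
  · intro η hη
    obtain ⟨w, hw⟩ := (hW₁ hη).2.2
    refine ContDiffAt.comp_contDiffWithinAt (g := Ring.inverse) η ?_ (hR η hη)
    rw [← hw]
    exact contDiffAt_ringInverse ℝ w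
  · intro η hη
    exact ⟨Ring.mul_inverse_cancel _ (hW₁ hη).2.2, Ring.inverse_mul_cancel _ (hW₁ hη).2.2⟩
  · intro η hη hηalt u v
    have hskew : ∀ (τ : E →L[ℝ] E →L[ℝ] ℝ), (∀ u, τ u u = 0) → ∀ u v, τ u v = -τ v u := by
      intro τ hτ u v
      have := hτ (u + v)
      simp only [map_add, add_apply, hτ, zero_add, add_zero] at this
      linarith
    have hfix : φ (N η) = N η := by
      ext1 u
      refine hinj _ _ fun v => ?_
      rw [hφ, hNη, hskew η₀ halt, hNη, hskew η hηalt v u, neg_neg]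
    have hsfix := (hW₁ hη).1 hfix
    rw [← hφ, hsfix, ← mul_apply_eq_comp, hsq _ (hW₁ hη).2.1, hNη]

end SymplecticFrames

/-! ### Fibre bundles from homogeneous models of their fibres -/

section Bundles

variable {d : ℕ} {M : Type*} [TopologicalSpace M] [ChartedSpace (EuclideanSpace ℝ (Fin d)) M]
  {V : Type*} [NormedAddCommGroup V] [NormedSpace ℝ V] {G : Type*} [Group G]

/-- The set `𝓕` in a normed space is smoothly identified with `G/H`: there is a smooth orbit map
`o : G → 𝓕`, onto, whose fibres are the cosets of `H`, and which has smooth local sections. -/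
def IsHomogeneousModel {X : Type*} [NormedAddCommGroup X] [NormedSpace ℝ X] (ρ : G → V)
    (H : Subgroup G) (𝓕 : Set X) : Prop :=
  ∃ o : G → X, Set.range o = 𝓕 ∧ (∀ g g', o g = o g' ↔ g⁻¹ * g' ∈ H) ∧
    (∃ F₀ : V → X, ContDiffOn ℝ ∞ F₀ (Set.range ρ) ∧ ∀ g, F₀ (ρ g) = o g) ∧
    ∀ x₀ ∈ 𝓕, ∃ N : Set X, IsOpen N ∧ x₀ ∈ N ∧ ∃ γ : X → G,
      ContDiffOn ℝ ∞ (fun x => ρ (γ x)) (𝓕 ∩ N) ∧ ∀ x ∈ 𝓕 ∩ N, o (γ x) = x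

/-- Homogeneous models can be transported along linear maps which restrict to mutually inverse
bijections. -/
theorem IsHomogeneousModel.transport {X X' : Type*} [NormedAddCommGroup X] [NormedSpace ℝ X]
    [NormedAddCommGroup X'] [NormedSpace ℝ X'] {ρ : G → V} {H : Subgroup G} {𝓕 : Set X}
    {𝓕' : Set X'} (h : IsHomogeneousModel ρ H 𝓕') (L : X' →L[ℝ] X) (L' : X →L[ℝ] X')
    (hL : ∀ x ∈ 𝓕', L x ∈ 𝓕) (hL' : ∀ x ∈ 𝓕, L' x ∈ 𝓕') (h1 : ∀ x ∈ 𝓕', L' (L x) = x)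
    (h2 : ∀ x ∈ 𝓕, L (L' x) = x) : IsHomogeneousModel ρ H 𝓕 := by
  obtain ⟨o, ho, hH, ⟨F₀, hF₀, hF₀o⟩, hloc⟩ := h
  have hmem : ∀ g, o g ∈ 𝓕' := fun g => ho ▸ Set.mem_range_self g
  refine ⟨fun g => L (o g), ?_, fun g g' => ?_, ⟨fun v => L (F₀ v), L.contDiff.comp_contDiffOn hF₀,
    fun g => congrArg L (hF₀o g)⟩, fun x₀ hx₀ => ?_⟩
  · ext x
    constructor
    · rintro ⟨g, rfl⟩
      exact hL _ (hmem g)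
    · intro hx
      obtain ⟨g, hg⟩ : L' x ∈ Set.range o := ho ▸ hL' x hx
      exact ⟨g, (congrArg L hg).trans (h2 x hx)⟩
  · rw [← hH]
    exact ⟨fun e => (h1 _ (hmem g)).symm.trans ((congrArg L' e).trans (h1 _ (hmem g'))),
      fun e => congrArg L e⟩
  · obtain ⟨N, hN, hxN, γ, hγ, hoγ⟩ := hloc _ (hL' x₀ hx₀)
    refine ⟨L' ⁻¹' N, hN.preimage L'.continuous, hxN, fun x => γ (L' x),
      hγ.comp L'.contDiff.contDiffOn fun x hx => ⟨hL' x hx.1, hx.2⟩, fun x hx => ?_⟩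
    exact (congrArg L (hoγ _ ⟨hL' x hx.1, hx.2⟩)).trans (h2 x hx.1)

variable [IsManifold (𝓡 d) ∞ M]

variable (d M) in
/-- The trivialization of `TM` at `p₀`. -/
noncomputable abbrev tangentTriv (p₀ : M) :=
  trivializationAt (EuclideanSpace ℝ (Fin d)) (TangentSpace (𝓡 d) : M → Type) p₀

variable (d M) in
/-- The trivialization of `End(𝕋M)` at `p₀`. -/
noncomputable abbrev endTriv (p₀ : M) :=
  trivializationAt (ETModel d →L[ℝ] ETModel d) (fun p : M => ET d p →L[ℝ] ET d p) p₀

/-- In the trivialization of `End(𝕋M)`, the fibre over `p` is identified by conjugation with the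
extension to `𝕋` of the trivialization of `TM`. -/
theorem endTriv_apply (p₀ p : M) (hp : p ∈ (tangentTriv d M p₀).baseSet)
    (S : ET d p →L[ℝ] ET d p) :
    (endTriv d M p₀ ⟨p, S⟩).2 =
      (extendedEquiv ((tangentTriv d M p₀).continuousLinearEquivAt ℝ p hp) :
        ET d p →L[ℝ] ETModel d) ∘L S ∘L
      ((extendedEquiv ((tangentTriv d M p₀).continuousLinearEquivAt ℝ p hp)).symm :
        ETModel d →L[ℝ] ET d p) := by
  have hp' : p ∈ (trivializationAt (ETModel d) (fun p : M => ET d p) p₀).baseSet :=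
    ⟨hp, hp, Set.mem_univ _⟩
  have key : (trivializationAt (ETModel d) (fun p : M => ET d p) p₀).continuousLinearEquivAt
      ℝ p hp' = extendedEquiv ((tangentTriv d M p₀).continuousLinearEquivAt ℝ p hp) := by
    refine ContinuousLinearEquiv.ext (funext fun x => ?_)
    refine Prod.ext rfl ?_
    change (trivializationAt (EuclideanSpace ℝ (Fin d) →L[ℝ] ℝ)
      (fun p : M => TangentSpace (𝓡 d) p →L[ℝ] ℝ) p₀ ⟨p, x.2⟩).2 = _
    rw [hom_trivializationAt_apply, ContinuousLinearMap.inCoordinates_eq hp (Set.mem_univ _)]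
    ext v
    rfl
  rw [hom_trivializationAt_apply, ContinuousLinearMap.inCoordinates_eq hp' hp', key]

theorem mem_endTriv_baseSet {p₀ p : M} (hp : p ∈ (tangentTriv d M p₀).baseSet) :
    p ∈ (endTriv d M p₀).baseSet :=
  ⟨⟨hp, hp, Set.mem_univ _⟩, ⟨hp, hp, Set.mem_univ _⟩⟩

/-- The coordinate expression of a symplectic form in the trivialization of `TM` at `p₀`. -/
noncomputable def SymplecticForm.coord (Ω : SymplecticForm d M) (p₀ p : M) :
    EuclideanSpace ℝ (Fin d) →L[ℝ] EuclideanSpace ℝ (Fin d) →L[ℝ] ℝ :=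
  (trivializationAt (EuclideanSpace ℝ (Fin d) →L[ℝ] EuclideanSpace ℝ (Fin d) →L[ℝ] ℝ)
    (fun p : M => TangentSpace (𝓡 d) p →L[ℝ] TangentSpace (𝓡 d) p →L[ℝ] ℝ) p₀ ⟨p, Ω.form p⟩).2

theorem SymplecticForm.coord_apply (Ω : SymplecticForm d M) (p₀ p : M)
    (hp : p ∈ (tangentTriv d M p₀).baseSet) (u v : TangentSpace (𝓡 d) p) :
    Ω.coord p₀ p ((tangentTriv d M p₀).continuousLinearEquivAt ℝ p hp u)
      ((tangentTriv d M p₀).continuousLinearEquivAt ℝ p hp v) = Ω.form p u v := by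
  have hp' : p ∈ (trivializationAt (EuclideanSpace ℝ (Fin d) →L[ℝ] ℝ)
    (fun p : M => TangentSpace (𝓡 d) p →L[ℝ] ℝ) p₀).baseSet := ⟨hp, Set.mem_univ _⟩
  rw [SymplecticForm.coord, hom_trivializationAt_apply, ContinuousLinearMap.inCoordinates_eq hp hp']
  simp only [ContinuousLinearMap.comp_apply, ContinuousLinearEquiv.coe_coe,
    ContinuousLinearEquiv.symm_apply_apply]
  change ((trivializationAt (EuclideanSpace ℝ (Fin d) →L[ℝ] ℝ)
    (fun p : M => TangentSpace (𝓡 d) p →L[ℝ] ℝ) p₀) ⟨p, Ω.form p u⟩).2 _ = _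
  rw [hom_trivializationAt_apply, ContinuousLinearMap.inCoordinates_eq hp (Set.mem_univ _)]
  simp only [ContinuousLinearMap.comp_apply, ContinuousLinearEquiv.coe_coe,
    ContinuousLinearEquiv.symm_apply_apply]
  rfl

set_option synthInstance.maxHeartbeats 200000 in
theorem SymplecticForm.contMDiffOn_coord (Ω : SymplecticForm d M) (p₀ : M) :
    ContMDiffOn (𝓡 d) 𝓘(ℝ, EuclideanSpace ℝ (Fin d) →L[ℝ] EuclideanSpace ℝ (Fin d) →L[ℝ] ℝ) ∞
      (Ω.coord p₀) (tangentTriv d M p₀).baseSet := by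
  have hsub : (tangentTriv d M p₀).baseSet ⊆
    (trivializationAt (EuclideanSpace ℝ (Fin d) →L[ℝ] EuclideanSpace ℝ (Fin d) →L[ℝ] ℝ)
    (fun p : M => TangentSpace (𝓡 d) p →L[ℝ] TangentSpace (𝓡 d) p →L[ℝ] ℝ) p₀).baseSet :=
    fun p hp => ⟨hp, hp, Set.mem_univ _⟩
  exact (Trivialization.contMDiffOn_section_iff
    (trivializationAt (EuclideanSpace ℝ (Fin d) →L[ℝ] EuclideanSpace ℝ (Fin d) →L[ℝ] ℝ)
    (fun p : M => TangentSpace (𝓡 d) p →L[ℝ] TangentSpace (𝓡 d) p →L[ℝ] ℝ) p₀)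
    (tangentTriv d M p₀).open_baseSet hsub).1 Ω.smooth.contMDiffOn

set_option synthInstance.maxHeartbeats 200000 in
/-- Near each point of a symplectic manifold there is a smooth frame in which the form is constant,
here expressed as a smooth change `R` of the coordinates on `TM`. -/
theorem SymplecticForm.exists_frame (Ω : SymplecticForm d M) (p₀ : M) :
    ∃ (η₀ : EuclideanSpace ℝ (Fin d) →L[ℝ] EuclideanSpace ℝ (Fin d) →L[ℝ] ℝ) (U : Set M)
      (R R' : M → (EuclideanSpace ℝ (Fin d) →L[ℝ] EuclideanSpace ℝ (Fin d))),
      (∀ u, η₀ u u = 0) ∧ (∀ u, (∀ v, η₀ u v = 0) → u = 0) ∧ IsOpen U ∧ p₀ ∈ U ∧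
      U ⊆ (tangentTriv d M p₀).baseSet ∧
      ContMDiffOn (𝓡 d) 𝓘(ℝ, EuclideanSpace ℝ (Fin d) →L[ℝ] EuclideanSpace ℝ (Fin d)) ∞ R U ∧
      ContMDiffOn (𝓡 d) 𝓘(ℝ, EuclideanSpace ℝ (Fin d) →L[ℝ] EuclideanSpace ℝ (Fin d)) ∞ R' U ∧
      (∀ p ∈ U, R p * R' p = 1 ∧ R' p * R p = 1) ∧
      ∀ p ∈ U, ∀ u v, η₀ (R p u) (R p v) = Ω.coord p₀ p u v := by
  have hp₀ : p₀ ∈ (tangentTriv d M p₀).baseSet := FiberBundle.mem_baseSet_trivializationAt' p₀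
  have hcoord : ∀ p (hp : p ∈ (tangentTriv d M p₀).baseSet) (u v : EuclideanSpace ℝ (Fin d)),
      Ω.coord p₀ p u v = Ω.form p
        (((tangentTriv d M p₀).continuousLinearEquivAt ℝ p hp).symm u)
        (((tangentTriv d M p₀).continuousLinearEquivAt ℝ p hp).symm v) := by
    intro p hp u v
    rw [← Ω.coord_apply p₀ p hp, ContinuousLinearEquiv.apply_symm_apply,
      ContinuousLinearEquiv.apply_symm_apply]
  have halt : ∀ p ∈ (tangentTriv d M p₀).baseSet, ∀ u, Ω.coord p₀ p u u = 0 := fun p hp u => by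
    rw [hcoord p hp, Ω.alternating]
  have hnd : ∀ u, (∀ v, Ω.coord p₀ p₀ u v = 0) → u = 0 := by
    intro u hu
    have := Ω.nondegenerate p₀ (((tangentTriv d M p₀).continuousLinearEquivAt ℝ p₀ hp₀).symm u)
      fun v => by
        have h := hu ((tangentTriv d M p₀).continuousLinearEquivAt ℝ p₀ hp₀ v)
        rwa [hcoord p₀ hp₀, ContinuousLinearEquiv.symm_apply_apply] at h
    exact (ContinuousLinearEquiv.map_eq_zero_iff _).1 this
  obtain ⟨W, R, R', hW, hW₀, hR, hR', hinv, hiso⟩ :=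
    exists_smooth_isometry (Ω.coord p₀ p₀) (halt p₀ hp₀) hnd
  have hc := Ω.contMDiffOn_coord p₀
  have hsub : (tangentTriv d M p₀).baseSet ∩ Ω.coord p₀ ⁻¹' W ⊆ (tangentTriv d M p₀).baseSet :=
    Set.inter_subset_left
  refine ⟨Ω.coord p₀ p₀, (tangentTriv d M p₀).baseSet ∩ Ω.coord p₀ ⁻¹' W,
    fun p => R (Ω.coord p₀ p), fun p => R' (Ω.coord p₀ p), halt p₀ hp₀, hnd,
    hc.continuousOn.isOpen_inter_preimage (tangentTriv d M p₀).open_baseSet hW, ⟨hp₀, hW₀⟩, hsub,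
    hR.contMDiffOn.comp (hc.mono hsub) fun p hp => hp.2,
    hR'.contMDiffOn.comp (hc.mono hsub) fun p hp => hp.2,
    fun p hp => hinv _ hp.2, fun p hp => hiso _ hp.2 (halt p hp.1)⟩

end Bundles

section BundleTheorem

open Topology

set_option synthInstance.maxHeartbeats 200000

/-- The operator on `E ⊕ E*` given by `A` on `E` and by the transpose of `B` on `E*`. -/
noncomputable def sumTranspose {E : Type*} [NormedAddCommGroup E] [NormedSpace ℝ E]
    (A B : E →L[ℝ] E) : (E × (E →L[ℝ] ℝ)) →L[ℝ] (E × (E →L[ℝ] ℝ)) :=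
  A.prodMap ((ContinuousLinearMap.compL ℝ E E ℝ).flip B)

theorem sumTranspose_apply {E : Type*} [NormedAddCommGroup E] [NormedSpace ℝ E]
    (A B : E →L[ℝ] E) (x : E × (E →L[ℝ] ℝ)) : sumTranspose A B x = (A x.1, x.2 ∘L B) :=
  rfl

theorem contDiff_sumTranspose {E : Type*} [NormedAddCommGroup E] [NormedSpace ℝ E] :
    ContDiff ℝ ∞ (fun x : (E →L[ℝ] E) × (E →L[ℝ] E) => sumTranspose x.1 x.2) := by
  have h : (fun x : (E →L[ℝ] E) × (E →L[ℝ] E) => sumTranspose x.1 x.2) = fun x =>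
      ContinuousLinearMap.inl ℝ E (E →L[ℝ] ℝ) ∘L (x.1 ∘L ContinuousLinearMap.fst ℝ E (E →L[ℝ] ℝ)) +
      ContinuousLinearMap.inr ℝ E (E →L[ℝ] ℝ) ∘L ((ContinuousLinearMap.compL ℝ E E ℝ).flip x.2 ∘L
        ContinuousLinearMap.snd ℝ E (E →L[ℝ] ℝ)) := by
    ext x : 1
    refine ContinuousLinearMap.ext fun y => ?_
    simp only [add_apply, ContinuousLinearMap.comp_apply, ContinuousLinearMap.inl_apply,
      ContinuousLinearMap.inr_apply, Prod.mk_add_mk, add_zero, zero_add]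
    rfl
  rw [h]
  refine (contDiff_const.clm_comp (contDiff_fst.clm_comp contDiff_const)).add
    (contDiff_const.clm_comp (ContDiff.clm_comp ?_ contDiff_const))
  exact (ContinuousLinearMap.contDiff _).comp contDiff_snd

theorem mul_conj_cancel {A : Type*} [Monoid A] {a b : A} (h : a * b = 1) (y : A) :
    a * (b * y * a) * b = y := by
  rw [show a * (b * y * a) * b = (a * b) * y * (a * b) by simp only [mul_assoc], h, one_mul,
    mul_one]

section HomBundle

variable {𝕜 B F₁ F₂ : Type*} {n : WithTop ℕ∞}
  {E₁ : B → Type*} {E₂ : B → Type*} [NontriviallyNormedField 𝕜]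
  [∀ x, AddCommGroup (E₁ x)] [∀ x, Module 𝕜 (E₁ x)] [NormedAddCommGroup F₁] [NormedSpace 𝕜 F₁]
  [TopologicalSpace (TotalSpace F₁ E₁)] [∀ x, TopologicalSpace (E₁ x)] [∀ x, AddCommGroup (E₂ x)]
  [∀ x, Module 𝕜 (E₂ x)] [NormedAddCommGroup F₂] [NormedSpace 𝕜 F₂]
  [TopologicalSpace (TotalSpace F₂ E₂)] [∀ x, TopologicalSpace (E₂ x)]
  {EB : Type*}
  [NormedAddCommGroup EB] [NormedSpace 𝕜 EB] {HB : Type*} [TopologicalSpace HB]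
  {IB : ModelWithCorners 𝕜 EB HB} [TopologicalSpace B] [ChartedSpace HB B]
  [FiberBundle F₁ E₁] [VectorBundle 𝕜 F₁ E₁]
  [FiberBundle F₂ E₂] [VectorBundle 𝕜 F₂ E₂]
  [∀ x, IsTopologicalAddGroup (E₂ x)] [∀ x, ContinuousSMul 𝕜 (E₂ x)]
  [ContMDiffVectorBundle n F₁ E₁ IB] [ContMDiffVectorBundle n F₂ E₂ IB]

/-- The trivializations of the bundle of homomorphisms are diffeomorphisms; for an abstract pair of
vector bundles the required instances are found quickly. -/
theorem contMDiffOn_hom_symm (x₀ : B) :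
    ContMDiffOn (IB.prod 𝓘(𝕜, F₁ →L[𝕜] F₂)) (IB.prod 𝓘(𝕜, F₁ →L[𝕜] F₂)) n
    (trivializationAt (F₁ →L[𝕜] F₂) (fun x => E₁ x →L[𝕜] E₂ x) x₀).toOpenPartialHomeomorph.symm
    (trivializationAt (F₁ →L[𝕜] F₂) (fun x => E₁ x →L[𝕜] E₂ x) x₀).target :=
  Trivialization.contMDiffOn_symm (F := F₁ →L[𝕜] F₂)
    (E := fun p => E₁ p →L[𝕜] E₂ p)
    (trivializationAt (F₁ →L[𝕜] F₂) (fun x => E₁ x →L[𝕜] E₂ x) x₀)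

theorem contMDiffOn_hom (x₀ : B) :
    ContMDiffOn (IB.prod 𝓘(𝕜, F₁ →L[𝕜] F₂)) (IB.prod 𝓘(𝕜, F₁ →L[𝕜] F₂)) n
    (trivializationAt (F₁ →L[𝕜] F₂) (fun x => E₁ x →L[𝕜] E₂ x) x₀)
    (trivializationAt (F₁ →L[𝕜] F₂) (fun x => E₁ x →L[𝕜] E₂ x) x₀).source :=
  Trivialization.contMDiffOn (F := F₁ →L[𝕜] F₂)
    (E := fun p => E₁ p →L[𝕜] E₂ p)
    (trivializationAt (F₁ →L[𝕜] F₂) (fun x => E₁ x →L[𝕜] E₂ x) x₀)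

end HomBundle

variable {d : ℕ} {M : Type*} [TopologicalSpace M] [ChartedSpace (EuclideanSpace ℝ (Fin d)) M]
  [IsManifold (𝓡 d) ∞ M]
  {V : Type*} [NormedAddCommGroup V] [NormedSpace ℝ V] {G : Type*} [Group G]

variable (d M) in
theorem contMDiffOn_endTriv_symm (p₀ : M) :
    ContMDiffOn ((𝓡 d).prod 𝓘(ℝ, ETModel d →L[ℝ] ETModel d))
      ((𝓡 d).prod 𝓘(ℝ, ETModel d →L[ℝ] ETModel d)) ∞
      (endTriv d M p₀).toOpenPartialHomeomorph.symm (endTriv d M p₀).target :=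
  contMDiffOn_hom_symm p₀

variable (d M) in
theorem contMDiffOn_endTriv (p₀ : M) :
    ContMDiffOn ((𝓡 d).prod 𝓘(ℝ, ETModel d →L[ℝ] ETModel d))
      ((𝓡 d).prod 𝓘(ℝ, ETModel d →L[ℝ] ETModel d)) ∞
      (endTriv d M p₀) (endTriv d M p₀).source :=
  contMDiffOn_hom p₀

/-- Near each point, conjugation by a smooth symplectic frame carries the fibres of a subset `B` of
`End(𝕋M)` to a constant set, if `B` is described in a way that is natural under symplectic
isomorphisms. -/
theorem exists_smooth_conjugation (Ω : SymplecticForm d M) {B : Set (EndTotal d M)}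
    (Fib : (EuclideanSpace ℝ (Fin d) →L[ℝ] EuclideanSpace ℝ (Fin d) →L[ℝ] ℝ) →
      Set (ETModel d →L[ℝ] ETModel d))
    (hB : ∀ (p : M) (η : EuclideanSpace ℝ (Fin d) →L[ℝ] EuclideanSpace ℝ (Fin d) →L[ℝ] ℝ)
      (f : TangentSpace (𝓡 d) p ≃L[ℝ] EuclideanSpace ℝ (Fin d)),
      (∀ u v, η (f u) (f v) = Ω.form p u v) → ∀ S : ET d p →L[ℝ] ET d p,
      ((⟨p, S⟩ : EndTotal d M) ∈ B ↔ (extendedEquiv f : ET d p →L[ℝ] ETModel d) ∘L S ∘L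
        ((extendedEquiv f).symm : ETModel d →L[ℝ] ET d p) ∈ Fib η)) (p₀ : M) :
    ∃ (η₀ : EuclideanSpace ℝ (Fin d) →L[ℝ] EuclideanSpace ℝ (Fin d) →L[ℝ] ℝ) (U : Set M)
      (θ θ' : M → (ETModel d →L[ℝ] ETModel d)),
      (∀ u, η₀ u u = 0) ∧ (∀ u, (∀ v, η₀ u v = 0) → u = 0) ∧ IsOpen U ∧ p₀ ∈ U ∧
      U ⊆ (endTriv d M p₀).baseSet ∧
      ContMDiffOn (𝓡 d) 𝓘(ℝ, ETModel d →L[ℝ] ETModel d) ∞ θ U ∧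
      ContMDiffOn (𝓡 d) 𝓘(ℝ, ETModel d →L[ℝ] ETModel d) ∞ θ' U ∧
      (∀ p ∈ U, θ p * θ' p = 1 ∧ θ' p * θ p = 1) ∧
      ∀ p ∈ U, ∀ S : ET d p →L[ℝ] ET d p, (⟨p, S⟩ : EndTotal d M) ∈ B ↔
        θ' p * (endTriv d M p₀ ⟨p, S⟩).2 * θ p ∈ Fib η₀ := by
  obtain ⟨η₀, U, R, R', halt, hnd, hU, hpU, hUb, hR, hR', hinv, hiso⟩ := Ω.exists_frame p₀
  have hmul : ∀ A B A' B' : EuclideanSpace ℝ (Fin d) →L[ℝ] EuclideanSpace ℝ (Fin d),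
      A * A' = 1 → B' * B = 1 → sumTranspose A B * sumTranspose A' B' = 1 := by
    intro A B A' B' h h'
    refine ContinuousLinearMap.ext fun x => ?_
    change sumTranspose A B (sumTranspose A' B' x) = x
    rw [sumTranspose_apply, sumTranspose_apply]
    refine Prod.ext ?_ ?_
    · exact congrArg (fun f : EuclideanSpace ℝ (Fin d) →L[ℝ] EuclideanSpace ℝ (Fin d) => f x.1) h
    · change x.2 ∘L (B' * B) = x.2
      rw [h']; rfl
  refine ⟨η₀, U, fun p => sumTranspose (R' p) (R p), fun p => sumTranspose (R p) (R' p), halt, hnd,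
    hU, hpU, fun p hp => mem_endTriv_baseSet (hUb hp),
    (contDiff_sumTranspose (E := EuclideanSpace ℝ (Fin d))).contMDiff.comp_contMDiffOn
      (hR'.prodMk_space hR),
    (contDiff_sumTranspose (E := EuclideanSpace ℝ (Fin d))).contMDiff.comp_contMDiffOn
      (hR.prodMk_space hR'),
    fun p hp => ⟨hmul _ _ _ _ (hinv p hp).2 (hinv p hp).2,
      hmul _ _ _ _ (hinv p hp).1 (hinv p hp).1⟩, ?_⟩
  intro p hp S
  let a := (tangentTriv d M p₀).continuousLinearEquivAt ℝ p (hUb hp)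
  let r : EuclideanSpace ℝ (Fin d) ≃L[ℝ] EuclideanSpace ℝ (Fin d) :=
    ContinuousLinearEquiv.equivOfInverse (R p) (R' p)
      (fun x => congrArg (fun f : EuclideanSpace ℝ (Fin d) →L[ℝ] EuclideanSpace ℝ (Fin d) => f x)
        (hinv p hp).2)
      (fun x => congrArg (fun f : EuclideanSpace ℝ (Fin d) →L[ℝ] EuclideanSpace ℝ (Fin d) => f x)
        (hinv p hp).1)
  have hf : ∀ u v, η₀ (a.trans r u) (a.trans r v) = Ω.form p u v := fun u v => by
    change η₀ (R p (a u)) (R p (a v)) = _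
    rw [hiso p hp]
    exact Ω.coord_apply p₀ p (hUb hp) u v
  rw [hB p η₀ (a.trans r) hf S, endTriv_apply p₀ p (hUb hp)]
  exact Iff.rfl

set_option maxHeartbeats 1600000 in
/-- If the fibres of `B` are, naturally under symplectic isomorphisms, homogeneous models of `G/H`,
then `B` is a smooth fibre bundle with fibre `G/H`. -/
theorem isFiberBundleWithFiber_of_model (Ω : SymplecticForm d M) {B : Set (EndTotal d M)}
    {ρ : G → V} {H : Subgroup G}
    (Fib : (EuclideanSpace ℝ (Fin d) →L[ℝ] EuclideanSpace ℝ (Fin d) →L[ℝ] ℝ) →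
      Set (ETModel d →L[ℝ] ETModel d))
    (hB : ∀ (p : M) (η : EuclideanSpace ℝ (Fin d) →L[ℝ] EuclideanSpace ℝ (Fin d) →L[ℝ] ℝ)
      (f : TangentSpace (𝓡 d) p ≃L[ℝ] EuclideanSpace ℝ (Fin d)),
      (∀ u v, η (f u) (f v) = Ω.form p u v) → ∀ S : ET d p →L[ℝ] ET d p,
      ((⟨p, S⟩ : EndTotal d M) ∈ B ↔ (extendedEquiv f : ET d p →L[ℝ] ETModel d) ∘L S ∘L
        ((extendedEquiv f).symm : ETModel d →L[ℝ] ET d p) ∈ Fib η))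
    (hmodel : ∀ η : EuclideanSpace ℝ (Fin d) →L[ℝ] EuclideanSpace ℝ (Fin d) →L[ℝ] ℝ,
      (∀ u, η u u = 0) → (∀ u, (∀ v, η u v = 0) → u = 0) → IsHomogeneousModel ρ H (Fib η)) :
    IsFiberBundleWithFiber B ρ H := by
  intro p₀
  obtain ⟨η₀, U, θ, θ', halt, hnd, hU, hpU, hUb, hθ, hθ', hinv, hmem⟩ :=
    exists_smooth_conjugation Ω Fib hB p₀
  obtain ⟨o, ho, hH, ⟨F₀, hF₀, hF₀o⟩, hloc⟩ := hmodel η₀ halt hnd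
  have hout : ∀ g : G, o (Quotient.out (g : G ⧸ H)) = o g := fun g =>
    (hH _ _).2 (QuotientGroup.eq.1 (QuotientGroup.out_eq' (g : G ⧸ H)))
  let e := endTriv d M p₀
  -- The model coordinate of a point of `End(𝕋M)`, and the point with a given coordinate.
  let k : EndTotal d M → (ETModel d →L[ℝ] ETModel d) := fun x => θ' x.proj * (e x).2 * θ x.proj
  let j : M × (ETModel d →L[ℝ] ETModel d) → EndTotal d M := fun x =>
    e.toOpenPartialHomeomorph.symm (x.1, θ x.1 * x.2 * θ' x.1)
  have hmemk : ∀ x : EndTotal d M, x.proj ∈ U → (x ∈ B ↔ k x ∈ Fib η₀) := fun x hx =>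
    hmem x.proj hx x.2
  have hjt : ∀ p ∈ U, ∀ y : ETModel d →L[ℝ] ETModel d, (p, y) ∈ e.target := fun p hp y =>
    e.mem_target.2 (hUb hp)
  have hjproj : ∀ p ∈ U, ∀ y, (j (p, y)).proj = p := fun p hp y =>
    e.proj_symm_apply (hjt p hp _)
  have hkj : ∀ p ∈ U, ∀ y, k (j (p, y)) = y := by
    intro p hp y
    change θ' (j (p, y)).proj * (e (j (p, y))).2 * θ (j (p, y)).proj = y
    rw [hjproj p hp y, show e (j (p, y)) = _ from e.apply_symm_apply (hjt p hp _)]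
    exact mul_conj_cancel (hinv p hp).2 y
  have hjk : ∀ x : EndTotal d M, x.proj ∈ U → j (x.proj, k x) = x := by
    intro x hx
    change e.toOpenPartialHomeomorph.symm (x.proj, θ x.proj * (θ' x.proj * (e x).2 * θ x.proj) *
      θ' x.proj) = x
    rw [mul_conj_cancel (hinv _ hx).1]
    exact e.symm_apply_mk_proj (e.mem_source.2 (hUb hx))
  let f : U × (G ⧸ H) → ({e | e ∈ B ∧ e.proj ∈ U} : Set (EndTotal d M)) := fun x =>
    ⟨j (x.1, o x.2.out), by
      have hp : (j (x.1, o x.2.out)).proj ∈ U := by rw [hjproj _ x.1.2]; exact x.1.2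
      refine ⟨(hmemk _ hp).2 ?_, hp⟩
      rw [hkj _ x.1.2, ← ho]
      exact Set.mem_range_self _⟩
  have hf : Function.Bijective f := by
    constructor
    · rintro ⟨p, q⟩ ⟨p', q'⟩ h
      have h' : j (p, o q.out) = j (p', o q'.out) := congrArg Subtype.val h
      have hp : (p : M) = p' := by
        rw [← hjproj p p.2 (o q.out), h', hjproj p' p'.2]
      have hq : o q.out = o q'.out := by
        rw [← hkj p p.2 (o q.out), h', hkj p' p'.2]
      refine Prod.ext (Subtype.ext hp) ?_
      rw [← QuotientGroup.out_eq' q, ← QuotientGroup.out_eq' q']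
      exact QuotientGroup.eq.2 ((hH _ _).1 hq)
    · rintro ⟨x, hxB, hxU⟩
      obtain ⟨g, hg⟩ : k x ∈ Set.range o := ho ▸ (hmemk x hxU).1 hxB
      refine ⟨(⟨x.proj, hxU⟩, (g : G ⧸ H)), Subtype.ext ?_⟩
      change j (x.proj, o (Quotient.out (g : G ⧸ H))) = x
      rw [hout, hg, hjk x hxU]
  refine ⟨U, hU, hpU, Equiv.ofBijective f hf, fun x => hjproj _ x.1.2 _,
    ⟨fun x => j (x.1, F₀ x.2), ?_, fun p g => ?_⟩, ?_⟩
  · have hfst : ContMDiffOn ((𝓡 d).prod 𝓘(ℝ, V)) (𝓡 d) ∞ (Prod.fst : M × V → M)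
        (U ×ˢ Set.range ρ) := contMDiffOn_fst
    have hsnd : ContMDiffOn ((𝓡 d).prod 𝓘(ℝ, V)) 𝓘(ℝ, V) ∞ (Prod.snd : M × V → V)
        (U ×ˢ Set.range ρ) := contMDiffOn_snd
    have h1 := hθ.comp hfst fun x hx => hx.1
    have h2 := hθ'.comp hfst fun x hx => hx.1
    have h3 := hF₀.contMDiffOn.comp hsnd fun x hx => hx.2
    have h4 := contMDiffOn_endTriv_symm d M p₀
    exact h4.comp (hfst.prodMk ((h1.clm_comp h3).clm_comp h2)) fun x hx => hjt x.1 hx.1 _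
  · change j (p, F₀ (ρ g)) = j (p, o (Quotient.out (g : G ⧸ H)))
    rw [hF₀o, hout]
  · intro x₀
    have hproj : ContMDiffOn ((𝓡 d).prod 𝓘(ℝ, ETModel d →L[ℝ] ETModel d)) (𝓡 d) ∞
        (TotalSpace.proj : EndTotal d M → M) (TotalSpace.proj ⁻¹' U) :=
      (contMDiff_proj _).contMDiffOn
    have hopen : IsOpen (TotalSpace.proj ⁻¹' U : Set (EndTotal d M)) :=
      hU.preimage (FiberBundle.continuous_proj _ _)
    have hk : ContMDiffOn ((𝓡 d).prod 𝓘(ℝ, ETModel d →L[ℝ] ETModel d))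
        𝓘(ℝ, ETModel d →L[ℝ] ETModel d) ∞ k (TotalSpace.proj ⁻¹' U) := by
      have h1 := hθ.comp hproj fun x hx => hx
      have h2 := hθ'.comp hproj fun x hx => hx
      have h3 := contMDiff_snd.comp_contMDiffOn ((contMDiffOn_endTriv d M p₀).mono
        fun x (hx : x ∈ TotalSpace.proj ⁻¹' U) => e.mem_source.2 (hUb hx))
      exact (h2.clm_comp h3).clm_comp h1
    obtain ⟨N, hN, hxN, γ, hγ, hoγ⟩ := hloc (k x₀) ((hmemk x₀ x₀.2.2).1 x₀.2.1)
    refine ⟨TotalSpace.proj ⁻¹' U ∩ k ⁻¹' N, hk.continuousOn.isOpen_inter_preimage hopen hN,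
      ⟨x₀.2.2, hxN⟩, fun x => γ (k x), ?_, ?_⟩
    · exact hγ.contMDiffOn.comp (hk.mono fun x hx => hx.2.1)
        fun x hx => ⟨(hmemk x hx.1.2).1 hx.1.1, hx.2.2⟩
    · intro x hx
      have hx' : f ((Equiv.ofBijective f hf).symm x) = x :=
        (Equiv.ofBijective f hf).apply_symm_apply x
      set y := (Equiv.ofBijective f hf).symm x
      have hy : o y.2.out = k x := by
        rw [← hx']
        exact (hkj _ y.1.2 _).symm
      change y.2 = (γ (k x) : G ⧸ H)
      rw [← QuotientGroup.out_eq' y.2]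
      refine QuotientGroup.eq.2 ((hH _ _).1 ?_)
      rw [hy]
      exact (hoγ _ ⟨(hmemk x x.2.2).1 x.2.1, hx.2⟩).symm

end BundleTheorem

/-! ### Split endomorphisms -/

section Split

/-- The trace of an involution is the difference of the dimensions of its eigenspaces. -/
theorem trace_of_involution {K V : Type*} [Field K] [CharZero K] [AddCommGroup V] [Module K V]
    [FiniteDimensional K V] (T : V →ₗ[K] V) (hT : T ∘ₗ T = LinearMap.id) :
    LinearMap.trace K V T = (Module.finrank K (Module.End.eigenspace T (1 : K)) : K) -
      Module.finrank K (Module.End.eigenspace T (-1 : K)) := by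
  have hT' : ∀ x, T (T x) = x := fun x => congrArg (fun f : V →ₗ[K] V => f x) hT
  have hmem : ∀ (a : K) x, x ∈ Module.End.eigenspace T a ↔ T x = a • x :=
    fun a x => Module.End.mem_eigenspace_iff
  let P : V →ₗ[K] V := (2⁻¹ : K) • (LinearMap.id + T)
  have hP : ∀ x, P x = (2⁻¹ : K) • (x + T x) := fun x => rfl
  have h2 : ∀ x : V, (2⁻¹ : K) • (x + x) = x := fun x => by
    rw [← two_smul K x, smul_smul, inv_mul_cancel₀ two_ne_zero, one_smul]
  have hproj : LinearMap.IsProj (Module.End.eigenspace T (1 : K)) P := by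
    refine ⟨fun x => ?_, fun x hx => ?_⟩
    · rw [hmem, hP, map_smul, map_add, hT', one_smul, add_comm]
    · rw [hmem, one_smul] at hx
      rw [hP, hx, h2]
  have hker : LinearMap.ker P = Module.End.eigenspace T (-1 : K) := by
    ext x
    rw [LinearMap.mem_ker, hmem, hP, smul_eq_zero_iff_right (inv_ne_zero two_ne_zero), neg_smul,
      one_smul, add_comm, add_eq_zero_iff_eq_neg]
  have htr : LinearMap.trace K V P = (Module.finrank K (Module.End.eigenspace T (1 : K)) : K) :=
    hproj.trace
  have hTP : T = (2 : K) • P - LinearMap.id := by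
    ext x
    rw [LinearMap.sub_apply, LinearMap.smul_apply, hP, smul_smul, mul_inv_cancel₀ two_ne_zero,
      one_smul, LinearMap.id_apply, add_sub_cancel_left]
  have hrn := LinearMap.finrank_range_add_finrank_ker P
  rw [hproj.range, hker] at hrn
  conv_lhs => rw [hTP]
  rw [map_sub, map_smul, htr, LinearMap.trace_id, ← hrn, smul_eq_mul]
  push_cast
  ring

/-- A real operator with square `-id` has eigenvalues `±i` of the same multiplicity: the difference
of the multiplicities is the trace of `-iT`, which is both real and imaginary. Hence such operators
are always split, and involutions are split if and only if they are traceless. -/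
theorem isSplit_iff {V : Type*} [AddCommGroup V] [Module ℝ V] [FiniteDimensional ℝ V]
    (T : V →ₗ[ℝ] V) : IsSplit T ↔
      (T ∘ₗ T = LinearMap.id ∧ LinearMap.trace ℝ V T = 0) ∨ T ∘ₗ T = -LinearMap.id := by
  refine or_congr ?_ ?_
  · refine and_congr_right fun h => ?_
    rw [trace_of_involution T h, sub_eq_zero, Nat.cast_inj]
  · refine ⟨fun h => h.1, fun h => ⟨h, ?_⟩⟩
    have hI : (LinearMap.baseChange ℂ T) ∘ₗ (LinearMap.baseChange ℂ T) = -LinearMap.id := by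
      rw [← LinearMap.baseChange_comp, h, LinearMap.baseChange_neg, LinearMap.baseChange_id]
    set J := (-Complex.I) • LinearMap.baseChange ℂ T with hJ
    have hJ2 : J ∘ₗ J = LinearMap.id := by
      rw [hJ, LinearMap.smul_comp, LinearMap.comp_smul, hI, smul_smul, smul_neg, ← neg_smul]
      simp
    have heig : ∀ a : ℂ, Module.End.eigenspace J a =
        Module.End.eigenspace (LinearMap.baseChange ℂ T) (Complex.I * a) := by
      intro a
      ext x
      rw [Module.End.mem_eigenspace_iff, Module.End.mem_eigenspace_iff, hJ, LinearMap.smul_apply]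
      constructor
      · intro hx
        rw [mul_smul, ← hx, smul_smul]
        simp
      · intro hx
        rw [hx, smul_smul, ← mul_assoc]
        simp
    have htr := trace_of_involution J hJ2
    rw [hJ, map_smul, ← hJ, heig, heig, mul_one, mul_neg_one,
      LinearMap.trace_baseChange] at htr
    have him := congrArg Complex.re htr
    simp only [smul_eq_mul, Complex.coe_algebraMap, Complex.mul_re, Complex.neg_re, Complex.I_re,
      Complex.neg_im, Complex.I_im, Complex.ofReal_re, Complex.ofReal_im, Complex.sub_re,
      Complex.natCast_re, mul_zero] at him
    have him' : (Module.finrank ℂ (Module.End.eigenspace (LinearMap.baseChange ℂ T) Complex.I) : ℝ)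
      = Module.finrank ℂ (Module.End.eigenspace (LinearMap.baseChange ℂ T) (-Complex.I)) := by
      linarith
    exact_mod_cast him'

theorem isSplit_conj_iff {V W : Type*} [AddCommGroup V] [Module ℝ V] [FiniteDimensional ℝ V]
    [AddCommGroup W] [Module ℝ W] (e : V ≃ₗ[ℝ] W) (T : V →ₗ[ℝ] V) :
    IsSplit (e.conj T) ↔ IsSplit T := by
  have : FiniteDimensional ℝ W := LinearEquiv.finiteDimensional e
  have h1 : e.conj T ∘ₗ e.conj T = LinearMap.id ↔ T ∘ₗ T = LinearMap.id := by
    rw [← LinearEquiv.conj_comp, ← LinearEquiv.conj_id e, e.conj.injective.eq_iff]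
  have h2 : e.conj T ∘ₗ e.conj T = -LinearMap.id ↔ T ∘ₗ T = -LinearMap.id := by
    rw [← LinearEquiv.conj_comp, ← LinearEquiv.conj_id e, ← map_neg, e.conj.injective.eq_iff]
  rw [isSplit_iff, isSplit_iff, h1, h2, LinearMap.trace_conj']

/-- The conditions on a `(lam, ell)`-structure, for operators on an arbitrary real vector space with
a bilinear form `b` and an operator `I` in place of the canonical form and of `I_{lam ell}`. -/
structure IsSplitStructure {V : Type*} [AddCommGroup V] [Module ℝ V] (b : LinearMap.BilinForm ℝ V)
    (I : V →ₗ[ℝ] V) (lam : ℝ) (S : V →ₗ[ℝ] V) : Prop where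
  sq : S ∘ₗ S = lam • LinearMap.id
  split : IsSplit S
  skew : ∀ x y, b (S x) y = -b x (S y)
  comm : S ∘ₗ I = I ∘ₗ S
  split' : IsSplit (I ∘ₗ S)

theorem IsSplitStructure.conj {V W : Type*} [AddCommGroup V] [Module ℝ V] [FiniteDimensional ℝ V]
    [AddCommGroup W] [Module ℝ W] {b : LinearMap.BilinForm ℝ V} {b' : LinearMap.BilinForm ℝ W}
    {I : V →ₗ[ℝ] V} {I' : W →ₗ[ℝ] W} {lam : ℝ} (e : V ≃ₗ[ℝ] W)
    (hb : ∀ x y, b' (e x) (e y) = b x y) (hI : ∀ x, I' (e x) = e (I x)) {S : V →ₗ[ℝ] V}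
    (h : IsSplitStructure b I lam S) : IsSplitStructure b' I' lam (e.conj S) := by
  have hI' : I' = e.conj I := by
    ext x
    rw [LinearEquiv.conj_apply_apply, ← hI, e.apply_symm_apply]
  refine ⟨?_, (isSplit_conj_iff e S).2 h.split, fun x y => ?_, ?_, ?_⟩
  · rw [← LinearEquiv.conj_comp, h.sq, map_smul, LinearEquiv.conj_id]
  · have h1 := h.skew (e.symm x) (e.symm y)
    rw [← hb, ← hb, e.apply_symm_apply, e.apply_symm_apply] at h1
    exact h1
  · rw [hI', ← LinearEquiv.conj_comp, h.comm, LinearEquiv.conj_comp]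
  · rw [hI', ← LinearEquiv.conj_comp, isSplit_conj_iff]
    exact h.split'

/-- The conditions of `IsSplitStructure` are invariant under isometries that intertwine the
operators `I` and `I'`. -/
theorem isSplitStructure_conj_iff {V W : Type*} [AddCommGroup V] [Module ℝ V]
    [FiniteDimensional ℝ V] [AddCommGroup W] [Module ℝ W] {b : LinearMap.BilinForm ℝ V}
    {b' : LinearMap.BilinForm ℝ W} {I : V →ₗ[ℝ] V} {I' : W →ₗ[ℝ] W} {lam : ℝ} (e : V ≃ₗ[ℝ] W)
    (hb : ∀ x y, b' (e x) (e y) = b x y) (hI : ∀ x, I' (e x) = e (I x)) {S : V →ₗ[ℝ] V} :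
    IsSplitStructure b' I' lam (e.conj S) ↔ IsSplitStructure b I lam S := by
  have : FiniteDimensional ℝ W := LinearEquiv.finiteDimensional e
  refine ⟨fun h => ?_, fun h => h.conj e hb hI⟩
  have h' := h.conj e.symm (b' := b) (I' := I) (fun x y => ?_) fun x => ?_
  · have hS : e.symm.conj (e.conj S) = S := by
      ext x
      simp [LinearEquiv.conj_apply]
    rwa [hS] at h'
  · rw [← hb, e.apply_symm_apply, e.apply_symm_apply]
  · apply e.injective
    rw [← hI, e.apply_symm_apply, e.apply_symm_apply]

/-- The signature of a bilinear form is invariant under isomorphisms. -/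
theorem hasSignature_iff_of_equiv {V W : Type*} [AddCommGroup V] [Module ℝ V] [AddCommGroup W]
    [Module ℝ W] {β : LinearMap.BilinForm ℝ V} {β' : LinearMap.BilinForm ℝ W} (e : V ≃ₗ[ℝ] W)
    (h : ∀ x, β' (e x) (e x) = β x x) (p q : ℕ) : HasSignature β' p q ↔ HasSignature β p q := by
  have he : QuadraticMap.Equivalent (LinearMap.BilinMap.toQuadraticMap β)
      (LinearMap.BilinMap.toQuadraticMap β') := ⟨⟨e, fun x => h x⟩⟩
  rw [HasSignature, HasSignature, he.sigPos_eq, he.sigNeg_eq]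

end Split

/-! ### Naturality of the conditions under symplectic isomorphisms -/

section SlashFibers

variable {T : Type*} [AddCommGroup T] [Module ℝ T] [TopologicalSpace T] [IsTopologicalAddGroup T]
  [ContinuousSMul ℝ T]

theorem pairing_apply (x y : T × (T →L[ℝ] ℝ)) : pairing T x y = y.2 x.1 + x.2 y.1 := rfl

theorem opI_apply (Ω : T →L[ℝ] T →L[ℝ] ℝ) (k : ℝ) (x : T × (T →L[ℝ] ℝ)) :
    opI Ω k x = (k • Ω.inverse x.2, Ω x.1) := rfl

theorem mem_slashFiber_iff (Ω : T →L[ℝ] T →L[ℝ] ℝ) (lam ell : ℤˣ)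
    (S : (T × (T →L[ℝ] ℝ)) →L[ℝ] (T × (T →L[ℝ] ℝ))) :
    S ∈ slashFiber Ω lam ell ↔ IsSplitStructure (pairing T) (opI Ω (sgn (lam * ell))).toLinearMap
      (sgn lam) S.toLinearMap := by
  have hext : ∀ A B : (T × (T →L[ℝ] ℝ)) →L[ℝ] (T × (T →L[ℝ] ℝ)),
      A = B ↔ A.toLinearMap = B.toLinearMap := fun A B => ContinuousLinearMap.coe_inj.symm
  constructor
  · rintro ⟨⟨h1, h2, h3⟩, ⟨h4, h5⟩⟩
    exact ⟨(hext _ _).1 h1, h2, h3, (hext _ _).1 h4, h5⟩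
  · rintro ⟨h1, h2, h3, h4, h5⟩
    exact ⟨⟨(hext _ _).2 h1, h2, h3⟩, ⟨(hext _ _).2 h4, h5⟩⟩

variable {T' : Type*} [AddCommGroup T'] [Module ℝ T'] [TopologicalSpace T']
  [IsTopologicalAddGroup T'] [ContinuousSMul ℝ T']

theorem pairing_extendedEquiv (f : T ≃L[ℝ] T') (x y : T × (T →L[ℝ] ℝ)) :
    pairing T' (extendedEquiv f x) (extendedEquiv f y) = pairing T x y := by
  change y.2 (f.symm (f x.1)) + x.2 (f.symm (f y.1)) = y.2 x.1 + x.2 y.1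
  rw [f.symm_apply_apply, f.symm_apply_apply]

theorem opI_extendedEquiv [T2Space T] [FiniteDimensional ℝ T] {Ω : T →L[ℝ] T →L[ℝ] ℝ}
    (h : ∀ u, (∀ v, Ω u v = 0) → u = 0) {Ω' : T' →L[ℝ] T' →L[ℝ] ℝ} (f : T ≃L[ℝ] T')
    (hf : ∀ u v, Ω' (f u) (f v) = Ω u v) (k : ℝ) (x : T × (T →L[ℝ] ℝ)) :
    opI Ω' k (extendedEquiv f x) = extendedEquiv f (opI Ω k x) := by
  have : T2Space T' := f.toHomeomorph.symm.isEmbedding.t2Space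
  have : FiniteDimensional ℝ T' := LinearEquiv.finiteDimensional f.toLinearEquiv
  have h' : ∀ u, (∀ v, Ω' u v = 0) → u = 0 := by
    intro u hu
    have := h (f.symm u) fun v => by rw [← hf, f.apply_symm_apply, hu]
    exact (ContinuousLinearEquiv.map_eq_zero_iff _).1 this
  have hflat : ∀ u, Ω' (f u) = (Ω u) ∘L (f.symm : T' →L[ℝ] T) := by
    intro u
    ext v
    change Ω' (f u) v = Ω u (f.symm v)
    rw [← hf, f.apply_symm_apply]
  refine Prod.ext ?_ (hflat x.1)
  change k • Ω'.inverse (x.2 ∘L (f.symm : T' →L[ℝ] T)) = f (k • Ω.inverse x.2)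
  have hx : x.2 ∘L (f.symm : T' →L[ℝ] T) = Ω' (f (Ω.inverse x.2)) := by
    rw [hflat, (inverse_flat Ω h).2]
  rw [hx, (inverse_flat Ω' h').1, map_smul]

/-- The sets of `(lam, ell)`-structures are natural under symplectic isomorphisms. -/
theorem mem_slashFiber_conj_iff [T2Space T] [FiniteDimensional ℝ T] {Ω : T →L[ℝ] T →L[ℝ] ℝ}
    (h : ∀ u, (∀ v, Ω u v = 0) → u = 0) {Ω' : T' →L[ℝ] T' →L[ℝ] ℝ} (f : T ≃L[ℝ] T')
    (hf : ∀ u v, Ω' (f u) (f v) = Ω u v) (lam ell : ℤˣ)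
    (S : (T × (T →L[ℝ] ℝ)) →L[ℝ] (T × (T →L[ℝ] ℝ))) :
    S ∈ slashFiber Ω lam ell ↔
      (extendedEquiv f : (T × (T →L[ℝ] ℝ)) →L[ℝ] (T' × (T' →L[ℝ] ℝ))) ∘L S ∘L
        ((extendedEquiv f).symm : (T' × (T' →L[ℝ] ℝ)) →L[ℝ] (T × (T →L[ℝ] ℝ))) ∈
        slashFiber Ω' lam ell := by
  have : FiniteDimensional ℝ (T →L[ℝ] ℝ) :=
    LinearEquiv.finiteDimensional (LinearMap.toContinuousLinearMap (E := T) (F' := ℝ) (𝕜 := ℝ))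
  rw [mem_slashFiber_iff, mem_slashFiber_iff]
  exact (isSplitStructure_conj_iff (extendedEquiv f).toLinearEquiv (pairing_extendedEquiv f)
    (opI_extendedEquiv h f hf _)).symm

theorem mem_slashFiberSig_conj_iff [T2Space T] [FiniteDimensional ℝ T] {Ω : T →L[ℝ] T →L[ℝ] ℝ}
    (h : ∀ u, (∀ v, Ω u v = 0) → u = 0) {Ω' : T' →L[ℝ] T' →L[ℝ] ℝ} (f : T ≃L[ℝ] T')
    (hf : ∀ u v, Ω' (f u) (f v) = Ω u v) (m n : ℕ)
    (S : (T × (T →L[ℝ] ℝ)) →L[ℝ] (T × (T →L[ℝ] ℝ))) :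
    S ∈ slashFiberSig Ω m n ↔
      (extendedEquiv f : (T × (T →L[ℝ] ℝ)) →L[ℝ] (T' × (T' →L[ℝ] ℝ))) ∘L S ∘L
        ((extendedEquiv f).symm : (T' × (T' →L[ℝ] ℝ)) →L[ℝ] (T × (T →L[ℝ] ℝ))) ∈
        slashFiberSig Ω' m n := by
  refine and_congr (mem_slashFiber_conj_iff h f hf _ _ S) ?_
  refine (hasSignature_iff_of_equiv (extendedEquiv f).toLinearEquiv (fun x => ?_) _ _).symm
  change pairing T' (opI Ω' (-1) (extendedEquiv f (S ((extendedEquiv f).symm (extendedEquiv f x)))))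
    (extendedEquiv f x) = pairing T (opI Ω (-1) (S x)) x
  rw [(extendedEquiv f).symm_apply_apply, opI_extendedEquiv h f hf, pairing_extendedEquiv]

end SlashFibers

/-! ### Conjugacy classes in `GL` and in `U(p, q)` as homogeneous models -/

section MatrixModels

open Topology Filter

attribute [local instance] Matrix.linftyOpNormedRing Matrix.linftyOpNormedAlgebra

/-- If `x` and `x₀` both have square `ε = ±1`, then `(1 + ε x x₀) / 2` intertwines them; it is
the identity for `x = x₀`. -/
theorem intertwiner {A : Type*} [Ring A] [Algebra ℝ A] {ε : ℝ} (hε : ε * ε = 1) {x x₀ : A}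
    (hx : x * x = ε • 1) (hx₀ : x₀ * x₀ = ε • 1) :
    ((1 / 2 : ℝ) • (1 + ε • (x * x₀))) * x₀ = x * ((1 / 2 : ℝ) • (1 + ε • (x * x₀))) := by
  rw [smul_mul_assoc, mul_smul_comm, add_mul, mul_add, smul_mul_assoc, mul_smul_comm, mul_assoc,
    hx₀, ← mul_assoc, hx, mul_smul_comm, smul_mul_assoc, smul_smul, smul_smul, hε, one_mul,
    mul_one, one_smul, one_smul, add_comm]

theorem intertwiner_self {A : Type*} [Ring A] [Algebra ℝ A] {ε : ℝ} (hε : ε * ε = 1) {x₀ : A}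
    (hx₀ : x₀ * x₀ = ε • 1) : (1 / 2 : ℝ) • (1 + ε • (x₀ * x₀)) = 1 := by
  rw [hx₀, smul_smul, hε, one_smul, smul_add, ← add_smul]
  norm_num

/-- Two conjugates `g S₀ g⁻¹`, `g' S₀ g'⁻¹` agree if and only if `g⁻¹ g'` centralizes `S₀`. -/
theorem conj_eq_conj_iff {A : Type*} [Monoid A] (g g' : Aˣ) (S₀ : A) :
    ↑g * S₀ * ↑g⁻¹ = ↑g' * S₀ * ↑g'⁻¹ ↔ S₀ * ↑(g⁻¹ * g') = ↑(g⁻¹ * g') * S₀ := by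
  rw [Units.val_mul]
  constructor
  · intro h
    calc S₀ * (↑g⁻¹ * ↑g') = ↑g⁻¹ * (↑g * S₀ * ↑g⁻¹) * ↑g' := by
          rw [mul_assoc (g : A), Units.inv_mul_cancel_left, mul_assoc]
      _ = ↑g⁻¹ * ↑g' * S₀ := by
          rw [h, mul_assoc, Units.inv_mul_cancel_right, mul_assoc]
  · intro h
    calc ↑g * S₀ * ↑g⁻¹ = ↑g * (S₀ * (↑g⁻¹ * ↑g')) * ↑g'⁻¹ := by
          simp only [mul_assoc, Units.mul_inv, mul_one]
      _ = ↑g' * S₀ * ↑g'⁻¹ := by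
          rw [h, ← mul_assoc, Units.mul_inv_cancel_left]

theorem conj_sq {A : Type*} [Ring A] [Algebra ℝ A] {ε : ℝ} {S₀ : A} (hS₀ : S₀ * S₀ = ε • 1)
    (g : Aˣ) : (↑g * S₀ * ↑g⁻¹) * (↑g * S₀ * ↑g⁻¹) = ε • (1 : A) := by
  rw [show (↑g * S₀ * ↑g⁻¹) * (↑g * S₀ * ↑g⁻¹) = ↑g * S₀ * (↑g⁻¹ * ↑g) * S₀ * ↑g⁻¹ by
    simp only [mul_assoc], Units.inv_mul, mul_one, mul_assoc (g : A), hS₀, mul_smul_comm, mul_one,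
    smul_mul_assoc, Units.mul_inv]

/-- The conjugacy class in `GL(ι, ℝ)` of a matrix with square `±1` is a homogeneous model of the
quotient by the centralizer. -/
theorem isHomogeneousModel_gl {ι : Type*} [Fintype ι] [DecidableEq ι] {ε : ℝ} (hε : ε * ε = 1)
    {S₀ : Matrix ι ι ℝ} (hS₀ : S₀ * S₀ = ε • 1) {H : Subgroup (GL ι ℝ)}
    (hH : ∀ g, g ∈ H ↔ S₀ * g.val = g.val * S₀) :
    IsHomogeneousModel glIncl H {A | ∃ g : GL ι ℝ, A = g.val * S₀ * g⁻¹.val} := by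
  let of : (ι → ι → ℝ) →L[ℝ] Matrix ι ι ℝ :=
    LinearMap.toContinuousLinearMap (Matrix.ofLinearEquiv ℝ).toLinearMap
  let fo : Matrix ι ι ℝ →L[ℝ] (ι → ι → ℝ) :=
    LinearMap.toContinuousLinearMap (Matrix.ofLinearEquiv ℝ).symm.toLinearMap
  have hof : ∀ g : GL ι ℝ, of (glIncl g) = g.val := fun g => rfl
  refine ⟨fun g => g.val * S₀ * g⁻¹.val, ?_, fun g g' => ?_,
    ⟨fun v => of v * S₀ * Ring.inverse (of v), ?_, fun g => ?_⟩, ?_⟩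
  · ext A
    exact ⟨fun ⟨g, hg⟩ => ⟨g, hg.symm⟩, fun ⟨g, hg⟩ => ⟨g, hg.symm⟩⟩
  · rw [hH]
    exact conj_eq_conj_iff g g' S₀
  · rintro _ ⟨g, rfl⟩
    have h : ContDiffAt ℝ ∞ Ring.inverse (of (glIncl g)) := by
      rw [hof]; exact contDiffAt_ringInverse ℝ g
    exact ((of.contDiff.contDiffAt.mul contDiffAt_const).mul
      (h.comp _ of.contDiff.contDiffAt)).contDiffWithinAt
  · change of (glIncl g) * S₀ * Ring.inverse (of (glIncl g)) = _
    rw [hof, Ring.inverse_unit]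
  · rintro x₀ ⟨g₁, hg₁⟩
    have hx₀ : x₀ * x₀ = ε • 1 := by rw [hg₁]; exact conj_sq hS₀ g₁
    let h : Matrix ι ι ℝ → Matrix ι ι ℝ := fun x => (1 / 2 : ℝ) • (1 + ε • (x * x₀))
    have hh : ContDiff ℝ ∞ h :=
      (contDiff_const.add ((contDiff_id.mul contDiff_const).const_smul ε)).const_smul (1 / 2 : ℝ)
    -- Near `x₀`, the intertwiner `h x` carries `x₀` to `x`.
    classical
    let γ : Matrix ι ι ℝ → GL ι ℝ := fun x => if hx : IsUnit (h x) then hx.unit * g₁ else 1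
    have hγ : ∀ x, IsUnit (h x) → (γ x).val = h x * g₁.val := fun x hx => by
      simp only [γ, dif_pos hx, Units.val_mul, IsUnit.unit_spec]
    refine ⟨h ⁻¹' {y | IsUnit y}, Units.isOpen.preimage hh.continuous, ?_, γ, ?_, ?_⟩
    · change IsUnit (h x₀)
      rw [show h x₀ = 1 from intertwiner_self hε hx₀]
      exact isUnit_one
    · have hsm : ContDiff ℝ ∞ (fun x => fo (h x * g₁.val)) :=
        fo.contDiff.comp (hh.mul contDiff_const)
      refine hsm.contDiffOn.congr fun x hx => ?_
      rw [← hγ x hx.2]; rfl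
    · rintro x ⟨⟨g, hg⟩, hx⟩
      have hx2 : x * x = ε • 1 := by rw [hg]; exact conj_sq hS₀ g
      change (γ x).val * S₀ * ((γ x)⁻¹).val = x
      rw [Units.mul_inv_eq_iff_eq_mul, hγ x hx, ← mul_assoc x,
        ← show h x * x₀ = x * h x from intertwiner hε hx2 hx₀, hg₁]
      simp only [mul_assoc, Units.inv_mul, mul_one]

theorem sigMatrix_mul_self (p q : ℕ) :
    sigMatrix (Fin p) (Fin q) * sigMatrix (Fin p) (Fin q) = 1 := by
  simp [sigMatrix, Matrix.fromBlocks_multiply]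

theorem sigMatrix_conjTranspose (p q : ℕ) :
    (sigMatrix (Fin p) (Fin q))ᴴ = sigMatrix (Fin p) (Fin q) := by
  simp [sigMatrix, Matrix.fromBlocks_conjTranspose]

/-- Complex square matrices of size `p + q`, with indices grouped accordingly. -/
abbrev CMat (p q : ℕ) : Type := Matrix (Fin p ⊕ Fin q) (Fin p ⊕ Fin q) ℂ

/-- The adjoint of a matrix for the Hermitian form of signature `(p, q)`. -/
def sigAdjoint (p q : ℕ) : CMat p q →ₗ[ℝ] CMat p q where
  toFun A := sigMatrix _ _ * Aᴴ * sigMatrix _ _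
  map_add' A B := by rw [Matrix.conjTranspose_add, Matrix.mul_add, Matrix.add_mul]
  map_smul' c A := by
    rw [Matrix.conjTranspose_smul, Matrix.mul_smul, Matrix.smul_mul]; rfl

section

variable {p q : ℕ}

theorem sigAdjoint_apply (A : CMat p q) :
    sigAdjoint p q A = sigMatrix _ _ * Aᴴ * sigMatrix _ _ := rfl

theorem sigAdjoint_one : sigAdjoint p q 1 = 1 := by
  rw [sigAdjoint_apply, Matrix.conjTranspose_one, Matrix.mul_one, sigMatrix_mul_self]

theorem sigAdjoint_mul (A B : CMat p q) :
    sigAdjoint p q (A * B) = sigAdjoint p q B * sigAdjoint p q A := by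
  simp only [sigAdjoint_apply, Matrix.conjTranspose_mul]
  rw [show sigMatrix (Fin p) (Fin q) * Bᴴ * sigMatrix _ _ * (sigMatrix _ _ * Aᴴ * sigMatrix _ _) =
    sigMatrix _ _ * Bᴴ * (sigMatrix _ _ * sigMatrix _ _) * Aᴴ * sigMatrix _ _ by
    simp only [mul_assoc], sigMatrix_mul_self]
  simp only [mul_assoc, one_mul]

theorem sigAdjoint_sigAdjoint (A : CMat p q) :
    sigAdjoint p q (sigAdjoint p q A) = A := by
  simp only [sigAdjoint_apply, Matrix.conjTranspose_mul, Matrix.conjTranspose_conjTranspose,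
    sigMatrix_conjTranspose]
  rw [show sigMatrix (Fin p) (Fin q) * (sigMatrix _ _ * (A * sigMatrix _ _)) * sigMatrix _ _ =
    (sigMatrix _ _ * sigMatrix _ _) * A * (sigMatrix _ _ * sigMatrix _ _) by
    simp only [mul_assoc], sigMatrix_mul_self, one_mul, mul_one]

theorem sigAdjoint_mul_eq_one_iff (A : CMat p q) :
    sigAdjoint p q A * A = 1 ↔ Aᴴ * sigMatrix _ _ * A = sigMatrix _ _ := by
  have h := sigMatrix_mul_self p q
  rw [sigAdjoint_apply]
  constructor
  · intro h1
    calc Aᴴ * sigMatrix _ _ * A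
        = sigMatrix _ _ * sigMatrix _ _ * (Aᴴ * sigMatrix _ _ * A) := by rw [h, one_mul]
      _ = sigMatrix _ _ * (sigMatrix _ _ * Aᴴ * sigMatrix _ _ * A) := by simp only [mul_assoc]
      _ = _ := by rw [h1, mul_one]
  · intro h1
    calc _ = sigMatrix _ _ * (Aᴴ * sigMatrix _ _ * A) := by simp only [mul_assoc]
      _ = 1 := by rw [h1, h]

theorem sigAdjoint_unitary (g : unitaryGrp p q) :
    sigAdjoint p q g.val.val = g.val⁻¹.val := by
  have h : sigAdjoint p q g.val.val * g.val.val = 1 := (sigAdjoint_mul_eq_one_iff _).2 g.2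
  exact (Units.inv_eq_of_mul_eq_one_left h).symm

theorem sigAdjoint_conj {S₀ : CMat p q} (hskew : sigAdjoint p q S₀ = -S₀)
    (g : unitaryGrp p q) : sigAdjoint p q (g.val.val * S₀ * g.val⁻¹.val) =
      -(g.val.val * S₀ * g.val⁻¹.val) := by
  rw [sigAdjoint_mul, sigAdjoint_mul, hskew, ← sigAdjoint_unitary, sigAdjoint_sigAdjoint]
  simp only [mul_neg, neg_mul, mul_assoc]

/-- A matrix with `A† A = 1` is an element of `U(p, q)`. -/
theorem exists_unitary {A : CMat p q}
    (h : sigAdjoint p q A * A = 1) : ∃ g : unitaryGrp p q, g.val.val = A :=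
  ⟨⟨⟨A, sigAdjoint p q A, mul_eq_one_comm.1 h, h⟩, (sigAdjoint_mul_eq_one_iff A).1 h⟩, rfl⟩

end

set_option maxHeartbeats 1000000 in
/-- The conjugacy class in `U(p, q)` of an element of its Lie algebra with square `±1` is a
homogeneous model of the quotient by the centralizer. For the local sections, the intertwiner
`h = (1 + ε x x₀) / 2` is replaced by its unitary part `h (h† h) ^ (-1/2)`. -/
theorem isHomogeneousModel_unitary {p q : ℕ} {ε : ℝ} (hε : ε * ε = 1)
    {S₀ : CMat p q} (hS₀ : S₀ * S₀ = ε • 1)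
    (hskew : sigAdjoint p q S₀ = -S₀) {H : Subgroup (unitaryGrp p q)}
    (hH : ∀ g, g ∈ H ↔ S₀ * g.val.val = g.val.val * S₀) :
    IsHomogeneousModel (unitaryIncl p q) H
      {A | ∃ g : unitaryGrp p q, A = g.val.val * S₀ * g.val⁻¹.val} := by
  let of : ((Fin p ⊕ Fin q) → (Fin p ⊕ Fin q) → ℂ) →L[ℝ] CMat p q :=
    LinearMap.toContinuousLinearMap (Matrix.ofLinearEquiv ℝ).toLinearMap
  let fo : CMat p q →L[ℝ] ((Fin p ⊕ Fin q) → (Fin p ⊕ Fin q) → ℂ) :=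
    LinearMap.toContinuousLinearMap (Matrix.ofLinearEquiv ℝ).symm.toLinearMap
  let adj : CMat p q →L[ℝ] CMat p q := LinearMap.toContinuousLinearMap (sigAdjoint p q)
  have hadj : ∀ A, adj A = sigAdjoint p q A := fun A => rfl
  have hof : ∀ g : unitaryGrp p q, of (unitaryIncl p q g) = g.val.val := fun g => rfl
  refine ⟨fun g => g.val.val * S₀ * g.val⁻¹.val, ?_, fun g g' => ?_,
    ⟨fun v => of v * S₀ * adj (of v), ?_, fun g => ?_⟩, ?_⟩
  · ext A
    exact ⟨fun ⟨g, hg⟩ => ⟨g, hg.symm⟩, fun ⟨g, hg⟩ => ⟨g, hg.symm⟩⟩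
  · rw [hH]
    exact conj_eq_conj_iff g.val g'.val S₀
  · exact ((of.contDiff.mul contDiff_const).mul (adj.contDiff.comp of.contDiff)).contDiffOn
  · change of (unitaryIncl p q g) * S₀ * adj (of (unitaryIncl p q g)) = _
    rw [hof, hadj, sigAdjoint_unitary]
  · rintro x₀ ⟨g₁, hg₁⟩
    have hx₀ : x₀ * x₀ = ε • 1 := by rw [hg₁]; exact conj_sq hS₀ g₁.val
    have hx₀s : adj x₀ = -x₀ := by rw [hg₁]; exact sigAdjoint_conj hskew g₁
    let h : CMat p q → CMat p q := fun x => (1 / 2 : ℝ) • (1 + ε • (x * x₀))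
    have hh : ContDiff ℝ ∞ h :=
      (contDiff_const.add ((contDiff_id.mul contDiff_const).const_smul ε)).const_smul (1 / 2 : ℝ)
    have hh₀ : h x₀ = 1 := intertwiner_self hε hx₀
    let N : CMat p q → CMat p q := fun x => adj (h x) * h x
    have hN : ContDiff ℝ ∞ N := (adj.contDiff.comp hh).mul hh
    have hN₀ : N x₀ = 1 := by
      change adj (h x₀) * h x₀ = 1
      rw [hh₀, hadj, sigAdjoint_one, one_mul]
    obtain ⟨s, W₀, O, hW₀, hW1, hO, hO1, hs, hs1, hsq, huniq⟩ := exists_smooth_sqrt (CMat p q)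
    -- `φ` fixes exactly the matrices that commute with `x₀`; it respects squares, and so does
    -- `adj`.
    let φ : CMat p q → CMat p q := fun y => ε • (x₀ * y * x₀)
    have hφc : Continuous φ :=
      ((continuous_const.mul continuous_id).mul continuous_const).const_smul ε
    have hφ1 : φ 1 = 1 := by
      change ε • (x₀ * 1 * x₀) = 1
      rw [mul_one, hx₀, smul_smul, hε, one_smul]
    have hφsq : ∀ y, φ (y * y) = φ y * φ y := fun y => by
      change ε • (x₀ * (y * y) * x₀) = ε • (x₀ * y * x₀) * ε • (x₀ * y * x₀)
      rw [smul_mul_smul_comm, hε, one_smul,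
        show x₀ * y * x₀ * (x₀ * y * x₀) = x₀ * y * (x₀ * x₀) * y * x₀ by simp only [mul_assoc],
        hx₀, mul_smul_comm, mul_one, smul_mul_assoc, smul_mul_assoc]
      simp only [mul_assoc]
    have hφfix : ∀ y, φ y = y ↔ y * x₀ = x₀ * y := fun y => by
      change ε • (x₀ * y * x₀) = y ↔ _
      constructor
      · intro h
        calc y * x₀ = ε • (x₀ * y * x₀) * x₀ := by rw [h]
          _ = ε • (x₀ * y * (x₀ * x₀)) := by rw [smul_mul_assoc]; simp only [mul_assoc]
          _ = x₀ * y := by rw [hx₀, mul_smul_comm, smul_smul, hε, one_smul, mul_one]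
      · intro h
        rw [mul_assoc, h, ← mul_assoc, hx₀, smul_mul_assoc, one_mul, smul_smul, hε, one_smul]
    have hev : ∀ᶠ y in 𝓝 (1 : CMat p q), (adj y = y → adj (s y) = s y) ∧ (φ y = y → φ (s y) = s y) ∧
        y ∈ W₀ ∧ IsUnit (s y) := by
      refine (sqrt_fixed hW₀ hW1 hO hO1 hs.continuousOn hs1 hsq huniq adj.continuous
        sigAdjoint_one fun a => sigAdjoint_mul a a).and
        ((sqrt_fixed hW₀ hW1 hO hO1 hs.continuousOn hs1 hsq huniq hφc hφ1 hφsq).and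
        (Filter.Eventually.and (hW₀.mem_nhds hW1) ?_))
      have hc : ContinuousAt s 1 := hs.continuousOn.continuousAt (hW₀.mem_nhds hW1)
      refine hc (Units.isOpen.mem_nhds ?_)
      rw [hs1]; exact isUnit_one
    obtain ⟨W, hW, hWo, hW1'⟩ := mem_nhds_iff.1 hev
    let Γ : CMat p q → CMat p q := fun x => h x * Ring.inverse (s (N x)) * g₁.val.val
    have hΓ : ContDiffOn ℝ ∞ Γ (N ⁻¹' W) := by
      refine (hh.contDiffOn.mul fun x hx => ?_).mul contDiffOn_const
      obtain ⟨w, hw⟩ := (hW hx).2.2.2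
      refine ContDiffAt.comp_contDiffWithinAt (g := Ring.inverse) x ?_
        ((hs.comp hN.contDiffOn fun x (hx : x ∈ N ⁻¹' W) => (hW hx).2.2.1) x hx)
      change ContDiffAt ℝ ∞ Ring.inverse (s (N x))
      rw [← hw]
      exact contDiffAt_ringInverse ℝ w
    classical
    let γ : CMat p q → unitaryGrp p q := fun x =>
      if hx : ∃ g : unitaryGrp p q, g.val.val = Γ x then hx.choose else 1
    have key : ∀ x, (∃ g : unitaryGrp p q, x = g.val.val * S₀ * g.val⁻¹.val) → N x ∈ W →
        (γ x).val.val = Γ x ∧ Γ x * S₀ = x * Γ x := by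
      rintro x ⟨g, hg⟩ hxW
      obtain ⟨hW1, hW2, hW3, hW4⟩ := hW hxW
      have hx2 : x * x = ε • 1 := by rw [hg]; exact conj_sq hS₀ g.val
      have hxs : adj x = -x := by rw [hg]; exact sigAdjoint_conj hskew g
      have hint : h x * x₀ = x * h x := intertwiner hε hx2 hx₀
      have hint' : x₀ * adj (h x) = adj (h x) * x := by
        have := congrArg adj hint
        rw [hadj, hadj, sigAdjoint_mul, sigAdjoint_mul, ← hadj, ← hadj, ← hadj, hx₀s, hxs,
          neg_mul, mul_neg, neg_inj] at this
        exact this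
      have hNx : N x * x₀ = x₀ * N x := by
        change adj (h x) * h x * x₀ = x₀ * (adj (h x) * h x)
        rw [mul_assoc, hint, ← mul_assoc, ← mul_assoc, hint']
      have hNs : adj (N x) = N x := by
        change sigAdjoint p q (sigAdjoint p q (h x) * h x) = _
        rw [sigAdjoint_mul, sigAdjoint_sigAdjoint]; rfl
      have hsx : s (N x) * x₀ = x₀ * s (N x) := (hφfix _).1 (hW2 ((hφfix _).2 hNx))
      have hss : adj (s (N x)) = s (N x) := hW1 hNs
      have hinv1 : s (N x) * Ring.inverse (s (N x)) = 1 := Ring.mul_inverse_cancel _ hW4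
      have hinv2 : Ring.inverse (s (N x)) * s (N x) = 1 := Ring.inverse_mul_cancel _ hW4
      set r := Ring.inverse (s (N x)) with hr
      have hrx : r * x₀ = x₀ * r := by
        calc r * x₀ = r * (x₀ * s (N x)) * r := by rw [mul_assoc, mul_assoc, hinv1, mul_one]
          _ = (r * s (N x)) * x₀ * r := by rw [← hsx, mul_assoc r (s (N x)) x₀]
          _ = x₀ * r := by rw [hinv2, one_mul]
      have hrs : adj r * s (N x) = 1 := by
        have := congrArg adj hinv1
        rw [hadj, hadj, sigAdjoint_mul, sigAdjoint_one, ← hadj, ← hadj, hss] at this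
        exact this
      have hU : sigAdjoint p q (Γ x) * Γ x = 1 := by
        change sigAdjoint p q (h x * r * g₁.val.val) * (h x * r * g₁.val.val) = 1
        rw [sigAdjoint_mul, sigAdjoint_mul, sigAdjoint_unitary]
        calc _ = g₁.val⁻¹.val * (adj r * (adj (h x) * h x) * r) * g₁.val.val := by
              simp only [mul_assoc]; rfl
          _ = g₁.val⁻¹.val * (adj r * s (N x) * (s (N x) * r)) * g₁.val.val := by
              rw [show adj (h x) * h x = s (N x) * s (N x) from (hsq _ hW3).symm]
              simp only [mul_assoc]
          _ = 1 := by rw [hrs, hinv1, mul_one, mul_one, Units.inv_mul]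
      have hex := exists_unitary hU
      refine ⟨?_, ?_⟩
      · simp only [γ, dif_pos hex]
        exact hex.choose_spec
      · change h x * r * g₁.val.val * S₀ = x * (h x * r * g₁.val.val)
        have hg₁' : x₀ * g₁.val.val = g₁.val.val * S₀ := by
          rw [hg₁, mul_assoc, Units.inv_mul, mul_one]
        rw [mul_assoc, ← hg₁', ← mul_assoc, mul_assoc (h x), hrx, ← mul_assoc (h x), hint]
        simp only [mul_assoc]
    refine ⟨N ⁻¹' W, hWo.preimage hN.continuous, ?_, γ, ?_, ?_⟩
    · change N x₀ ∈ W
      rwa [hN₀]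
    · refine (fo.contDiff.comp_contDiffOn (hΓ.mono fun x hx => hx.2)).congr fun x hx => ?_
      change _ = fo (Γ x)
      rw [← (key x hx.1 hx.2).1]; rfl
    · rintro x ⟨hx, hxW⟩
      obtain ⟨h1, h2⟩ := key x hx hxW
      change (γ x).val.val * S₀ * ((γ x).val⁻¹).val = x
      rw [Units.mul_inv_eq_iff_eq_mul, h1, h2]

end MatrixModels

/-! ### Normal forms of matrices -/

section NormalForms

/-- The invertible matrix whose columns are the vectors of a basis. -/
theorem exists_gl_of_basis {K ι : Type*} [Field K] [Fintype ι] [DecidableEq ι]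
    (b : Module.Basis ι K (ι → K)) : ∃ g : GL ι K, ∀ i j, g.val i j = b j i := by
  have h := Module.Basis.invertibleToMatrix (Pi.basisFun K ι) b
  exact ⟨unitOfInvertible ((Pi.basisFun K ι).toMatrix b), fun i j => rfl⟩

/-- A traceless involution is conjugate to `diag(1, -1)`. -/
theorem exists_conj_involution {K : Type*} [Field K] [CharZero K] {m : ℕ}
    {P : Matrix (Fin m ⊕ Fin m) (Fin m ⊕ Fin m) K} (hP : P * P = 1) (htr : P.trace = 0) :
    ∃ g : GL (Fin m ⊕ Fin m) K, P * g.val = g.val * Matrix.fromBlocks 1 0 0 (-1) := by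
  let T := Matrix.toLin' P
  have hT : T ∘ₗ T = LinearMap.id := by
    rw [← Matrix.toLin'_mul, hP, Matrix.toLin'_one]
  have hT' : ∀ x, T (T x) = x := fun x => congrArg (fun f : _ →ₗ[K] _ => f x) hT
  have htrT := trace_of_involution T hT
  rw [Matrix.trace_toLin'_eq, htr, eq_comm, sub_eq_zero, Nat.cast_inj] at htrT
  have hcompl : IsCompl (Module.End.eigenspace T (1 : K)) (Module.End.eigenspace T (-1 : K)) := by
    constructor
    · rw [Submodule.disjoint_def]
      intro x h1 h2
      rw [Module.End.mem_eigenspace_iff, one_smul] at h1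
      rw [Module.End.mem_eigenspace_iff, h1, neg_smul, one_smul, self_eq_neg] at h2
      exact h2
    · rw [codisjoint_iff, Submodule.eq_top_iff']
      intro x
      rw [Submodule.mem_sup]
      refine ⟨(2⁻¹ : K) • (x + T x), ?_, (2⁻¹ : K) • (x - T x), ?_, ?_⟩
      · rw [Module.End.mem_eigenspace_iff, map_smul, map_add, hT', one_smul, add_comm]
      · rw [Module.End.mem_eigenspace_iff, map_smul, map_sub, hT', neg_smul, one_smul, ← smul_neg,
          neg_sub]
      · rw [← smul_add, add_add_sub_cancel, ← two_smul K x, smul_smul,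
          inv_mul_cancel₀ two_ne_zero, one_smul]
  have hsum := Submodule.finrank_add_eq_of_isCompl hcompl
  rw [Module.finrank_fintype_fun_eq_card, Fintype.card_sum, Fintype.card_fin] at hsum
  let b₁ := Module.finBasisOfFinrankEq K (Module.End.eigenspace T (1 : K))
    (show _ = m by omega)
  let b₂ := Module.finBasisOfFinrankEq K (Module.End.eigenspace T (-1 : K))
    (show _ = m by omega)
  let b := (b₁.prod b₂).map (Submodule.prodEquivOfIsCompl _ _ hcompl)
  have hb₁ : ∀ j, b (Sum.inl j) = b₁ j := fun j => by simp [b]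
  have hb₂ : ∀ j, b (Sum.inr j) = b₂ j := fun j => by simp [b]
  obtain ⟨g, hg⟩ := exists_gl_of_basis b
  refine ⟨g, ?_⟩
  have hPg : ∀ i j, (P * g.val) i j = T (b j) i := fun i j => by
    rw [Matrix.toLin'_apply, Matrix.mul_apply, Matrix.mulVec, dotProduct]
    exact Finset.sum_congr rfl fun k _ => by rw [hg]
  ext i (j | j)
  · rw [hPg, hb₁, Module.End.mem_eigenspace_iff.1 (b₁ j).2, Matrix.mul_apply,
      Fintype.sum_sum_type]
    simp [hg, hb₁, Matrix.one_apply]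
  · rw [hPg, hb₂, Module.End.mem_eigenspace_iff.1 (b₂ j).2, Matrix.mul_apply,
      Fintype.sum_sum_type]
    simp [hg, hb₂, Matrix.one_apply]

/-- A real matrix with square `-1` is conjugate to the standard complex structure, by a complex
basis of `ℝ^{2m}` for the multiplication by `i` that it defines. -/
theorem exists_conj_complexStructure {m : ℕ} {A : Matrix (Fin m ⊕ Fin m) (Fin m ⊕ Fin m) ℝ}
    (hA : A * A = -1) :
    ∃ g : GL (Fin m ⊕ Fin m) ℝ, A * g.val = g.val * Matrix.fromBlocks 0 (-1) 1 0 := by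
  let T := Matrix.toLin' A
  have hT : T * T = -1 := by
    change T ∘ₗ T = -1
    rw [← Matrix.toLin'_mul, hA, map_neg, Matrix.toLin'_one]; rfl
  have hT' : ∀ x, T (T x) = -x := fun x => congrArg (fun f : _ →ₗ[ℝ] _ => f x) hT
  let φ : ℂ →ₐ[ℝ] Module.End ℝ (Fin m ⊕ Fin m → ℝ) := Complex.lift ⟨T, hT⟩
  let _ : Module ℂ (Fin m ⊕ Fin m → ℝ) := Module.compHom _ φ.toRingHom
  have hsmul : ∀ (z : ℂ) (x : Fin m ⊕ Fin m → ℝ), z • x = φ z x := fun z x => rfl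
  have hI : ∀ x : Fin m ⊕ Fin m → ℝ, Complex.I • x = T x := fun x => by
    rw [hsmul]
    simp [φ]
  have : IsScalarTower ℝ ℂ (Fin m ⊕ Fin m → ℝ) := ⟨fun r z x => by
    rw [hsmul, hsmul, map_smul]; rfl⟩
  have : Module.Finite ℂ (Fin m ⊕ Fin m → ℝ) :=
    Module.Finite.of_restrictScalars_finite ℝ ℂ _
  have hfin : Module.finrank ℂ (Fin m ⊕ Fin m → ℝ) = m := by
    have h := Module.finrank_mul_finrank ℝ ℂ (Fin m ⊕ Fin m → ℝ)
    rw [Complex.finrank_real_complex, Module.finrank_fintype_fun_eq_card, Fintype.card_sum,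
      Fintype.card_fin] at h
    omega
  let c : Module.Basis (Fin m) ℂ (Fin m ⊕ Fin m → ℝ) := Module.finBasisOfFinrankEq ℂ _ hfin
  let e : Fin 2 × Fin m ≃ Fin m ⊕ Fin m :=
    (finTwoEquiv.prodCongr (Equiv.refl _)).trans (Equiv.boolProdEquivSum _)
  let b := (Complex.basisOneI.smulTower c).reindex e
  have hb₁ : ∀ j, b (Sum.inl j) = c j := fun j => by
    simp only [b, e, Module.Basis.reindex_apply, Module.Basis.smulTower_apply,
      Complex.coe_basisOneI]
    exact one_smul ℂ (c j)
  have hb₂ : ∀ j, b (Sum.inr j) = T (c j) := fun j => by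
    simp only [b, e, Module.Basis.reindex_apply, Module.Basis.smulTower_apply,
      Complex.coe_basisOneI]
    exact hI (c j)
  obtain ⟨g, hg⟩ := exists_gl_of_basis b
  refine ⟨g, ?_⟩
  have hPg : ∀ i j, (A * g.val) i j = T (b j) i := fun i j => by
    rw [Matrix.toLin'_apply, Matrix.mul_apply, Matrix.mulVec, dotProduct]
    exact Finset.sum_congr rfl fun k _ => by rw [hg]
  ext i (j | j)
  · rw [hPg, hb₁, Matrix.mul_apply, Fintype.sum_sum_type]
    simp [hg, hb₂, Matrix.one_apply]
  · rw [hPg, hb₂, hT', Matrix.mul_apply, Fintype.sum_sum_type]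
    simp [hg, hb₁, Matrix.one_apply]

/-- A nondegenerate Hermitian form has an orthonormal basis, with `p` vectors of square `1` and
`q` vectors of square `-1`: rescale an eigenbasis. -/
theorem exists_orthonormal_of_isHermitian {κ : Type*} [Fintype κ] [DecidableEq κ]
    {A : Matrix κ κ ℂ} (hA : A.IsHermitian) (hdet : IsUnit A) :
    ∃ (p q : ℕ) (C : Matrix κ (Fin p ⊕ Fin q) ℂ) (D : Matrix (Fin p ⊕ Fin q) κ ℂ),
      C * D = 1 ∧ D * C = 1 ∧ p + q = Fintype.card κ ∧ Cᴴ * A * C = sigMatrix (Fin p) (Fin q) := by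
  classical
  let a := hA.eigenvalues
  have ha : ∀ i, a i ≠ 0 := fun i h0 => by
    have h1 : A.det ≠ 0 := ((Matrix.isUnit_iff_isUnit_det A).1 hdet).ne_zero
    apply h1
    rw [hA.det_eq_prod_eigenvalues]
    exact Finset.prod_eq_zero (Finset.mem_univ i) (by simpa using h0)
  let U : Matrix κ κ ℂ := hA.eigenvectorUnitary
  have hU1 : Uᴴ * U = 1 := Unitary.coe_star_mul_self hA.eigenvectorUnitary
  have hU2 : U * Uᴴ = 1 := Unitary.coe_mul_star_self hA.eigenvectorUnitary
  have hspec : Uᴴ * A * U = Matrix.diagonal fun i => (a i : ℂ) := by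
    have h := hA.spectral_theorem
    rw [Unitary.conjStarAlgAut_apply] at h
    change A = U * Matrix.diagonal (fun i => (a i : ℂ)) * Uᴴ at h
    conv_lhs => rw [h]
    rw [show Uᴴ * (U * Matrix.diagonal (fun i => (a i : ℂ)) * Uᴴ) * U =
      (Uᴴ * U) * Matrix.diagonal (fun i => (a i : ℂ)) * (Uᴴ * U) by simp only [mul_assoc], hU1,
      one_mul, mul_one]
  let e₀ : ({i // 0 < a i} ⊕ {i // ¬ 0 < a i}) ≃ κ := Equiv.sumCompl _
  let e : (Fin (Fintype.card {i // 0 < a i}) ⊕ Fin (Fintype.card {i // ¬ 0 < a i})) ≃ κ :=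
    ((Fintype.equivFin _).symm.sumCongr (Fintype.equivFin _).symm).trans e₀
  have he1 : ∀ i, 0 < a (e (Sum.inl i)) := fun i => ((Fintype.equivFin {i // 0 < a i}).symm i).2
  have he2 : ∀ i, a (e (Sum.inr i)) < 0 := fun i =>
    lt_of_le_of_ne (not_lt.1 ((Fintype.equivFin {i // ¬ 0 < a i}).symm i).2) (ha _)
  let r : κ → ℂ := fun i => ((Real.sqrt |a i|)⁻¹ : ℝ)
  let r' : κ → ℂ := fun i => (Real.sqrt |a i| : ℝ)
  have hs : ∀ i, Real.sqrt |a i| ≠ 0 := fun i => (Real.sqrt_pos.2 (abs_pos.2 (ha i))).ne'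
  have hrr' : ∀ i, r i * r' i = 1 := fun i => by
    simp only [r, r']
    rw [← Complex.ofReal_mul, inv_mul_cancel₀ (hs i), Complex.ofReal_one]
  have hR1 : Matrix.diagonal r * Matrix.diagonal r' = 1 := by
    rw [Matrix.diagonal_mul_diagonal]; simp only [hrr', Matrix.diagonal_one]
  have hR2 : Matrix.diagonal r' * Matrix.diagonal r = 1 := by
    rw [Matrix.diagonal_mul_diagonal]; simp only [mul_comm (r' _), hrr', Matrix.diagonal_one]
  refine ⟨_, _, (U * Matrix.diagonal r).submatrix id e,
    (Matrix.diagonal r' * Uᴴ).submatrix e id, ?_, ?_, ?_, ?_⟩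
  · rw [Matrix.submatrix_mul_equiv, show U * Matrix.diagonal r * (Matrix.diagonal r' * Uᴴ) =
      U * (Matrix.diagonal r * Matrix.diagonal r') * Uᴴ by simp only [mul_assoc], hR1, mul_one, hU2,
      Matrix.submatrix_id_id]
  · rw [← Matrix.submatrix_mul _ _ e id e Function.bijective_id,
      show Matrix.diagonal r' * Uᴴ * (U * Matrix.diagonal r) =
      Matrix.diagonal r' * (Uᴴ * U) * Matrix.diagonal r by simp only [mul_assoc], hU1, mul_one, hR2,
      Matrix.submatrix_one_equiv]
  · rw [← Fintype.card_congr e, Fintype.card_sum, Fintype.card_fin, Fintype.card_fin]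
  · have hconj : (Matrix.diagonal r)ᴴ = Matrix.diagonal r := by
      rw [Matrix.diagonal_conjTranspose]
      congr 1
      ext i
      simp [r]
    have h1 : (U * Matrix.diagonal r)ᴴ * A * (U * Matrix.diagonal r) =
        Matrix.diagonal fun i => ((a i / |a i| : ℝ) : ℂ) := by
      rw [Matrix.conjTranspose_mul, hconj, show Matrix.diagonal r * Uᴴ * A *
        (U * Matrix.diagonal r) = Matrix.diagonal r * (Uᴴ * A * U) * Matrix.diagonal r by
        simp only [mul_assoc], hspec, Matrix.diagonal_mul_diagonal, Matrix.diagonal_mul_diagonal]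
      congr 1
      ext i
      simp only [r]
      rw [← Complex.ofReal_mul, ← Complex.ofReal_mul]
      congr 1
      rw [mul_right_comm, ← mul_inv, Real.mul_self_sqrt (abs_nonneg _)]
      ring
    rw [Matrix.conjTranspose_submatrix, ← Matrix.submatrix_id_id A,
      ← Matrix.submatrix_mul _ _ e id id Function.bijective_id,
      ← Matrix.submatrix_mul _ _ e id e Function.bijective_id, h1]
    ext (i | i) (j | j)
    · by_cases hij : i = j
      · subst hij
        simp [sigMatrix, abs_of_pos (he1 i), (he1 i).ne']
      · simp [sigMatrix, hij]
    · simp [sigMatrix]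
    · simp [sigMatrix]
    · by_cases hij : i = j
      · subst hij
        simp [sigMatrix, abs_of_neg (he2 i), (he2 i).ne]
      · simp [sigMatrix, hij]

end NormalForms

/-! ### Signatures of Hermitian forms -/

section Signatures

/-- The real part of the sesquilinear form with matrix `A`. -/
noncomputable def hermForm {κ : Type*} [Fintype κ] (A : Matrix κ κ ℂ) :
    LinearMap.BilinForm ℝ (κ → ℂ) :=
  LinearMap.mk₂ ℝ (fun x y => (star x ⬝ᵥ A *ᵥ y).re)
    (fun x x' y => by simp [add_dotProduct])
    (fun c x y => by simp [smul_dotProduct])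
    (fun x y y' => by simp [Matrix.mulVec_add, dotProduct_add])
    (fun c x y => by simp [Matrix.mulVec_smul, dotProduct_smul])

theorem hermForm_apply {κ : Type*} [Fintype κ] (A : Matrix κ κ ℂ) (x y : κ → ℂ) :
    hermForm A x y = (star x ⬝ᵥ A *ᵥ y).re := rfl

theorem hermForm_mulVec {κ κ' : Type*} [Fintype κ] [Fintype κ'] (A : Matrix κ κ ℂ)
    (C : Matrix κ κ' ℂ) (x y : κ' → ℂ) :
    hermForm A (C *ᵥ x) (C *ᵥ y) = hermForm (Cᴴ * A * C) x y := by
  rw [hermForm_apply, hermForm_apply, Matrix.star_mulVec, ← Matrix.dotProduct_mulVec,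
    Matrix.mulVec_mulVec, Matrix.mulVec_mulVec, Matrix.mul_assoc]

/-- A diagonal Hermitian form with real entries `s j` has twice as many positive squares, over the
reals, as there are positive entries. -/
theorem hasSignature_hermForm_diagonal {κ : Type*} [Fintype κ] [DecidableEq κ] (s : κ → ℝ) :
    HasSignature (hermForm (Matrix.diagonal fun j => (s j : ℂ))) (2 * {j | 0 < s j}.ncard)
      (2 * {j | s j < 0}.ncard) := by
  let e : (κ → ℂ) ≃ₗ[ℝ] (κ ⊕ κ → ℝ) :=
    { toFun := fun x => Sum.elim (fun j => (x j).re) (fun j => (x j).im)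
      invFun := fun y j => ⟨y (Sum.inl j), y (Sum.inr j)⟩
      map_add' := fun x y => by ext (j | j) <;> simp
      map_smul' := fun c x => by ext (j | j) <;> simp
      left_inv := fun x => rfl
      right_inv := fun y => by ext (j | j) <;> rfl }
  let w : κ ⊕ κ → ℝ := Sum.elim s s
  have hcard : ∀ P : ℝ → Prop, {i | P (w i)}.ncard = 2 * {j | P (s j)}.ncard := by
    intro P
    have h : {i | P (w i)} = Sum.inl '' {j | P (s j)} ∪ Sum.inr '' {j | P (s j)} := by
      ext (j | j) <;> simp [w]
    rw [h, Set.ncard_union_eq, Set.ncard_image_of_injective _ Sum.inl_injective,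
      Set.ncard_image_of_injective _ Sum.inr_injective, two_mul]
    rw [Set.disjoint_left]
    rintro _ ⟨j, -, rfl⟩ ⟨j', -, h⟩
    cases h
  have hQ : QuadraticMap.Equivalent (LinearMap.BilinMap.toQuadraticMap
      (hermForm (Matrix.diagonal fun j => (s j : ℂ)))) (QuadraticMap.weightedSumSquares ℝ w) := by
    refine ⟨⟨e, fun x => ?_⟩⟩
    rw [QuadraticMap.weightedSumSquares_apply, LinearMap.BilinMap.toQuadraticMap_apply,
      hermForm_apply, Fintype.sum_sum_type, ← Finset.sum_add_distrib, dotProduct, Complex.re_sum]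
    refine Finset.sum_congr rfl fun j _ => ?_
    simp [w, e, Matrix.mulVec_diagonal]
    ring
  exact ⟨by rw [QuadraticForm.sigPos_of_equiv_weightedSumSquares hQ]; exact hcard (fun t => 0 < t),
    by rw [QuadraticForm.sigNeg_of_equiv_weightedSumSquares hQ]; exact hcard (fun t => t < 0)⟩

theorem hasSignature_unique {V : Type*} [AddCommGroup V] [Module ℝ V]
    {β : LinearMap.BilinForm ℝ V} {p q p' q' : ℕ} (h : HasSignature β p q)
    (h' : HasSignature β p' q') : p = p' ∧ q = q' :=
  ⟨h.1.symm.trans h'.1, h.2.symm.trans h'.2⟩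

theorem ncard_sum_setOf {α β : Type*} [Finite α] [Finite β] (P : α ⊕ β → Prop) :
    {i | P i}.ncard = {a | P (Sum.inl a)}.ncard + {b | P (Sum.inr b)}.ncard := by
  have h : {i | P i} = Sum.inl '' {a | P (Sum.inl a)} ∪ Sum.inr '' {b | P (Sum.inr b)} := by
    ext (j | j) <;> simp
  rw [h, Set.ncard_union_eq, Set.ncard_image_of_injective _ Sum.inl_injective,
    Set.ncard_image_of_injective _ Sum.inr_injective]
  rw [Set.disjoint_left]
  rintro _ ⟨j, -, rfl⟩ ⟨j', -, h⟩
  cases h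

theorem sigMatrix_eq_diagonal (p q : ℕ) : sigMatrix (Fin p) (Fin q) =
    Matrix.diagonal fun j => ((Sum.elim (fun _ => 1) (fun _ => -1) j : ℝ) : ℂ) := by
  rw [sigMatrix, ← Matrix.diagonal_one, ← Matrix.diagonal_one, Matrix.diagonal_neg,
    Matrix.fromBlocks_diagonal]
  congr 1
  ext (j | j) <;> simp

theorem hasSignature_sigMatrix (p q : ℕ) :
    HasSignature (hermForm (sigMatrix (Fin p) (Fin q))) (2 * p) (2 * q) := by
  have h := hasSignature_hermForm_diagonal
    (Sum.elim (fun _ : Fin p => (1 : ℝ)) (fun _ : Fin q => (-1 : ℝ)))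
  rw [← sigMatrix_eq_diagonal, ncard_sum_setOf, ncard_sum_setOf] at h
  have h10 : ¬ (1 : ℝ) < 0 := by norm_num
  simpa [Set.ncard_univ, h10] using h

/-- Multiplication by an invertible (formally rectangular) complex matrix. -/
noncomputable def mulVecEquiv {κ κ' : Type*} [Fintype κ] [Fintype κ'] [DecidableEq κ]
    [DecidableEq κ'] {C : Matrix κ κ' ℂ} {D : Matrix κ' κ ℂ} (hCD : C * D = 1) (hDC : D * C = 1) :
    (κ' → ℂ) ≃ₗ[ℝ] (κ → ℂ) :=
  LinearEquiv.ofLinearMap (C.mulVecLin.restrictScalars ℝ) (D.mulVecLin.restrictScalars ℝ)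
    (LinearMap.ext fun x => by
      change C *ᵥ (D *ᵥ x) = x
      rw [Matrix.mulVec_mulVec, hCD, Matrix.one_mulVec])
    (LinearMap.ext fun x => by
      change D *ᵥ (C *ᵥ x) = x
      rw [Matrix.mulVec_mulVec, hDC, Matrix.one_mulVec])

/-- Signatures of Hermitian forms are invariant under changes of basis. -/
theorem hasSignature_hermForm_congr {κ κ' : Type*} [Fintype κ] [Fintype κ'] [DecidableEq κ]
    [DecidableEq κ'] {A : Matrix κ κ ℂ} {C : Matrix κ κ' ℂ} {D : Matrix κ' κ ℂ} (hCD : C * D = 1)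
    (hDC : D * C = 1) (p q : ℕ) :
    HasSignature (hermForm A) p q ↔ HasSignature (hermForm (Cᴴ * A * C)) p q := by
  exact hasSignature_iff_of_equiv (mulVecEquiv hCD hDC) (fun x => hermForm_mulVec A C x x) p q

/-- The orthogonal sum of a Hermitian form of signature `(p, q)` and the negative of one of
signature `(p', q')`. -/
theorem hasSignature_fromBlocks (p q p' q' : ℕ) :
    HasSignature (hermForm (Matrix.fromBlocks (sigMatrix (Fin p) (Fin q)) 0 0
      (-sigMatrix (Fin p') (Fin q')))) (2 * (p + q')) (2 * (q + p')) := by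
  have h := hasSignature_hermForm_diagonal (Sum.elim
    (Sum.elim (fun _ : Fin p => (1 : ℝ)) (fun _ : Fin q => (-1 : ℝ)))
    (Sum.elim (fun _ : Fin p' => (-1 : ℝ)) (fun _ : Fin q' => (1 : ℝ))))
  have hM : Matrix.fromBlocks (sigMatrix (Fin p) (Fin q)) 0 0 (-sigMatrix (Fin p') (Fin q')) =
      Matrix.diagonal fun j => ((Sum.elim
    (Sum.elim (fun _ : Fin p => (1 : ℝ)) (fun _ : Fin q => (-1 : ℝ)))
    (Sum.elim (fun _ : Fin p' => (-1 : ℝ)) (fun _ : Fin q' => (1 : ℝ))) j : ℝ) : ℂ) := by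
    rw [sigMatrix_eq_diagonal, sigMatrix_eq_diagonal, Matrix.diagonal_neg,
      Matrix.fromBlocks_diagonal]
    congr 1
    ext ((j | j) | (j | j)) <;> simp
  rw [← hM] at h
  simp only [ncard_sum_setOf] at h
  have h10 : ¬ (1 : ℝ) < 0 := by norm_num
  simpa [Set.ncard_univ, h10] using h

/-- The orthogonal sum of two Hermitian forms of signatures `(p, q)` and `(p', q')`. -/
theorem hasSignature_fromBlocks' (p q p' q' : ℕ) :
    HasSignature (hermForm (Matrix.fromBlocks (sigMatrix (Fin p) (Fin q)) 0 0
      (sigMatrix (Fin p') (Fin q')))) (2 * (p + p')) (2 * (q + q')) := by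
  have h := hasSignature_hermForm_diagonal (Sum.elim
    (Sum.elim (fun _ : Fin p => (1 : ℝ)) (fun _ : Fin q => (-1 : ℝ)))
    (Sum.elim (fun _ : Fin p' => (1 : ℝ)) (fun _ : Fin q' => (-1 : ℝ))))
  have hM : Matrix.fromBlocks (sigMatrix (Fin p) (Fin q)) 0 0 (sigMatrix (Fin p') (Fin q')) =
      Matrix.diagonal fun j => ((Sum.elim
    (Sum.elim (fun _ : Fin p => (1 : ℝ)) (fun _ : Fin q => (-1 : ℝ)))
    (Sum.elim (fun _ : Fin p' => (1 : ℝ)) (fun _ : Fin q' => (-1 : ℝ))) j : ℝ) : ℂ) := by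
    rw [sigMatrix_eq_diagonal, sigMatrix_eq_diagonal, Matrix.fromBlocks_diagonal]
    congr 1
    ext ((j | j) | (j | j)) <;> simp
  rw [← hM] at h
  simp only [ncard_sum_setOf] at h
  have h10 : ¬ (1 : ℝ) < 0 := by norm_num
  simpa [Set.ncard_univ, h10] using h

end Signatures

/-! ### The homogeneous spaces of `GL(2m, ℝ)` -/

section RealModels

attribute [local instance] Matrix.linftyOpNormedRing Matrix.linftyOpNormedAlgebra

theorem matrix_eq_neg_iff {K s t : Type*} [Field K] [CharZero K] (x : Matrix s t K) :
    x = -x ↔ x = 0 := by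
  constructor
  · intro h
    ext i j
    have := congrFun (congrFun h i) j
    rw [Matrix.neg_apply, self_eq_neg] at this
    exact this
  · rintro rfl
    simp

theorem commute_diag_iff {K α β : Type*} [Field K] [CharZero K] [Fintype α] [Fintype β]
    [DecidableEq α] [DecidableEq β] (a : Matrix α α K) (b : Matrix α β K) (c : Matrix β α K)
    (d : Matrix β β K) :
    Matrix.fromBlocks 1 0 0 (-1) * Matrix.fromBlocks a b c d =
      Matrix.fromBlocks a b c d * Matrix.fromBlocks 1 0 0 (-1) ↔ b = 0 ∧ c = 0 := by
  simp only [Matrix.fromBlocks_multiply, Matrix.one_mul, Matrix.zero_mul, Matrix.mul_one,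
    Matrix.mul_zero, add_zero, zero_add, Matrix.neg_mul, Matrix.mul_neg, Matrix.fromBlocks_inj,
    true_and, and_true]
  rw [matrix_eq_neg_iff, eq_comm (a := -c), matrix_eq_neg_iff]

theorem exists_blocks_of_commute_diag {K α β : Type*} [Field K] [CharZero K] [Fintype α] [Fintype β]
    [DecidableEq α] [DecidableEq β] {A : Matrix (α ⊕ β) (α ⊕ β) K}
    (h : Matrix.fromBlocks 1 0 0 (-1) * A = A * Matrix.fromBlocks 1 0 0 (-1)) :
    ∃ a d, A = Matrix.fromBlocks a 0 0 d := by
  rw [← Matrix.fromBlocks_toBlocks A, commute_diag_iff] at h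
  refine ⟨A.toBlocks₁₁, A.toBlocks₂₂, ?_⟩
  rw [← h.1, ← h.2, Matrix.fromBlocks_toBlocks]

theorem commute_inv {A : Type*} [Monoid A] {S : A} {g : Aˣ} (h : S * ↑g = ↑g * S) :
    S * ↑g⁻¹ = ↑g⁻¹ * S := by
  rw [Units.mul_inv_eq_iff_eq_mul, mul_assoc, h, Units.inv_mul_cancel_left]

/-- `GL(m, ℝ) × GL(m, ℝ)` is the centralizer of `diag(1, -1)`. -/
theorem mem_range_glProdHom_iff {m : ℕ} (g : GL (Fin m ⊕ Fin m) ℝ) :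
    g ∈ (glProdHom m).range ↔
      Matrix.fromBlocks 1 0 0 (-1) * g.val = g.val * Matrix.fromBlocks 1 0 0 (-1) := by
  constructor
  · rintro ⟨x, rfl⟩
    exact (commute_diag_iff _ _ _ _).2 ⟨rfl, rfl⟩
  · intro h
    obtain ⟨a, d, hg⟩ := exists_blocks_of_commute_diag h
    obtain ⟨a', d', hg'⟩ := exists_blocks_of_commute_diag (commute_inv h)
    have h1 := g.mul_inv
    have h2 := g.inv_mul
    rw [hg, hg', Matrix.fromBlocks_multiply, ← Matrix.fromBlocks_one,
      Matrix.fromBlocks_inj] at h1 h2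
    simp only [Matrix.mul_zero, add_zero, zero_add] at h1 h2
    exact ⟨(⟨a, a', h1.1, h2.1⟩, ⟨d, d', h1.2.2.2, h2.2.2.2⟩), Units.ext hg.symm⟩

theorem trace_fromBlocks_one_neg_one {K : Type*} [Field K] (m : ℕ) :
    (Matrix.fromBlocks 1 0 0 (-1) : Matrix (Fin m ⊕ Fin m) (Fin m ⊕ Fin m) K).trace = 0 := by
  simp [Matrix.trace, Fintype.sum_sum_type]

/-- Traceless involutions of `ℝ^{2m}` form the space `GL(2m, ℝ) / (GL(m, ℝ) × GL(m, ℝ))`. -/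
theorem isHomogeneousModel_involutions (m : ℕ) :
    IsHomogeneousModel glIncl (glProdHom m).range
      {A : Matrix (Fin m ⊕ Fin m) (Fin m ⊕ Fin m) ℝ | A * A = 1 ∧ A.trace = 0} := by
  have hS₀ : (Matrix.fromBlocks 1 0 0 (-1) : Matrix (Fin m ⊕ Fin m) (Fin m ⊕ Fin m) ℝ) *
      Matrix.fromBlocks 1 0 0 (-1) = (1 : ℝ) • 1 := by
    simp [Matrix.fromBlocks_multiply]
  have h := isHomogeneousModel_gl (one_mul 1) hS₀ mem_range_glProdHom_iff
  convert h using 1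
  ext A
  constructor
  · rintro ⟨hA, htr⟩
    obtain ⟨g, hg⟩ := exists_conj_involution hA htr
    exact ⟨g, by rw [← hg, Units.mul_inv_cancel_right]⟩
  · rintro ⟨g, rfl⟩
    refine ⟨(conj_sq hS₀ g).trans (one_smul _ _), ?_⟩
    rw [Matrix.trace_mul_cycle, Units.inv_mul, one_mul, trace_fromBlocks_one_neg_one]

theorem exists_blocks_of_commute_J {m : ℕ} {A : Matrix (Fin m ⊕ Fin m) (Fin m ⊕ Fin m) ℝ}
    (h : Matrix.fromBlocks 0 (-1) 1 0 * A = A * Matrix.fromBlocks 0 (-1) 1 0) :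
    ∃ a c, A = Matrix.fromBlocks a (-c) c a := by
  rw [← Matrix.fromBlocks_toBlocks A] at h
  simp only [Matrix.fromBlocks_multiply, Matrix.one_mul, Matrix.zero_mul, Matrix.mul_one,
    Matrix.mul_zero, add_zero, zero_add, Matrix.neg_mul, Matrix.mul_neg, Matrix.fromBlocks_inj,
    neg_inj] at h
  refine ⟨A.toBlocks₁₁, A.toBlocks₂₁, ?_⟩
  conv_lhs => rw [← Matrix.fromBlocks_toBlocks A, ← h.1, h.2.1]

/-- `GL(m, ℂ)` is the centralizer of the standard complex structure. -/
theorem mem_range_glRealHom_iff {m : ℕ} (g : GL (Fin m ⊕ Fin m) ℝ) :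
    g ∈ (glRealHom m).range ↔
      Matrix.fromBlocks 0 (-1) 1 0 * g.val = g.val * Matrix.fromBlocks 0 (-1) 1 0 := by
  constructor
  · rintro ⟨A, rfl⟩
    change Matrix.fromBlocks 0 (-1) 1 0 * Matrix.fromBlocks _ _ _ _ =
      Matrix.fromBlocks _ _ _ _ * Matrix.fromBlocks 0 (-1) 1 0
    simp [Matrix.fromBlocks_multiply]
  · intro h
    obtain ⟨a, c, hg⟩ := exists_blocks_of_commute_J h
    obtain ⟨a', c', hg'⟩ := exists_blocks_of_commute_J (commute_inv h)
    have h1 := g.mul_inv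
    have h2 := g.inv_mul
    rw [hg, hg', Matrix.fromBlocks_multiply, ← Matrix.fromBlocks_one,
      Matrix.fromBlocks_inj] at h1 h2
    -- The complex matrix `x + iy`.
    let z : Matrix (Fin m) (Fin m) ℝ → Matrix (Fin m) (Fin m) ℝ → Matrix (Fin m) (Fin m) ℂ :=
      fun x y => Matrix.of fun i j => ⟨x i j, y i j⟩
    have hz : ∀ x y x' y' : Matrix (Fin m) (Fin m) ℝ,
        x * x' + -y * y' = 1 → y * x' + x * y' = 0 → z x y * z x' y' = 1 := by
      intro x y x' y' hr hi
      ext i j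
      have hr' := congrFun (congrFun hr i) j
      have hi' := congrFun (congrFun hi i) j
      simp only [Matrix.add_apply, Matrix.mul_apply, Matrix.neg_apply,
        ← Finset.sum_add_distrib, Matrix.zero_apply] at hr' hi'
      apply Complex.ext
      · rw [Matrix.mul_apply, Complex.re_sum]
        simp only [z, Matrix.of_apply, Complex.mul_re]
        rw [show ((1 : Matrix (Fin m) (Fin m) ℂ) i j).re = (1 : Matrix (Fin m) (Fin m) ℝ) i j by
          by_cases hij : i = j <;> simp [hij, Matrix.one_apply], ← hr']
        exact Finset.sum_congr rfl fun k _ => by ring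
      · rw [Matrix.mul_apply, Complex.im_sum]
        simp only [z, Matrix.of_apply, Complex.mul_im]
        rw [show ((1 : Matrix (Fin m) (Fin m) ℂ) i j).im = 0 by
          by_cases hij : i = j <;> simp [hij, Matrix.one_apply], ← hi']
        exact Finset.sum_congr rfl fun k _ => by ring
    exact ⟨⟨z a c, z a' c', hz _ _ _ _ h1.1 h1.2.2.1, hz _ _ _ _ h2.1 h2.2.2.1⟩,
      Units.ext hg.symm⟩

/-- Complex structures on `ℝ^{2m}` form the space `GL(2m, ℝ) / GL(m, ℂ)`. -/
theorem isHomogeneousModel_complexStructures (m : ℕ) :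
    IsHomogeneousModel glIncl (glRealHom m).range
      {A : Matrix (Fin m ⊕ Fin m) (Fin m ⊕ Fin m) ℝ | A * A = -1} := by
  have hS₀ : (Matrix.fromBlocks 0 (-1) 1 0 : Matrix (Fin m ⊕ Fin m) (Fin m ⊕ Fin m) ℝ) *
      Matrix.fromBlocks 0 (-1) 1 0 = (-1 : ℝ) • 1 := by
    rw [← Matrix.fromBlocks_one, Matrix.fromBlocks_multiply, Matrix.fromBlocks_smul]
    simp
  have h := isHomogeneousModel_gl (by norm_num) hS₀ mem_range_glRealHom_iff
  convert h using 1
  ext A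
  constructor
  · intro hA
    obtain ⟨g, hg⟩ := exists_conj_complexStructure hA
    exact ⟨g, by rw [← hg, Units.mul_inv_cancel_right]⟩
  · rintro ⟨g, rfl⟩
    exact (conj_sq hS₀ g).trans (by rw [neg_smul, one_smul])

end RealModels

/-! ### The homogeneous spaces of `U(m, m)` -/

section UnitaryModels

attribute [local instance] Matrix.linftyOpNormedRing Matrix.linftyOpNormedAlgebra

theorem sigAdjoint_eq_neg_iff {p q : ℕ} (S : CMat p q) :
    sigAdjoint p q S = -S ↔ Sᴴ * sigMatrix _ _ = -(sigMatrix _ _ * S) := by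
  have h := sigMatrix_mul_self p q
  rw [sigAdjoint_apply]
  constructor
  · intro h1
    rw [← mul_neg, ← h1, ← mul_assoc, ← mul_assoc, h, one_mul]
  · intro h1
    rw [mul_assoc, h1, mul_neg, ← mul_assoc, h, one_mul]

/-- If `P` is self-adjoint (`δ = 1`) or skew-adjoint (`δ = -1`) for the Hermitian form `B`, then
the Gram matrix of an eigenbasis commutes or anticommutes with the diagonal matrix of the
eigenvalues. -/
theorem gram_of_eigenbasis {κ κ' : Type*} [Fintype κ] [Fintype κ']
    {P B : Matrix κ κ ℂ} {D : Matrix κ' κ' ℂ} {g : Matrix κ κ' ℂ} {δ : ℂ}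
    (hP : Pᴴ * B = δ • (B * P)) (hD : Dᴴ = D) (hg : P * g = g * D) :
    D * (gᴴ * B * g) = δ • (gᴴ * B * g * D) := by
  have h : D * gᴴ = gᴴ * Pᴴ := by
    rw [← Matrix.conjTranspose_mul, hg, Matrix.conjTranspose_mul, hD]
  calc D * (gᴴ * B * g) = gᴴ * (Pᴴ * B) * g := by
        rw [Matrix.mul_assoc gᴴ, ← Matrix.mul_assoc D, h]
        simp only [Matrix.mul_assoc]
    _ = _ := by
        rw [hP, Matrix.mul_smul, Matrix.smul_mul, Matrix.mul_assoc, Matrix.mul_assoc B, hg]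
        simp only [Matrix.mul_assoc]

theorem isHermitian_gram {κ κ' : Type*} [Fintype κ] {B : Matrix κ κ ℂ} (hB : Bᴴ = B)
    (g : Matrix κ κ' ℂ) : (gᴴ * B * g)ᴴ = gᴴ * B * g := by
  rw [Matrix.conjTranspose_mul, Matrix.conjTranspose_mul, Matrix.conjTranspose_conjTranspose,
    hB, Matrix.mul_assoc]

/-- `GL(m, ℂ) ⊆ U(m, m)` is the centralizer of the swap of the two factors. -/
theorem mem_range_glUnitaryHom_iff {m : ℕ} (g : unitaryGrp m m) :
    g ∈ (glUnitaryHom m).range ↔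
      Matrix.fromBlocks 0 1 1 0 * g.val.val = g.val.val * Matrix.fromBlocks 0 1 1 0 := by
  constructor
  · rintro ⟨A, rfl⟩
    change Matrix.fromBlocks 0 1 1 0 * Matrix.fromBlocks _ _ _ _ =
      Matrix.fromBlocks _ _ _ _ * Matrix.fromBlocks 0 1 1 0
    simp [Matrix.fromBlocks_multiply]
  · intro h
    have hg : ∃ a b, g.val.val = Matrix.fromBlocks a b b a := by
      rw [← Matrix.fromBlocks_toBlocks g.val.val] at h
      simp only [Matrix.fromBlocks_multiply, Matrix.one_mul, Matrix.zero_mul, Matrix.mul_one,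
        Matrix.mul_zero, add_zero, zero_add, Matrix.fromBlocks_inj] at h
      refine ⟨g.val.val.toBlocks₁₁, g.val.val.toBlocks₂₁, ?_⟩
      conv_lhs => rw [← Matrix.fromBlocks_toBlocks g.val.val, ← h.1, h.2.1]
    obtain ⟨a, b, hg⟩ := hg
    have h1 : g.val.val * g.val⁻¹.val = 1 := g.val.mul_inv
    rw [← sigAdjoint_unitary, hg, sigAdjoint_apply, sigMatrix, Matrix.fromBlocks_conjTranspose,
      Matrix.fromBlocks_multiply, Matrix.fromBlocks_multiply, Matrix.fromBlocks_multiply,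
      ← Matrix.fromBlocks_one, Matrix.fromBlocks_inj] at h1
    simp only [Matrix.one_mul, Matrix.zero_mul, Matrix.mul_one, Matrix.mul_zero, add_zero,
      zero_add, Matrix.neg_mul, Matrix.mul_neg, neg_neg] at h1
    have h2 : (a + b) * (aᴴ - bᴴ) = 1 := by
      calc (a + b) * (aᴴ - bᴴ) = (a * aᴴ + -(b * bᴴ)) + (-(a * bᴴ) + b * aᴴ) := by noncomm_ring
        _ = 1 := by rw [h1.1, h1.2.1, add_zero]
    refine ⟨⟨a + b, aᴴ - bᴴ, h2, mul_eq_one_comm.1 h2⟩, ?_⟩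
    apply Subtype.ext
    apply Units.ext
    rw [hg]
    change Matrix.fromBlocks ((1 / 2 : ℂ) • (a + b + (aᴴ - bᴴ)ᴴ))
      ((1 / 2 : ℂ) • (a + b - (aᴴ - bᴴ)ᴴ)) ((1 / 2 : ℂ) • (a + b - (aᴴ - bᴴ)ᴴ))
      ((1 / 2 : ℂ) • (a + b + (aᴴ - bᴴ)ᴴ)) = _
    rw [Matrix.conjTranspose_sub, Matrix.conjTranspose_conjTranspose,
      Matrix.conjTranspose_conjTranspose]
    congr 1 <;> module

/-- A skew-adjoint involution of `ℂ^{m,m}` has isotropic eigenspaces, which are in duality; hence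
it is conjugate in `U(m, m)` to the swap of the two factors. -/
theorem exists_unitary_conj_swap {m : ℕ} {S : CMat m m} (hS : S * S = 1)
    (hskew : sigAdjoint m m S = -S) (htr : S.trace = 0) :
    ∃ g : unitaryGrp m m, S * g.val.val = g.val.val * Matrix.fromBlocks 0 1 1 0 := by
  obtain ⟨g, hg⟩ := exists_conj_involution hS htr
  have hD : (Matrix.fromBlocks 1 0 0 (-1) : CMat m m)ᴴ = Matrix.fromBlocks 1 0 0 (-1) :=
    sigMatrix_conjTranspose m m
  have hM := gram_of_eigenbasis (δ := -1)
    (((sigAdjoint_eq_neg_iff S).1 hskew).trans (neg_one_smul ℂ _).symm) hD hg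
  have hH := isHermitian_gram (sigMatrix_conjTranspose m m) g.val
  have hinv : (g.valᴴ * sigMatrix _ _ * g.val) * (g⁻¹.val * sigMatrix _ _ * g⁻¹.valᴴ) = 1 := by
    have h1 : g.valᴴ * g⁻¹.valᴴ = 1 := by
      rw [← Matrix.conjTranspose_mul, Units.inv_mul, Matrix.conjTranspose_one]
    calc _ = g.valᴴ * (sigMatrix _ _ * (g.val * g⁻¹.val) * sigMatrix _ _) * g⁻¹.valᴴ := by
          simp only [mul_assoc]
      _ = 1 := by rw [Units.mul_inv, mul_one, sigMatrix_mul_self, mul_one, h1]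
  set G := g.valᴴ * sigMatrix _ _ * g.val with hG
  set G' := g⁻¹.val * sigMatrix _ _ * g⁻¹.valᴴ
  obtain ⟨K, hK⟩ : ∃ K, G = Matrix.fromBlocks 0 K Kᴴ 0 := by
    rw [← Matrix.fromBlocks_toBlocks G] at hM hH
    rw [Matrix.fromBlocks_multiply, Matrix.fromBlocks_multiply, Matrix.fromBlocks_smul,
      Matrix.fromBlocks_inj] at hM
    rw [Matrix.fromBlocks_conjTranspose, Matrix.fromBlocks_inj] at hH
    simp only [Matrix.one_mul, Matrix.zero_mul, Matrix.mul_one, Matrix.mul_zero, add_zero,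
      zero_add, Matrix.neg_mul, Matrix.mul_neg, neg_smul, one_smul, neg_neg] at hM
    refine ⟨G.toBlocks₁₂, ?_⟩
    conv_lhs => rw [← Matrix.fromBlocks_toBlocks G, (matrix_eq_neg_iff _).1 hM.1,
      (matrix_eq_neg_iff _).1 hM.2.2.2.symm, ← hH.2.2.1]
  obtain ⟨z, hz⟩ : ∃ z, K * z = 1 := by
    rw [hK, ← Matrix.fromBlocks_toBlocks G', Matrix.fromBlocks_multiply, ← Matrix.fromBlocks_one,
      Matrix.fromBlocks_inj] at hinv
    exact ⟨_, by simpa using hinv.1⟩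
  have hz' : zᴴ * Kᴴ = 1 := by rw [← Matrix.conjTranspose_mul, hz, Matrix.conjTranspose_one]
  -- `g * diag(1, z)` consists of dual bases of the two eigenspaces; rotate them by 45 degrees.
  let r : ℂ := ((Real.sqrt 2)⁻¹ : ℝ)
  have hr : r * r = 1 / 2 := by
    simp only [r]
    rw [← Complex.ofReal_mul, ← mul_inv, Real.mul_self_sqrt (by norm_num)]
    norm_num
  have hr' : star r = r := Complex.conj_ofReal _
  let h : CMat m m := Matrix.fromBlocks (r • 1) (r • 1) (r • z) (-(r • z))
  have hu : (g.val * h)ᴴ * sigMatrix _ _ * (g.val * h) = sigMatrix _ _ := by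
    calc _ = hᴴ * G * h := by
          rw [Matrix.conjTranspose_mul, hG]; simp only [mul_assoc]
      _ = _ := by
          simp only [h]
          rw [hK, Matrix.fromBlocks_conjTranspose, Matrix.fromBlocks_multiply,
            Matrix.fromBlocks_multiply, sigMatrix]
          simp only [Matrix.conjTranspose_smul, Matrix.conjTranspose_neg,
            Matrix.conjTranspose_one, hr', Matrix.mul_one, Matrix.one_mul, Matrix.mul_zero,
            add_zero, zero_add, Matrix.mul_neg, Matrix.neg_mul, Matrix.smul_mul, Matrix.mul_smul,
            hz, hz', smul_neg, smul_smul, hr]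
          congr 1 <;> module
  obtain ⟨u, hu'⟩ := exists_unitary ((sigAdjoint_mul_eq_one_iff _).2 hu)
  refine ⟨u, ?_⟩
  rw [hu', ← mul_assoc, hg, mul_assoc, mul_assoc]
  congr 1
  simp [h, Matrix.fromBlocks_multiply]

/-- The skew-adjoint traceless involutions of `ℂ^{m,m}` form the space `U(m, m) / GL(m, ℂ)`. -/
theorem isHomogeneousModel_skewInvolutions (m : ℕ) :
    IsHomogeneousModel (unitaryIncl m m) (glUnitaryHom m).range
      {S : CMat m m | S * S = 1 ∧ sigAdjoint m m S = -S ∧ S.trace = 0} := by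
  have hS₀ : (Matrix.fromBlocks 0 1 1 0 : CMat m m) * Matrix.fromBlocks 0 1 1 0 = (1 : ℝ) • 1 := by
    simp [Matrix.fromBlocks_multiply]
  have hskew : sigAdjoint m m (Matrix.fromBlocks 0 1 1 0) = -Matrix.fromBlocks 0 1 1 0 := by
    simp [sigAdjoint_apply, sigMatrix, Matrix.fromBlocks_multiply,
      Matrix.fromBlocks_conjTranspose, Matrix.fromBlocks_neg]
  have h := isHomogeneousModel_unitary (one_mul 1) hS₀ hskew mem_range_glUnitaryHom_iff
  convert h using 1
  ext S
  constructor
  · rintro ⟨hS, hsk, htr⟩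
    obtain ⟨g, hg⟩ := exists_unitary_conj_swap hS hsk htr
    exact ⟨g, by rw [← hg, Units.mul_inv_cancel_right]⟩
  · rintro ⟨g, rfl⟩
    refine ⟨(conj_sq hS₀ g.val).trans (one_smul _ _), sigAdjoint_conj hskew g, ?_⟩
    rw [Matrix.trace_mul_cycle, Units.inv_mul, one_mul]
    simp [Matrix.trace, Fintype.sum_sum_type]

theorem sigMatrix_eq_reindex (m n : ℕ) (h : n ≤ m) : sigMatrix (Fin m) (Fin m) =
    Matrix.reindex (splitEquiv m n h) (splitEquiv m n h)
      (Matrix.fromBlocks (sigMatrix (Fin n) (Fin (m - n))) 0 0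
        (sigMatrix (Fin (m - n)) (Fin n))) := by
  rw [← Equiv.symm_apply_eq]
  ext i j
  rcases i with (i | i) | (i | i) <;> rcases j with (j | j) | (j | j) <;>
    simp [sigMatrix, splitEquiv, Matrix.one_apply, Fin.ext_iff] <;> omega

/-- The involution of `ℂ^{m,m} = ℂ^{n,m-n} ⊕ ℂ^{m-n,n}` that is `1` on the first summand and `-1`
on the second. -/
noncomputable def splitInvolution (m n : ℕ) (h : n ≤ m) : CMat m m :=
  Matrix.reindex (splitEquiv m n h) (splitEquiv m n h) (Matrix.fromBlocks 1 0 0 (-1))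

theorem splitInvolution_mul_self (m n : ℕ) (h : n ≤ m) :
    splitInvolution m n h * splitInvolution m n h = 1 := by
  simp [splitInvolution, Matrix.submatrix_mul_equiv, Matrix.fromBlocks_multiply]

theorem splitInvolution_conjTranspose (m n : ℕ) (h : n ≤ m) :
    (splitInvolution m n h)ᴴ = splitInvolution m n h := by
  simp [splitInvolution, Matrix.conjTranspose_submatrix, Matrix.fromBlocks_conjTranspose]

theorem splitInvolution_trace (m n : ℕ) (h : n ≤ m) : (splitInvolution m n h).trace = 0 := by
  rw [splitInvolution, Matrix.trace, Matrix.reindex_apply,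
    ← Equiv.sum_comp (splitEquiv m n h)]
  simp [Fintype.sum_sum_type]
  ring

theorem sigMatrix_mul_splitInvolution (m n : ℕ) (h : n ≤ m) :
    sigMatrix (Fin m) (Fin m) * splitInvolution m n h =
      Matrix.reindex (splitEquiv m n h) (splitEquiv m n h)
        (Matrix.fromBlocks (sigMatrix (Fin n) (Fin (m - n))) 0 0
          (-sigMatrix (Fin (m - n)) (Fin n))) := by
  rw [sigMatrix_eq_reindex m n h, splitInvolution]
  simp [Matrix.submatrix_mul_equiv, Matrix.fromBlocks_multiply]

theorem splitInvolution_mul_sigMatrix (m n : ℕ) (h : n ≤ m) :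
    splitInvolution m n h * sigMatrix (Fin m) (Fin m) =
      sigMatrix (Fin m) (Fin m) * splitInvolution m n h := by
  rw [sigMatrix_mul_splitInvolution, sigMatrix_eq_reindex m n h, splitInvolution]
  simp [Matrix.submatrix_mul_equiv, Matrix.fromBlocks_multiply]

theorem hasSignature_hermForm_reindex {κ κ' : Type*} [Fintype κ] [Fintype κ'] (e : κ ≃ κ')
    (A : Matrix κ κ ℂ) (p q : ℕ) :
    HasSignature (hermForm (Matrix.reindex e e A)) p q ↔ HasSignature (hermForm A) p q := by
  refine hasSignature_iff_of_equiv (LinearEquiv.funCongrLeft ℝ ℂ e.symm) (fun x => ?_) p q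
  change (star (x ∘ e.symm) ⬝ᵥ (A.submatrix e.symm e.symm) *ᵥ (x ∘ e.symm)).re = _
  rw [Matrix.submatrix_mulVec_equiv, hermForm_apply, Function.comp_assoc, Equiv.symm_symm,
    Equiv.symm_comp_self, Function.comp_id]
  exact congrArg Complex.re (comp_equiv_dotProduct_comp_equiv (star x) (A *ᵥ x) e.symm)

/-- `U(n, m - n) × U(m - n, n) ⊆ U(m, m)` is the centralizer of `-i` times `splitInvolution`. -/
theorem mem_range_unitaryProdHom_iff {m n : ℕ} (hn : n ≤ m) (g : unitaryGrp m m) :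
    g ∈ (unitaryProdHom m n hn).range ↔
      (-Complex.I • splitInvolution m n hn) * g.val.val =
        g.val.val * (-Complex.I • splitInvolution m n hn) := by
  have hI : -Complex.I ≠ 0 := neg_ne_zero.2 Complex.I_ne_zero
  rw [Matrix.smul_mul, Matrix.mul_smul, (smul_right_injective _ hI).eq_iff]
  constructor
  · rintro ⟨x, rfl⟩
    change splitInvolution m n hn * Matrix.reindex _ _ (Matrix.fromBlocks _ 0 0 _) =
      Matrix.reindex _ _ (Matrix.fromBlocks _ 0 0 _) * splitInvolution m n hn
    rw [splitInvolution]
    simp [Matrix.submatrix_mul_equiv, Matrix.fromBlocks_multiply]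
  · intro h
    set e := splitEquiv m n hn with he
    obtain ⟨A, hA⟩ : ∃ A, g.val.val = Matrix.reindex e e A :=
      ⟨_, ((Matrix.reindex e e).apply_symm_apply _).symm⟩
    have h1 : (Matrix.fromBlocks 1 0 0 (-1)) * A = A * Matrix.fromBlocks 1 0 0 (-1) := by
      apply (Matrix.reindex e e).injective
      rw [hA, splitInvolution, ← he] at h
      simpa only [Matrix.reindex_apply, Matrix.submatrix_mul_equiv] using h
    obtain ⟨a, d, rfl⟩ := exists_blocks_of_commute_diag h1
    have h2 : g.val.valᴴ * sigMatrix _ _ * g.val.val = sigMatrix _ _ := g.2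
    rw [hA, sigMatrix_eq_reindex m n hn, ← he] at h2
    simp only [Matrix.reindex_apply, Matrix.conjTranspose_submatrix,
      Matrix.submatrix_mul_equiv] at h2
    have h3 := (Matrix.reindex e e).injective (show Matrix.reindex e e
      ((Matrix.fromBlocks a 0 0 d)ᴴ * Matrix.fromBlocks (sigMatrix _ _) 0 0 (sigMatrix _ _) *
        Matrix.fromBlocks a 0 0 d) =
      Matrix.reindex e e (Matrix.fromBlocks (sigMatrix _ _) 0 0 (sigMatrix _ _)) from h2)
    rw [Matrix.fromBlocks_conjTranspose, Matrix.fromBlocks_multiply, Matrix.fromBlocks_multiply,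
      Matrix.fromBlocks_inj] at h3
    simp only [Matrix.conjTranspose_zero, Matrix.mul_zero, Matrix.zero_mul, add_zero,
      zero_add] at h3
    obtain ⟨x, hx⟩ := exists_unitary ((sigAdjoint_mul_eq_one_iff a).2 h3.1)
    obtain ⟨y, hy⟩ := exists_unitary ((sigAdjoint_mul_eq_one_iff d).2 h3.2.2.2)
    refine ⟨(x, y), Subtype.ext (Units.ext ?_)⟩
    rw [hA, ← hx, ← hy]
    rfl

/-- A traceless self-adjoint involution `P` of `ℂ^{m,m}` for which the form `⟨x, P y⟩` has
signature `(4n, 4m - 4n)` over `ℝ` has eigenspaces of signatures `(n, m - n)` and `(m - n, n)`. -/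
theorem exists_unitary_conj_splitInvolution {m n : ℕ} (hn : n ≤ m) {P : CMat m m}
    (hP : P * P = 1) (hadj : Pᴴ * sigMatrix _ _ = sigMatrix _ _ * P) (htr : P.trace = 0)
    (hsig : HasSignature (hermForm (sigMatrix _ _ * P)) (4 * n) (4 * m - 4 * n)) :
    ∃ g : unitaryGrp m m, P * g.val.val = g.val.val * splitInvolution m n hn := by
  obtain ⟨g, hg⟩ := exists_conj_involution hP htr
  have hD : (Matrix.fromBlocks 1 0 0 (-1) : CMat m m)ᴴ = Matrix.fromBlocks 1 0 0 (-1) :=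
    sigMatrix_conjTranspose m m
  have hM := (gram_of_eigenbasis (δ := 1) (hadj.trans (one_smul ℂ _).symm) hD hg).trans
    (one_smul ℂ _)
  obtain ⟨A, B, hG⟩ := exists_blocks_of_commute_diag hM
  have hH := isHermitian_gram (sigMatrix_conjTranspose m m) g.val
  rw [hG, Matrix.fromBlocks_conjTranspose, Matrix.fromBlocks_inj] at hH
  have hU : IsUnit (g.valᴴ * sigMatrix _ _ * g.val) := by
    refine (IsUnit.mul ?_ ?_).mul g.isUnit
    · exact g.isUnit.star
    · exact IsUnit.of_mul_eq_one _ (sigMatrix_mul_self m m)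
  rw [hG, Matrix.isUnit_iff_isUnit_det, Matrix.det_fromBlocks_zero₂₁, IsUnit.mul_iff,
    ← Matrix.isUnit_iff_isUnit_det, ← Matrix.isUnit_iff_isUnit_det] at hU
  obtain ⟨p, q, C, C', h1, h2, hpq, hC⟩ := exists_orthonormal_of_isHermitian hH.1 hU.1
  obtain ⟨p', q', E, E', h3, h4, hpq', hE⟩ := exists_orthonormal_of_isHermitian hH.2.2.2 hU.2
  -- Orthonormal bases of the two eigenspaces, of signatures `(p, q)` and `(p', q')`.
  let F := g.val * Matrix.fromBlocks C 0 0 E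
  let F' := Matrix.fromBlocks C' 0 0 E' * g⁻¹.val
  have hFF' : F * F' = 1 := by
    simp only [F, F']
    rw [Matrix.mul_assoc, ← Matrix.mul_assoc (Matrix.fromBlocks C 0 0 E),
      Matrix.fromBlocks_multiply]
    simp [h1, h3]
  have hF'F : F' * F = 1 := by
    simp only [F, F']
    rw [Matrix.mul_assoc, ← Matrix.mul_assoc g⁻¹.val, Units.inv_mul, Matrix.one_mul,
      Matrix.fromBlocks_multiply]
    simp [h2, h4]
  let D : Matrix ((Fin p ⊕ Fin q) ⊕ (Fin p' ⊕ Fin q')) ((Fin p ⊕ Fin q) ⊕ (Fin p' ⊕ Fin q')) ℂ :=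
    Matrix.fromBlocks 1 0 0 (-1)
  have hPF : P * F = F * D := by
    simp only [F, D]
    rw [← Matrix.mul_assoc, hg, Matrix.mul_assoc, Matrix.mul_assoc]
    simp [Matrix.fromBlocks_multiply]
  have hF1 : Fᴴ * sigMatrix (Fin m) (Fin m) * F =
      Matrix.fromBlocks (sigMatrix _ _) 0 0 (sigMatrix _ _) := by
    calc _ = (Matrix.fromBlocks C 0 0 E)ᴴ * (g.valᴴ * sigMatrix _ _ * g.val) *
          Matrix.fromBlocks C 0 0 E := by
          simp only [F, Matrix.conjTranspose_mul, Matrix.mul_assoc]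
      _ = _ := by
          rw [hG, Matrix.fromBlocks_conjTranspose, Matrix.fromBlocks_multiply,
            Matrix.fromBlocks_multiply]
          simp [hC, hE]
  have hF2 : Fᴴ * (sigMatrix (Fin m) (Fin m) * P) * F =
      Matrix.fromBlocks (sigMatrix _ _) 0 0 (-sigMatrix _ _) := by
    calc Fᴴ * (sigMatrix (Fin m) (Fin m) * P) * F = Fᴴ * sigMatrix (Fin m) (Fin m) * (P * F) := by
          simp only [Matrix.mul_assoc]
      _ = (Fᴴ * sigMatrix (Fin m) (Fin m) * F) * D := by
          rw [hPF]
          simp only [Matrix.mul_assoc]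
      _ = _ := by
          rw [hF1, Matrix.fromBlocks_multiply]
          simp
  have hs1 := hasSignature_unique
    ((hasSignature_hermForm_congr hFF' hF'F _ _).1 (hasSignature_sigMatrix m m))
    (hF1 ▸ hasSignature_fromBlocks' p q p' q')
  have hs2 := hasSignature_unique
    ((hasSignature_hermForm_congr hFF' hF'F _ _).1 hsig)
    (hF2 ▸ hasSignature_fromBlocks p q p' q')
  -- The signatures `(2m, 2m)` of the form itself and `(4n, 4m - 4n)` of `⟨x, P y⟩` give
  -- `p + p' = m` and `p + q' = 2n`, whereas `p + q = p' + q' = m`.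
  rw [Fintype.card_fin] at hpq hpq'
  obtain rfl : p = n := by omega
  obtain rfl : q = m - p := by omega
  obtain rfl : p' = m - p := by omega
  obtain rfl : p = q' := by omega
  let e := splitEquiv m p hn
  let u : CMat m m := F.submatrix id e.symm
  have hu : uᴴ * sigMatrix _ _ * u = sigMatrix _ _ := by
    have h5 : uᴴ * sigMatrix _ _ * u =
        Matrix.reindex e e (Fᴴ * sigMatrix (Fin m) (Fin m) * F) := rfl
    rw [h5, hF1]
    exact (sigMatrix_eq_reindex m p hn).symm
  obtain ⟨v, hv⟩ := exists_unitary ((sigAdjoint_mul_eq_one_iff _).2 hu)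
  refine ⟨v, ?_⟩
  rw [hv]
  change P.submatrix id id * F.submatrix id e.symm =
    F.submatrix id e.symm * D.submatrix e.symm e.symm
  rw [Matrix.submatrix_mul_equiv, ← hPF, ← Matrix.submatrix_mul _ _ _ _ _ Function.bijective_id]

/-- The complex structures of `ℂ^{m,m}` that lie in the Lie algebra of `U(m, m)`, are traceless and
whose associated Hermitian form has signature `(4n, 4m - 4n)` over `ℝ`, form the space
`U(m, m) / (U(n, m - n) × U(m - n, n))`. -/
theorem isHomogeneousModel_skewComplexStructures {m n : ℕ} (hn : n ≤ m) :
    IsHomogeneousModel (unitaryIncl m m) (unitaryProdHom m n hn).range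
      {S : CMat m m | S * S = -1 ∧ sigAdjoint m m S = -S ∧ S.trace = 0 ∧
        HasSignature (hermForm (sigMatrix _ _ * (Complex.I • S))) (4 * n) (4 * m - 4 * n)} := by
  have hS₀ : (-Complex.I • splitInvolution m n hn) * (-Complex.I • splitInvolution m n hn) =
      (-1 : ℝ) • 1 := by
    rw [smul_mul_smul_comm, splitInvolution_mul_self, neg_mul_neg, Complex.I_mul_I, neg_one_smul,
      neg_one_smul]
  have hskew : sigAdjoint m m (-Complex.I • splitInvolution m n hn) =
      -(-Complex.I • splitInvolution m n hn) := by
    rw [sigAdjoint_eq_neg_iff, Matrix.conjTranspose_smul, splitInvolution_conjTranspose,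
      Matrix.smul_mul, Matrix.mul_smul, splitInvolution_mul_sigMatrix, ← neg_smul]
    simp
  have hI : ∀ S : CMat m m, -Complex.I • Complex.I • S = S := fun S => by
    rw [smul_smul, neg_mul, Complex.I_mul_I, neg_neg, one_smul]
  have hI' : ∀ S : CMat m m, Complex.I • -Complex.I • S = S := fun S => by
    rw [smul_smul, mul_neg, Complex.I_mul_I, neg_neg, one_smul]
  have h := isHomogeneousModel_unitary (by norm_num) hS₀ hskew (mem_range_unitaryProdHom_iff hn)
  convert h using 1
  ext S
  constructor
  · rintro ⟨hS, hsk, htr, hsig⟩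
    have hP : (Complex.I • S) * (Complex.I • S) = 1 := by
      rw [smul_mul_smul_comm, hS, Complex.I_mul_I, neg_smul_neg, one_smul]
    have hadj : (Complex.I • S)ᴴ * sigMatrix _ _ = sigMatrix _ _ * (Complex.I • S) := by
      rw [Matrix.conjTranspose_smul, Matrix.smul_mul, (sigAdjoint_eq_neg_iff S).1 hsk,
        Matrix.mul_smul]
      simp
    obtain ⟨g, hg⟩ := exists_unitary_conj_splitInvolution hn hP hadj
      (by rw [Matrix.trace_smul, htr, smul_zero]) hsig
    refine ⟨g, ?_⟩
    rw [Units.eq_mul_inv_iff_mul_eq, Matrix.mul_smul, ← hg, Matrix.smul_mul, hI]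
  · rintro ⟨g, rfl⟩
    refine ⟨(conj_sq hS₀ g.val).trans (neg_one_smul _ _), sigAdjoint_conj hskew g, ?_, ?_⟩
    · rw [Matrix.trace_mul_cycle, Units.inv_mul, one_mul, Matrix.trace_smul,
        splitInvolution_trace, smul_zero]
    · have h1 : g.val.val * g.val⁻¹.val = 1 := g.val.mul_inv
      have h2 : g.val⁻¹.val * g.val.val = 1 := g.val.inv_mul
      have h3 : g.val.valᴴ * sigMatrix _ _ * g.val.val = sigMatrix _ _ := g.2
      rw [hasSignature_hermForm_congr h1 h2, ← Matrix.smul_mul, ← Matrix.mul_smul, hI',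
        show g.val.valᴴ * (sigMatrix _ _ * (g.val.val * splitInvolution m n hn * g.val⁻¹.val)) *
        g.val.val = (g.val.valᴴ * sigMatrix _ _ * g.val.val) * splitInvolution m n hn *
        (g.val⁻¹.val * g.val.val) by simp only [Matrix.mul_assoc], h2, h3, Matrix.mul_one,
        sigMatrix_mul_splitInvolution, hasSignature_hermForm_reindex]
      convert hasSignature_fromBlocks n (m - n) (m - n) n using 1 <;> omega

end UnitaryModels

/-! ### Split operators commuting with `I` -/

section Transfer

theorem isSplit_of_sq_eq_neg {V : Type*} [AddCommGroup V] [Module ℝ V] [FiniteDimensional ℝ V]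
    {T : V →ₗ[ℝ] V} (hT : T ∘ₗ T = (-1 : ℝ) • LinearMap.id) : IsSplit T :=
  (isSplit_iff T).2 (Or.inr (hT.trans (LinearMap.ext fun x => neg_one_smul ℝ x)))

theorem isSplit_iff_trace {V : Type*} [AddCommGroup V] [Module ℝ V] [FiniteDimensional ℝ V]
    {T : V →ₗ[ℝ] V} (hT : T ∘ₗ T = LinearMap.id) : IsSplit T ↔ LinearMap.trace ℝ V T = 0 := by
  rw [isSplit_iff]
  refine ⟨?_, fun h => Or.inl ⟨hT, h⟩⟩
  rintro (h | h)
  · exact h.2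
  · -- both squares can only occur for `V = 0`.
    have h0 : T = 0 := by
      ext x
      have h1 : T x = -T x := by
        have := congrArg (fun f : V →ₗ[ℝ] V => f (T x)) (hT.symm.trans h)
        exact this
      have h2 : (2 : ℝ) • T x = 0 := by rw [two_smul]; nth_rw 1 [h1]; exact neg_add_cancel _
      exact (smul_eq_zero.1 h2).resolve_left two_ne_zero
    rw [h0, map_zero]

/-- Real eigenspaces of a complex linear involution are complex, of twice the dimension. -/
theorem isSplit_restrictScalars_iff {V : Type*} [AddCommGroup V] [Module ℂ V]
    [Module ℝ V] [IsScalarTower ℝ ℂ V] [FiniteDimensional ℂ V] {T : V →ₗ[ℂ] V}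
    (hT : T ∘ₗ T = LinearMap.id) : IsSplit (T.restrictScalars ℝ) ↔ LinearMap.trace ℂ V T = 0 := by
  have : FiniteDimensional ℝ V := Module.Finite.trans ℂ V
  have hT' : T.restrictScalars ℝ ∘ₗ T.restrictScalars ℝ = LinearMap.id :=
    LinearMap.ext fun x => congrArg (fun f : V →ₗ[ℂ] V => f x) hT
  have h : ∀ s : ℝ, (Module.finrank ℝ (Module.End.eigenspace (T.restrictScalars ℝ) s)) =
      2 * Module.finrank ℂ (Module.End.eigenspace T (s : ℂ)) := fun s => by
    rw [← Complex.finrank_real_complex, Module.finrank_mul_finrank]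
    have he : Module.End.eigenspace (T.restrictScalars ℝ) s =
        (Module.End.eigenspace T (s : ℂ)).restrictScalars ℝ := by
      ext x
      rw [Module.End.mem_eigenspace_iff, Submodule.restrictScalars_mem,
        Module.End.mem_eigenspace_iff, LinearMap.restrictScalars_apply,
        ← Complex.coe_algebraMap, algebraMap_smul]
    rw [he]
    rfl
  have h1 := h 1
  have h2 := h (-1)
  rw [Complex.ofReal_one] at h1
  rw [Complex.ofReal_neg, Complex.ofReal_one] at h2
  rw [isSplit_iff_trace hT', trace_of_involution _ hT', trace_of_involution _ hT, sub_eq_zero,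
    sub_eq_zero, Nat.cast_inj, Nat.cast_inj, h1, h2]
  omega

/-- A homogeneous model consisting of operators on a vector space `W` that depend linearly on a
parameter yields one consisting of operators on an isomorphic space. -/
theorem IsHomogeneousModel.of_linearEquiv {G : Type*} [Group G] {R : Type*} [NormedAddCommGroup R]
    [NormedSpace ℝ R] {X W V : Type*}
    [NormedAddCommGroup X] [NormedSpace ℝ X] [FiniteDimensional ℝ X] [AddCommGroup W] [Module ℝ W]
    [NormedAddCommGroup V] [NormedSpace ℝ V] [FiniteDimensional ℝ V] {ρ : G → R} {H : Subgroup G}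
    {𝓕' : Set X} (h : IsHomogeneousModel ρ H 𝓕') (ψ : W ≃ₗ[ℝ] V) (f : X →ₗ[ℝ] (W →ₗ[ℝ] W))
    (hf : Function.Injective f) {𝓕 : Set (V →L[ℝ] V)}
    (h𝓕 : ∀ S, S ∈ 𝓕 ↔ ∃ A ∈ 𝓕', ψ.conj (f A) = S.toLinearMap) : IsHomogeneousModel ρ H 𝓕 := by
  obtain ⟨f', hf'⟩ := f.exists_leftInverse_of_injective (LinearMap.ker_eq_bot.2 hf)
  have hf'' : ∀ A, f' (f A) = A := fun A => congrArg (fun g : X →ₗ[ℝ] X => g A) hf'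
  let κ : (W →ₗ[ℝ] W) ≃ₗ[ℝ] (V →L[ℝ] V) := ψ.conj.trans LinearMap.toContinuousLinearMap
  have hκ : ∀ A, A ∈ 𝓕' → κ (f A) ∈ 𝓕 := fun A hA => (h𝓕 _).2 ⟨A, hA, rfl⟩
  have hex : ∀ S ∈ 𝓕, ∃ A ∈ 𝓕', κ (f A) = S := fun S hS => by
    obtain ⟨A, hA, hAS⟩ := (h𝓕 S).1 hS
    exact ⟨A, hA, ContinuousLinearMap.coe_inj.1 hAS⟩
  refine h.transport (LinearMap.toContinuousLinearMap (κ.toLinearMap ∘ₗ f))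
    (LinearMap.toContinuousLinearMap (f' ∘ₗ κ.symm.toLinearMap)) hκ ?_ ?_ ?_
  · intro S hS
    obtain ⟨A, hA, rfl⟩ := hex S hS
    change f' (κ.symm (κ (f A))) ∈ 𝓕'
    rwa [κ.symm_apply_apply, hf'']
  · intro A hA
    change f' (κ.symm (κ (f A))) = A
    rw [κ.symm_apply_apply, hf'']
  · intro S hS
    obtain ⟨A, hA, rfl⟩ := hex S hS
    change κ (f (f' (κ.symm (κ (f A))))) = κ (f A)
    rw [κ.symm_apply_apply, hf'']

/-- The split form on `ℝ^ι × ℝ^ι`. -/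
noncomputable def splitForm (ι : Type*) [Fintype ι] :
    LinearMap.BilinForm ℝ ((ι → ℝ) × (ι → ℝ)) :=
  LinearMap.mk₂ ℝ (fun x y => y.2 ⬝ᵥ x.1 + x.2 ⬝ᵥ y.1)
    (fun x x' y => by simp [dotProduct_add, add_dotProduct]; ring)
    (fun c x y => by simp [dotProduct_smul, smul_dotProduct]; ring)
    (fun x y y' => by simp [dotProduct_add, add_dotProduct]; ring)
    (fun c x y => by simp [dotProduct_smul, smul_dotProduct]; ring)

theorem splitForm_apply {ι : Type*} [Fintype ι] (x y : (ι → ℝ) × (ι → ℝ)) :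
    splitForm ι x y = y.2 ⬝ᵥ x.1 + x.2 ⬝ᵥ y.1 := rfl

/-- The involution `(x, y) ↦ (x, -y)`. -/
def splitReflection (ι : Type*) : ((ι → ℝ) × (ι → ℝ)) →ₗ[ℝ] ((ι → ℝ) × (ι → ℝ)) :=
  LinearMap.id.prodMap (-LinearMap.id)

/-- The operator `(A, -Aᵀ)` on `ℝ^ι × ℝ^ι`. -/
def blockEnd (ι : Type*) [Fintype ι] [DecidableEq ι] :
    Matrix ι ι ℝ →ₗ[ℝ] (((ι → ℝ) × (ι → ℝ)) →ₗ[ℝ] ((ι → ℝ) × (ι → ℝ))) where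
  toFun A := (Matrix.toLin' A).prodMap (-Matrix.toLin' Aᵀ)
  map_add' A B := by
    ext x i <;> simp [Matrix.transpose_add]
    ring
  map_smul' c A := by
    ext x i <;> simp [Matrix.transpose_smul]

theorem blockEnd_apply {ι : Type*} [Fintype ι] [DecidableEq ι] (A : Matrix ι ι ℝ)
    (x : (ι → ℝ) × (ι → ℝ)) : blockEnd ι A x = (A *ᵥ x.1, -(Aᵀ *ᵥ x.2)) := rfl

theorem blockEnd_injective (ι : Type*) [Fintype ι] [DecidableEq ι] :
    Function.Injective (blockEnd ι) := by
  intro A B h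
  apply Matrix.toLin'.injective
  ext1 i
  ext1
  exact congrArg (fun f : ((ι → ℝ) × (ι → ℝ)) →ₗ[ℝ] ((ι → ℝ) × (ι → ℝ)) =>
    (f (Pi.single i 1, 0)).1) h

theorem blockEnd_comp_self_iff {ι : Type*} [Fintype ι] [DecidableEq ι] (A : Matrix ι ι ℝ) (ε : ℝ) :
    blockEnd ι A ∘ₗ blockEnd ι A = ε • LinearMap.id ↔ A * A = ε • 1 := by
  constructor
  · intro h
    apply Matrix.toLin'.injective
    apply LinearMap.ext
    intro x
    have := congrArg (fun f : ((ι → ℝ) × (ι → ℝ)) →ₗ[ℝ] ((ι → ℝ) × (ι → ℝ)) => (f (x, 0)).1) h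
    simpa [blockEnd_apply] using this
  · intro h
    apply LinearMap.ext
    rintro ⟨x, y⟩
    have h' : Aᵀ * Aᵀ = ε • 1 := by
      rw [← Matrix.transpose_mul, h, Matrix.transpose_smul, Matrix.transpose_one]
    simp [blockEnd_apply, Matrix.mulVec_neg, h, h', Matrix.smul_mulVec]

theorem trace_blockEnd {ι : Type*} [Fintype ι] [DecidableEq ι] (A : Matrix ι ι ℝ) :
    LinearMap.trace ℝ _ (blockEnd ι A) = 0 := by
  change LinearMap.trace ℝ _ ((Matrix.toLin' A).prodMap (-Matrix.toLin' Aᵀ)) = 0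
  rw [LinearMap.trace_prodMap', map_neg, Matrix.trace_toLin'_eq, Matrix.trace_toLin'_eq,
    Matrix.trace_transpose, add_neg_cancel]

theorem trace_splitReflection_comp_blockEnd {ι : Type*} [Fintype ι] [DecidableEq ι]
    (A : Matrix ι ι ℝ) :
    LinearMap.trace ℝ _ (splitReflection ι ∘ₗ blockEnd ι A) = 2 * A.trace := by
  have h : splitReflection ι ∘ₗ blockEnd ι A = (Matrix.toLin' A).prodMap (Matrix.toLin' Aᵀ) := by
    apply LinearMap.ext
    rintro ⟨x, y⟩
    change ((A *ᵥ x, -(-(Aᵀ *ᵥ y))) : (ι → ℝ) × (ι → ℝ)) = (A *ᵥ x, Aᵀ *ᵥ y)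
    rw [neg_neg]
  rw [h, LinearMap.trace_prodMap', Matrix.trace_toLin'_eq, Matrix.trace_toLin'_eq,
    Matrix.trace_transpose, two_mul]

theorem blockEnd_comm {ι : Type*} [Fintype ι] [DecidableEq ι] (A : Matrix ι ι ℝ) :
    blockEnd ι A ∘ₗ splitReflection ι = splitReflection ι ∘ₗ blockEnd ι A := by
  apply LinearMap.ext
  rintro ⟨x, y⟩
  change ((A *ᵥ x, -(Aᵀ *ᵥ (-y))) : (ι → ℝ) × (ι → ℝ)) = (A *ᵥ x, -(-(Aᵀ *ᵥ y)))
  rw [Matrix.mulVec_neg]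

theorem blockEnd_skew {ι : Type*} [Fintype ι] [DecidableEq ι] (A : Matrix ι ι ℝ)
    (x y : (ι → ℝ) × (ι → ℝ)) :
    splitForm ι (blockEnd ι A x) y = -splitForm ι x (blockEnd ι A y) := by
  rw [blockEnd_apply, blockEnd_apply, splitForm_apply, splitForm_apply]
  simp only [neg_dotProduct, Matrix.mulVec_transpose, ← Matrix.dotProduct_mulVec]
  ring

/-- The skew operators which commute with `(x, y) ↦ (x, -y)` are the operators `(A, -Aᵀ)`. -/
theorem exists_blockEnd {ι : Type*} [Fintype ι] [DecidableEq ι]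
    {S : ((ι → ℝ) × (ι → ℝ)) →ₗ[ℝ] ((ι → ℝ) × (ι → ℝ))}
    (hskew : ∀ x y, splitForm ι (S x) y = -splitForm ι x (S y))
    (hcomm : S ∘ₗ splitReflection ι = splitReflection ι ∘ₗ S) : ∃ A, blockEnd ι A = S := by
  have hR : ∀ x y, S (x, -y) = ((S (x, y)).1, -(S (x, y)).2) := fun x y =>
    congrArg (fun f : ((ι → ℝ) × (ι → ℝ)) →ₗ[ℝ] ((ι → ℝ) × (ι → ℝ)) => f (x, y)) hcomm
  have h1 : ∀ x, (S (x, 0)).2 = 0 := fun x => by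
    have := congrArg Prod.snd (hR x 0)
    rw [neg_zero] at this
    exact self_eq_neg.1 this
  have h2 : ∀ y, (S (0, y)).1 = 0 := fun y => by
    have h3 := congrArg Prod.fst (hR 0 y)
    rw [show ((0, -y) : (ι → ℝ) × (ι → ℝ)) = -(0, y) by simp, map_neg] at h3
    exact self_eq_neg.1 h3.symm
  let A := LinearMap.toMatrix' (LinearMap.fst ℝ _ _ ∘ₗ S ∘ₗ LinearMap.inl ℝ (ι → ℝ) (ι → ℝ))
  have hA : ∀ x, A *ᵥ x = (S (x, 0)).1 := fun x => LinearMap.toMatrix'_mulVec _ x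
  refine ⟨A, ?_⟩
  apply LinearMap.ext
  rintro ⟨x, y⟩
  have hxy : ((x, y) : (ι → ℝ) × (ι → ℝ)) = (x, 0) + (0, y) := by simp
  have h4 : -(Aᵀ *ᵥ y) = (S (0, y)).2 := by
    apply dotProduct_eq
    intro u
    have h5 := hskew (u, 0) (0, y)
    rw [splitForm_apply, splitForm_apply, ← hA, h1] at h5
    simp only [dotProduct_zero, zero_dotProduct, add_zero] at h5
    rw [neg_dotProduct, Matrix.mulVec_transpose, ← Matrix.dotProduct_mulVec, h5, neg_neg]
  rw [blockEnd_apply, hxy, map_add]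
  ext1
  · rw [Prod.fst_add, Prod.fst_add, h2, ← hA, add_zero, add_zero]
  · rw [Prod.snd_add, Prod.snd_add, h1, ← h4, zero_add, zero_add]

theorem comp_sq_of_comm {V : Type*} [AddCommGroup V] [Module ℝ V] {I S : V →ₗ[ℝ] V} {δ ε : ℝ}
    (hI : I ∘ₗ I = δ • LinearMap.id) (hS : S ∘ₗ S = ε • LinearMap.id) (h : S ∘ₗ I = I ∘ₗ S) :
    (I ∘ₗ S) ∘ₗ (I ∘ₗ S) = (δ * ε) • LinearMap.id := by
  change (I * S) * (I * S) = _
  rw [(show Commute S I from h).mul_mul_mul_comm]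
  change (I ∘ₗ I) ∘ₗ (S ∘ₗ S) = _
  rw [hI, hS, LinearMap.smul_comp, LinearMap.comp_smul, LinearMap.id_comp, smul_smul]

theorem splitReflection_sq (ι : Type*) :
    splitReflection ι ∘ₗ splitReflection ι = (1 : ℝ) • LinearMap.id := by
  apply LinearMap.ext
  rintro ⟨x, y⟩
  simp [splitReflection]

/-- `(A, -Aᵀ)` is always traceless, and the trace of `(A, Aᵀ)` is `2 tr A`. -/
theorem isSplitStructure_splitForm_one_iff {ι : Type*} [Fintype ι] [DecidableEq ι]
    (S : ((ι → ℝ) × (ι → ℝ)) →ₗ[ℝ] ((ι → ℝ) × (ι → ℝ))) :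
    IsSplitStructure (splitForm ι) (splitReflection ι) 1 S ↔
      ∃ A, (A * A = 1 ∧ A.trace = 0) ∧ blockEnd ι A = S := by
  have hsq : ∀ A, blockEnd ι A ∘ₗ blockEnd ι A = (1 : ℝ) • LinearMap.id →
      (splitReflection ι ∘ₗ blockEnd ι A) ∘ₗ (splitReflection ι ∘ₗ blockEnd ι A) =
        LinearMap.id := fun A hA => by
    rw [comp_sq_of_comm (splitReflection_sq ι) hA (blockEnd_comm A), mul_one, one_smul]
  constructor
  · rintro ⟨h1, -, h3, h4, h5⟩
    obtain ⟨A, rfl⟩ := exists_blockEnd h3 h4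
    rw [isSplit_iff_trace (hsq A h1), trace_splitReflection_comp_blockEnd] at h5
    rw [blockEnd_comp_self_iff, one_smul] at h1
    exact ⟨A, ⟨h1, (mul_eq_zero.1 h5).resolve_left two_ne_zero⟩, rfl⟩
  · rintro ⟨A, ⟨hA, htr⟩, rfl⟩
    have h1 := (blockEnd_comp_self_iff A 1).2 (hA.trans (one_smul _ _).symm)
    refine ⟨h1, ?_, blockEnd_skew A, blockEnd_comm A, ?_⟩
    · exact (isSplit_iff_trace (h1.trans (one_smul _ _))).2 (trace_blockEnd A)
    · rw [isSplit_iff_trace (hsq A h1), trace_splitReflection_comp_blockEnd, htr, mul_zero]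

theorem isSplitStructure_splitForm_neg_one_iff {ι : Type*} [Fintype ι] [DecidableEq ι]
    (S : ((ι → ℝ) × (ι → ℝ)) →ₗ[ℝ] ((ι → ℝ) × (ι → ℝ))) :
    IsSplitStructure (splitForm ι) (splitReflection ι) (-1) S ↔
      ∃ A, A * A = -1 ∧ blockEnd ι A = S := by
  constructor
  · rintro ⟨h1, -, h3, h4, -⟩
    obtain ⟨A, rfl⟩ := exists_blockEnd h3 h4
    rw [blockEnd_comp_self_iff, neg_smul, one_smul] at h1
    exact ⟨A, h1, rfl⟩
  · rintro ⟨A, hA, rfl⟩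
    have h1 := (blockEnd_comp_self_iff A (-1)).2 (hA.trans (by rw [neg_smul, one_smul]))
    refine ⟨h1, ?_, blockEnd_skew A, blockEnd_comm A, ?_⟩
    · exact isSplit_of_sq_eq_neg h1
    · apply isSplit_of_sq_eq_neg
      rw [comp_sq_of_comm (splitReflection_sq ι) h1 (blockEnd_comm A), one_mul]

/-- The complex matrix `A` as a real linear operator on `ℂ^ι`. -/
noncomputable def complexEnd (ι : Type*) [Fintype ι] [DecidableEq ι] :
    Matrix ι ι ℂ →ₗ[ℝ] ((ι → ℂ) →ₗ[ℝ] (ι → ℂ)) where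
  toFun A := (Matrix.toLin' A).restrictScalars ℝ
  map_add' A B := by rw [map_add]; rfl
  map_smul' c A := LinearMap.ext fun x => Matrix.smul_mulVec c A x

theorem complexEnd_apply {ι : Type*} [Fintype ι] [DecidableEq ι] (A : Matrix ι ι ℂ) (x : ι → ℂ) :
    complexEnd ι A x = A *ᵥ x := rfl

theorem complexEnd_injective (ι : Type*) [Fintype ι] [DecidableEq ι] :
    Function.Injective (complexEnd ι) := fun _ _ h =>
  Matrix.toLin'.injective (LinearMap.restrictScalars_injective ℝ h)

theorem complexEnd_mul {ι : Type*} [Fintype ι] [DecidableEq ι] (A B : Matrix ι ι ℂ) :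
    complexEnd ι (A * B) = complexEnd ι A ∘ₗ complexEnd ι B :=
  LinearMap.ext fun x => (Matrix.mulVec_mulVec x A B).symm

theorem complexEnd_one (ι : Type*) [Fintype ι] [DecidableEq ι] :
    complexEnd ι 1 = LinearMap.id := LinearMap.ext fun x => Matrix.one_mulVec x

theorem complexEnd_comp_self_iff {ι : Type*} [Fintype ι] [DecidableEq ι] (A : Matrix ι ι ℂ)
    (ε : ℝ) : complexEnd ι A ∘ₗ complexEnd ι A = ε • LinearMap.id ↔ A * A = ε • 1 := by
  rw [← complexEnd_mul, ← complexEnd_one, ← map_smul, (complexEnd_injective ι).eq_iff]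

/-- Multiplication by `i`. -/
noncomputable def mulI (ι : Type*) : (ι → ℂ) →ₗ[ℝ] (ι → ℂ) :=
  (Complex.I • LinearMap.id : (ι → ℂ) →ₗ[ℂ] (ι → ℂ)).restrictScalars ℝ

theorem mulI_apply {ι : Type*} (x : ι → ℂ) : mulI ι x = Complex.I • x := rfl

theorem mulI_eq (ι : Type*) [Fintype ι] [DecidableEq ι] :
    mulI ι = complexEnd ι (Complex.I • 1) := LinearMap.ext fun x => by
  rw [mulI_apply, complexEnd_apply, Matrix.smul_mulVec, Matrix.one_mulVec]

theorem mulI_sq (ι : Type*) [Fintype ι] [DecidableEq ι] :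
    mulI ι ∘ₗ mulI ι = (-1 : ℝ) • LinearMap.id := by
  rw [mulI_eq, complexEnd_comp_self_iff, smul_mul_smul_comm, Complex.I_mul_I, one_mul, neg_smul,
    neg_smul, one_smul, one_smul]

theorem mulI_comp_complexEnd {ι : Type*} [Fintype ι] [DecidableEq ι] (A : Matrix ι ι ℂ) :
    mulI ι ∘ₗ complexEnd ι A = complexEnd ι (Complex.I • A) := by
  rw [mulI_eq, ← complexEnd_mul, smul_mul_assoc, one_mul]

theorem complexEnd_comm {ι : Type*} [Fintype ι] [DecidableEq ι] (A : Matrix ι ι ℂ) :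
    complexEnd ι A ∘ₗ mulI ι = mulI ι ∘ₗ complexEnd ι A := by
  rw [mulI_comp_complexEnd, mulI_eq, ← complexEnd_mul, mul_smul_comm, mul_one]

/-- A real linear operator that commutes with `i` is given by a complex matrix. -/
theorem exists_complexEnd {ι : Type*} [Fintype ι] [DecidableEq ι] {S : (ι → ℂ) →ₗ[ℝ] (ι → ℂ)}
    (h : S ∘ₗ mulI ι = mulI ι ∘ₗ S) : ∃ A, complexEnd ι A = S := by
  have hI : ∀ x, S (Complex.I • x) = Complex.I • S x := fun x =>
    congrArg (fun f : (ι → ℂ) →ₗ[ℝ] (ι → ℂ) => f x) h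
  have hr : ∀ (r : ℝ) (x : ι → ℂ), S ((r : ℂ) • x) = (r : ℂ) • S x := fun r x => by
    rw [Complex.coe_smul, Complex.coe_smul, map_smul]
  let T : (ι → ℂ) →ₗ[ℂ] (ι → ℂ) :=
    { toFun := S
      map_add' := S.map_add
      map_smul' := fun z x => by
        rw [RingHom.id_apply, ← Complex.re_add_im z, add_smul, map_add, mul_smul, hr, hr, hI,
          ← mul_smul, ← add_smul] }
  refine ⟨LinearMap.toMatrix' T, LinearMap.ext fun x => ?_⟩
  exact LinearMap.toMatrix'_mulVec T x

theorem isSplit_complexEnd_iff {ι : Type*} [Fintype ι] [DecidableEq ι] {A : Matrix ι ι ℂ}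
    (hA : A * A = 1) : IsSplit (complexEnd ι A) ↔ A.trace = 0 := by
  have h : Matrix.toLin' A ∘ₗ Matrix.toLin' A = LinearMap.id := by
    rw [← Matrix.toLin'_mul, hA, Matrix.toLin'_one]
  rw [← Matrix.trace_toLin'_eq]
  exact isSplit_restrictScalars_iff h

/-- A complex matrix is determined by the real part of its sesquilinear form. -/
theorem hermForm_injective {κ : Type*} [Fintype κ] [DecidableEq κ] :
    Function.Injective (hermForm : Matrix κ κ ℂ → LinearMap.BilinForm ℝ (κ → ℂ)) := by
  intro A B h
  have h' : ∀ x y, (star x ⬝ᵥ A *ᵥ y).re = (star x ⬝ᵥ B *ᵥ y).re := fun x y =>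
    congrArg (fun f : LinearMap.BilinForm ℝ (κ → ℂ) => f x y) h
  ext i j
  have h1 := h' (Pi.single i 1) (Pi.single j 1)
  have h2 := h' (Pi.single i Complex.I) (Pi.single j 1)
  rw [← Pi.single_star] at h1 h2
  simp at h1 h2
  exact Complex.ext h1 h2

theorem hermForm_mulVec_left {κ : Type*} [Fintype κ] (A B : Matrix κ κ ℂ) (x y : κ → ℂ) :
    hermForm A (B *ᵥ x) y = hermForm (Bᴴ * A) x y := by
  rw [hermForm_apply, hermForm_apply, Matrix.star_mulVec, ← Matrix.dotProduct_mulVec,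
    Matrix.mulVec_mulVec]

theorem hermForm_mulVec_right {κ : Type*} [Fintype κ] (A B : Matrix κ κ ℂ) (x y : κ → ℂ) :
    hermForm A x (B *ᵥ y) = hermForm (A * B) x y := by
  rw [hermForm_apply, hermForm_apply, Matrix.mulVec_mulVec]

theorem hermForm_neg {κ : Type*} [Fintype κ] (A : Matrix κ κ ℂ) :
    hermForm (-A) = -hermForm A := by
  ext x y
  simp [hermForm_apply, Matrix.neg_mulVec]

theorem complexEnd_skew_iff {p q : ℕ} (A : CMat p q) :
    (∀ x y, hermForm (sigMatrix _ _) (complexEnd _ A x) y =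
      -hermForm (sigMatrix _ _) x (complexEnd _ A y)) ↔ sigAdjoint p q A = -A := by
  rw [sigAdjoint_eq_neg_iff, ← hermForm_injective.eq_iff, hermForm_neg]
  constructor
  · intro h
    refine LinearMap.ext₂ fun x y => ?_
    rw [← hermForm_mulVec_left, LinearMap.neg_apply, LinearMap.neg_apply,
      ← hermForm_mulVec_right]
    exact h x y
  · intro h x y
    rw [complexEnd_apply, complexEnd_apply, hermForm_mulVec_left, hermForm_mulVec_right, h]
    rfl

/-- Structures with `λ = 1` on `ℂ^{p,q}`: commuting with `I` makes `S` complex linear, and `S` is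
split exactly when its complex trace vanishes. Splitness of `I S` is automatic, as its square is
`-1`. -/
theorem isSplitStructure_hermForm_one_iff {p q : ℕ}
    (S : (Fin p ⊕ Fin q → ℂ) →ₗ[ℝ] (Fin p ⊕ Fin q → ℂ)) :
    IsSplitStructure (hermForm (sigMatrix (Fin p) (Fin q))) (mulI _) 1 S ↔
      ∃ A, (A * A = 1 ∧ sigAdjoint p q A = -A ∧ A.trace = 0) ∧ complexEnd _ A = S := by
  constructor
  · rintro ⟨h1, h2, h3, h4, -⟩
    obtain ⟨A, rfl⟩ := exists_complexEnd h4
    rw [complexEnd_comp_self_iff, one_smul] at h1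
    exact ⟨A, ⟨h1, (complexEnd_skew_iff A).1 h3, (isSplit_complexEnd_iff h1).1 h2⟩, rfl⟩
  · rintro ⟨A, ⟨hA, hsk, htr⟩, rfl⟩
    have h1 := (complexEnd_comp_self_iff A 1).2 (hA.trans (one_smul _ _).symm)
    refine ⟨h1, (isSplit_complexEnd_iff hA).2 htr, (complexEnd_skew_iff A).2 hsk,
      complexEnd_comm A, isSplit_of_sq_eq_neg ?_⟩
    rw [comp_sq_of_comm (mulI_sq _) h1 (complexEnd_comm A), mul_one]

/-- Structures with `λ = -1` on `ℂ^{p,q}`: here splitness of `S` is automatic, and it is the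
splitness of `I S`, an involution, that makes the trace vanish. -/
theorem isSplitStructure_hermForm_neg_one_iff {p q : ℕ}
    (S : (Fin p ⊕ Fin q → ℂ) →ₗ[ℝ] (Fin p ⊕ Fin q → ℂ)) :
    IsSplitStructure (hermForm (sigMatrix (Fin p) (Fin q))) (mulI _) (-1) S ↔
      ∃ A, (A * A = -1 ∧ sigAdjoint p q A = -A ∧ A.trace = 0) ∧ complexEnd _ A = S := by
  have hsq : ∀ A : CMat p q, A * A = -1 → (Complex.I • A) * (Complex.I • A) = 1 := fun A hA => by
    rw [smul_mul_smul_comm, hA, Complex.I_mul_I, neg_smul_neg, one_smul]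
  have htr : ∀ A : CMat p q, (Complex.I • A).trace = 0 ↔ A.trace = 0 := fun A => by
    rw [Matrix.trace_smul, smul_eq_zero_iff_right Complex.I_ne_zero]
  constructor
  · rintro ⟨h1, -, h3, h4, h5⟩
    obtain ⟨A, rfl⟩ := exists_complexEnd h4
    rw [complexEnd_comp_self_iff, neg_smul, one_smul] at h1
    rw [mulI_comp_complexEnd, isSplit_complexEnd_iff (hsq A h1), htr] at h5
    exact ⟨A, ⟨h1, (complexEnd_skew_iff A).1 h3, h5⟩, rfl⟩
  · rintro ⟨A, ⟨hA, hsk, htrA⟩, rfl⟩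
    have h1 := (complexEnd_comp_self_iff A (-1)).2 (hA.trans (by rw [neg_smul, one_smul]))
    refine ⟨h1, isSplit_of_sq_eq_neg h1,
      (complexEnd_skew_iff A).2 hsk, complexEnd_comm A, ?_⟩
    rwa [mulI_comp_complexEnd, isSplit_complexEnd_iff (hsq A hA), htr]

/-! ### `T ⊕ T*` with `I₊` or `I₋` as a standard space -/

section Models

variable {T : Type*} [AddCommGroup T] [Module ℝ T] [TopologicalSpace T]

theorem apply_eq_sum_single {ι : Type*} [Fintype ι] [DecidableEq ι] (c : (ι → ℝ) ≃ₗ[ℝ] T)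
    (σ : T →L[ℝ] ℝ) (x : ι → ℝ) : σ (c x) = ∑ i, x i * σ (c (Pi.single i 1)) := by
  conv_lhs => rw [pi_eq_sum_univ' x]
  rw [map_sum, map_sum]
  refine Finset.sum_congr rfl fun i _ => ?_
  rw [map_smul, map_smul, smul_eq_mul]

theorem form_antisymm {η : T →L[ℝ] T →L[ℝ] ℝ} (halt : ∀ u, η u u = 0) (u v : T) :
    η u v = -η v u := by
  have h := halt (u + v)
  simp only [map_add, add_apply, halt, zero_add, add_zero] at h
  linarith

theorem form_eq_zero {η : T →L[ℝ] T →L[ℝ] ℝ} (h : ∀ u, (∀ v, η u v = 0) → u = 0) {u : T}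
    (hu : η u = 0) : u = 0 := h u fun v => by rw [hu]; rfl

variable [IsTopologicalAddGroup T] [ContinuousSMul ℝ T] [T2Space T] [FiniteDimensional ℝ T]

theorem finrank_continuousDual : Module.finrank ℝ (T →L[ℝ] ℝ) = Module.finrank ℝ T := by
  let c : (T →L[ℝ] ℝ) ≃ₗ[ℝ] (T →ₗ[ℝ] ℝ) := LinearMap.toContinuousLinearMap.symm
  rw [c.finrank_eq]
  exact Subspace.dual_finrank_eq (K := ℝ) (V := T)

theorem finiteDimensional_continuousDual : FiniteDimensional ℝ (T →L[ℝ] ℝ) :=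
  LinearEquiv.finiteDimensional
    (LinearMap.toContinuousLinearMap : (T →ₗ[ℝ] ℝ) ≃ₗ[ℝ] (T →L[ℝ] ℝ))

/-- `(x, y) ↦ (c x - ½ c' y, η (c x + ½ c' y))`, for `η`-dual bases `c`, `c'` of `T`: the
eigenspaces of `I₊` are the two graphs `± η`, which are isotropic and in duality. -/
theorem exists_splitForm_equiv {ι : Type*} [Fintype ι] [DecidableEq ι]
    (hdim : Module.finrank ℝ T = Fintype.card ι) {η : T →L[ℝ] T →L[ℝ] ℝ} (halt : ∀ u, η u u = 0)
    (h : ∀ u, (∀ v, η u v = 0) → u = 0) :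
    ∃ ψ : ((ι → ℝ) × (ι → ℝ)) ≃ₗ[ℝ] (T × (T →L[ℝ] ℝ)),
      (∀ x y, pairing T (ψ x) (ψ y) = splitForm ι x y) ∧
        ∀ x, (opI η 1).toLinearMap (ψ x) = ψ (splitReflection ι x) := by
  have := finiteDimensional_continuousDual (T := T)
  let c : (ι → ℝ) ≃ₗ[ℝ] T :=
    LinearEquiv.ofFinrankEq _ _ (by rw [Module.finrank_fintype_fun_eq_card, hdim])
  let Φ : T →ₗ[ℝ] (ι → ℝ) :=
    { toFun := fun w i => η w (c (Pi.single i 1))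
      map_add' := fun w w' => by ext i; rw [map_add]; rfl
      map_smul' := fun r w => by ext i; rw [map_smul]; rfl }
  have hΦ : ∀ w i, Φ w i = η w (c (Pi.single i 1)) := fun w i => rfl
  have hΦinj : Function.Injective Φ := by
    rw [injective_iff_map_eq_zero]
    intro w hw
    refine h w fun v => ?_
    rw [← c.apply_symm_apply v, apply_eq_sum_single]
    exact Finset.sum_eq_zero fun i _ => by rw [← hΦ, hw, Pi.zero_apply, mul_zero]
  let c' : (ι → ℝ) ≃ₗ[ℝ] T := (LinearEquiv.ofInjectiveOfFinrankEq Φ hΦinj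
    (by rw [Module.finrank_fintype_fun_eq_card, hdim])).symm
  have hcc' : ∀ x y, η (c' y) (c x) = y ⬝ᵥ x := fun x y => by
    rw [apply_eq_sum_single, dotProduct]
    refine Finset.sum_congr rfl fun i _ => ?_
    rw [← hΦ, mul_comm]
    congr 1
    exact congrFun (LinearEquiv.apply_symm_apply (LinearEquiv.ofInjectiveOfFinrankEq Φ hΦinj _) y) i
  let ψ₀ : ((ι → ℝ) × (ι → ℝ)) →ₗ[ℝ] (T × (T →L[ℝ] ℝ)) :=
    (c.toLinearMap.coprod (-(1 / 2 : ℝ) • c'.toLinearMap)).prod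
      (η.toLinearMap ∘ₗ c.toLinearMap.coprod ((1 / 2 : ℝ) • c'.toLinearMap))
  have hψ₀ : ∀ x, ψ₀ x = (c x.1 + -(1 / 2 : ℝ) • c' x.2, η (c x.1 + (1 / 2 : ℝ) • c' x.2)) :=
    fun x => rfl
  have hinj : Function.Injective ψ₀ := by
    rw [injective_iff_map_eq_zero]
    rintro ⟨x, y⟩ hxy
    rw [hψ₀, Prod.mk_eq_zero] at hxy
    have h1 := form_eq_zero h hxy.2
    have h2 : c x = 0 := by
      have : c x = (1 / 2 : ℝ) • ((c x + -(1 / 2 : ℝ) • c' y) + (c x + (1 / 2 : ℝ) • c' y)) := by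
        module
      rw [this, hxy.1, h1, add_zero, smul_zero]
    rw [h2, zero_add] at h1
    have h3 : c' y = 0 := (smul_eq_zero.1 h1).resolve_left (by norm_num)
    rw [c.map_eq_zero_iff.1 h2, c'.map_eq_zero_iff.1 h3]
    rfl
  let ψ := LinearEquiv.ofInjectiveOfFinrankEq ψ₀ hinj (by
    rw [Module.finrank_prod, Module.finrank_prod, finrank_continuousDual, hdim,
      Module.finrank_fintype_fun_eq_card])
  refine ⟨ψ, fun x y => ?_, fun x => ?_⟩
  · change pairing T (ψ₀ x) (ψ₀ y) = _
    rw [hψ₀, hψ₀, pairing_apply, splitForm_apply, ← hcc', ← hcc']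
    simp only [map_add, map_smul, add_apply, smul_apply,
      smul_eq_mul]
    rw [form_antisymm halt (c y.1) (c x.1), form_antisymm halt (c y.1) (c' x.2),
      form_antisymm halt (c x.1) (c' y.2), form_antisymm halt (c' y.2) (c' x.2)]
    ring
  · change opI η 1 (ψ₀ x) = ψ₀ (splitReflection ι x)
    rw [hψ₀, hψ₀, opI_apply, (inverse_flat η h).1, one_smul]
    change _ = (c x.1 + -(1 / 2 : ℝ) • c' (-x.2), η (c x.1 + (1 / 2 : ℝ) • c' (-x.2)))
    rw [map_neg, neg_smul, neg_smul, smul_neg, neg_neg]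

end Models

end Transfer

section StandardModels

variable {T : Type*} [AddCommGroup T] [Module ℝ T] [TopologicalSpace T]
  [IsTopologicalAddGroup T] [ContinuousSMul ℝ T]

theorem hasSignature_neg_iff {V : Type*} [AddCommGroup V] [Module ℝ V]
    (β : LinearMap.BilinForm ℝ V) (p q : ℕ) : HasSignature (-β) p q ↔ HasSignature β q p := by
  have h : LinearMap.BilinMap.toQuadraticMap (-β) = -LinearMap.BilinMap.toQuadraticMap β := rfl
  rw [HasSignature, HasSignature, h, sigNeg, sigNeg, neg_neg, and_comm]

/-- The split form has as many positive as negative squares. -/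
theorem hasSignature_pairing_comm (p q : ℕ) :
    HasSignature (pairing T) p q ↔ HasSignature (pairing T) q p := by
  rw [← hasSignature_neg_iff (pairing T) p q]
  refine hasSignature_iff_of_equiv (LinearEquiv.prodCongr (LinearEquiv.refl ℝ T)
    (LinearEquiv.neg ℝ)) (fun x => ?_) p q
  change (-x.2) x.1 + (-x.2) x.1 = -(x.2 x.1 + x.2 x.1)
  rw [neg_apply, neg_add]

variable [T2Space T] [FiniteDimensional ℝ T]

/-- `T ⊕ T*`, with the complex structure `I₋` and the split form, is a nondegenerate Hermitian
space: in coordinates `u + iv ↦ (u, η v)` the Hermitian matrix is `i η`. -/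
theorem exists_hermForm_equiv {ι : Type*} [Fintype ι] [DecidableEq ι]
    (hdim : Module.finrank ℝ T = Fintype.card ι) {η : T →L[ℝ] T →L[ℝ] ℝ} (halt : ∀ u, η u u = 0)
    (h : ∀ u, (∀ v, η u v = 0) → u = 0) :
    ∃ (A : Matrix ι ι ℂ) (ψ : (ι → ℂ) ≃ₗ[ℝ] (T × (T →L[ℝ] ℝ))), A.IsHermitian ∧ IsUnit A ∧
      (∀ x y, pairing T (ψ x) (ψ y) = hermForm A x y) ∧
        ∀ x, (opI η (-1)).toLinearMap (ψ x) = ψ (mulI ι x) := by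
  have := finiteDimensional_continuousDual (T := T)
  let c : (ι → ℝ) ≃ₗ[ℝ] T :=
    LinearEquiv.ofFinrankEq _ _ (by rw [Module.finrank_fintype_fun_eq_card, hdim])
  let w : Matrix ι ι ℝ := Matrix.of fun i j => η (c (Pi.single i 1)) (c (Pi.single j 1))
  have hw : ∀ x y, η (c x) (c y) = x ⬝ᵥ w *ᵥ y := fun x y => by
    rw [form_antisymm halt, apply_eq_sum_single,
      ← Finset.sum_neg_distrib]
    refine Finset.sum_congr rfl fun i _ => ?_
    rw [← mul_neg, ← form_antisymm halt, apply_eq_sum_single]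
    congr 1
    exact Finset.sum_congr rfl fun j _ => mul_comm _ _
  have hwT : wᵀ = -w := by
    ext i j
    exact form_antisymm halt _ _
  have hwU : IsUnit w := by
    rw [← Matrix.mulVec_injective_iff_isUnit, ← Matrix.coe_mulVecLin, injective_iff_map_eq_zero]
    intro y hy
    rw [← c.map_eq_zero_iff]
    refine h _ fun v => ?_
    rw [form_antisymm halt, ← c.apply_symm_apply v, hw, ← Matrix.mulVecLin_apply, hy,
      dotProduct_zero, neg_zero]
  let W : Matrix ι ι ℂ := w.map Complex.ofReal
  let re : (ι → ℂ) →ₗ[ℝ] (ι → ℝ) := LinearMap.compLeft Complex.reLm ι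
  let im : (ι → ℂ) →ₗ[ℝ] (ι → ℝ) := LinearMap.compLeft Complex.imLm ι
  let ψ₀ : (ι → ℂ) →ₗ[ℝ] (T × (T →L[ℝ] ℝ)) :=
    (c.toLinearMap ∘ₗ re).prod (η.toLinearMap ∘ₗ c.toLinearMap ∘ₗ im)
  have hψ₀ : ∀ x, ψ₀ x = (c (re x), η (c (im x))) := fun x => rfl
  have hinj : Function.Injective ψ₀ := by
    rw [injective_iff_map_eq_zero]
    intro x hx
    rw [hψ₀, Prod.mk_eq_zero] at hx
    have h1 := c.map_eq_zero_iff.1 hx.1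
    have h2 := c.map_eq_zero_iff.1 (form_eq_zero h hx.2)
    ext i
    exact Complex.ext (congrFun h1 i) (congrFun h2 i)
  have hfin : Module.finrank ℝ (ι → ℂ) = 2 * Fintype.card ι := by
    rw [Module.finrank_pi_fintype]
    simp [mul_comm]
  let ψ := LinearEquiv.ofInjectiveOfFinrankEq ψ₀ hinj (by
    rw [Module.finrank_prod, finrank_continuousDual, hdim, hfin, two_mul])
  refine ⟨Complex.I • W, ψ, ?_, ?_, fun x y => ?_, fun x => ?_⟩
  · ext i j
    have := congrFun (congrFun hwT i) j
    simp only [Matrix.transpose_apply, Matrix.neg_apply] at this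
    simp [W, this]
  · refine IsUnit.smul (Units.mk0 Complex.I Complex.I_ne_zero) ?_
    exact hwU.map Complex.ofRealHom.mapMatrix
  · change pairing T (ψ₀ x) (ψ₀ y) = _
    rw [hψ₀, hψ₀, pairing_apply, hermForm_apply, form_antisymm halt (c (im y)), hw, hw]
    simp only [dotProduct, Matrix.mulVec, Complex.re_sum, Finset.mul_sum,
      ← Finset.sum_neg_distrib, ← Finset.sum_add_distrib]
    refine Finset.sum_congr rfl fun i _ => Finset.sum_congr rfl fun j _ => ?_
    simp [re, im, W]
  · change opI η (-1) (ψ₀ x) = ψ₀ (mulI ι x)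
    rw [hψ₀, hψ₀, opI_apply, (inverse_flat η h).1]
    have h1 : re (mulI ι x) = -im x := by
      ext i
      simp [re, im, mulI_apply]
    have h2 : im (mulI ι x) = re x := by
      ext i
      simp [re, im, mulI_apply]
    rw [h1, h2, map_neg]
    simp

/-- `T ⊕ T*`, with the complex structure `I₋` and the split form, is `ℂ^{m,m}`. -/
theorem exists_unitary_equiv {m : ℕ} (hdim : Module.finrank ℝ T = 2 * m) {η : T →L[ℝ] T →L[ℝ] ℝ}
    (halt : ∀ u, η u u = 0) (h : ∀ u, (∀ v, η u v = 0) → u = 0) :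
    ∃ ψ : (Fin m ⊕ Fin m → ℂ) ≃ₗ[ℝ] (T × (T →L[ℝ] ℝ)),
      (∀ x y, pairing T (ψ x) (ψ y) = hermForm (sigMatrix _ _) x y) ∧
        ∀ x, (opI η (-1)).toLinearMap (ψ x) = ψ (mulI _ x) := by
  obtain ⟨A, ψ, hA, hU, hψ, hψI⟩ := exists_hermForm_equiv (ι := Fin (2 * m))
    (by rw [hdim, Fintype.card_fin]) halt h
  obtain ⟨p, q, C, D, hCD, hDC, hpq, hC⟩ := exists_orthonormal_of_isHermitian hA hU
  have h1 := hasSignature_hermForm_congr (A := A) hCD hDC (2 * p) (2 * q)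
  rw [hC, iff_true_right (hasSignature_sigMatrix p q),
    ← hasSignature_iff_of_equiv ψ (fun x => hψ x x)] at h1
  have h2 := hasSignature_unique h1 ((hasSignature_pairing_comm _ _).1 h1)
  rw [Fintype.card_fin] at hpq
  obtain rfl : m = p := by omega
  obtain rfl : m = q := by omega
  refine ⟨(mulVecEquiv hCD hDC).trans ψ, fun x y => ?_, fun x => ?_⟩
  · rw [LinearEquiv.trans_apply, LinearEquiv.trans_apply, hψ, ← hC]
    exact hermForm_mulVec A C x y
  · rw [LinearEquiv.trans_apply, LinearEquiv.trans_apply, hψI]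
    congr 1
    exact (Matrix.mulVec_smul C Complex.I x).symm

end StandardModels

/-! ### The fibres as homogeneous spaces -/

section Fibers

attribute [local instance] Matrix.linftyOpNormedRing Matrix.linftyOpNormedAlgebra

/-- Condition (i) at a point may be checked on any model `(W, b, I)` of `T ⊕ T*`. -/
theorem mem_slashFiber_iff_of_equiv {T W : Type*} [AddCommGroup T] [Module ℝ T]
    [TopologicalSpace T] [IsTopologicalAddGroup T] [ContinuousSMul ℝ T] [T2Space T]
    [FiniteDimensional ℝ T] [AddCommGroup W] [Module ℝ W] {b : LinearMap.BilinForm ℝ W}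
    {I : W →ₗ[ℝ] W} {η : T →L[ℝ] T →L[ℝ] ℝ} {lam ell : ℤˣ} (ψ : W ≃ₗ[ℝ] (T × (T →L[ℝ] ℝ)))
    (hb : ∀ x y, pairing T (ψ x) (ψ y) = b x y)
    (hI : ∀ x, (opI η (sgn (lam * ell))).toLinearMap (ψ x) = ψ (I x))
    (S : (T × (T →L[ℝ] ℝ)) →L[ℝ] (T × (T →L[ℝ] ℝ))) :
    S ∈ slashFiber η lam ell ↔ IsSplitStructure b I (sgn lam) (ψ.symm.conj S.toLinearMap) := by
  have := finiteDimensional_continuousDual (T := T)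
  have : FiniteDimensional ℝ W := LinearEquiv.finiteDimensional ψ.symm
  rw [mem_slashFiber_iff, ← isSplitStructure_conj_iff ψ hb hI]
  congr! 1
  ext x <;> simp

theorem conj_eq_iff {V W : Type*} [AddCommGroup V] [Module ℝ V] [AddCommGroup W] [Module ℝ W]
    (ψ : W ≃ₗ[ℝ] V) (A : W →ₗ[ℝ] W) (S : V →ₗ[ℝ] V) : A = ψ.symm.conj S ↔ ψ.conj A = S := by
  rw [← ψ.conj.injective.eq_iff]
  congr! 1
  ext x
  simp

variable {m : ℕ}
  {η : EuclideanSpace ℝ (Fin (2 * m)) →L[ℝ] EuclideanSpace ℝ (Fin (2 * m)) →L[ℝ] ℝ}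

theorem isHomogeneousModel_slashFiber_one_one (halt : ∀ u, η u u = 0)
    (h : ∀ u, (∀ v, η u v = 0) → u = 0) :
    IsHomogeneousModel glIncl (glProdHom m).range (slashFiber η 1 1) := by
  obtain ⟨ψ, hb, hI⟩ := exists_splitForm_equiv (ι := Fin m ⊕ Fin m)
    (by rw [finrank_euclideanSpace_fin, Fintype.card_sum, Fintype.card_fin, two_mul]) halt h
  refine (isHomogeneousModel_involutions m).of_linearEquiv ψ (blockEnd _) (blockEnd_injective _)
    fun S => ?_
  rw [mem_slashFiber_iff_of_equiv ψ hb (by simpa [sgn] using hI)]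
  have h1 : sgn 1 = 1 := by simp [sgn]
  rw [h1, isSplitStructure_splitForm_one_iff]
  simp only [conj_eq_iff]
  rfl

theorem isHomogeneousModel_slashFiber_neg_neg (halt : ∀ u, η u u = 0)
    (h : ∀ u, (∀ v, η u v = 0) → u = 0) :
    IsHomogeneousModel glIncl (glRealHom m).range (slashFiber η (-1) (-1)) := by
  obtain ⟨ψ, hb, hI⟩ := exists_splitForm_equiv (ι := Fin m ⊕ Fin m)
    (by rw [finrank_euclideanSpace_fin, Fintype.card_sum, Fintype.card_fin, two_mul]) halt h
  refine (isHomogeneousModel_complexStructures m).of_linearEquiv ψ (blockEnd _)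
    (blockEnd_injective _) fun S => ?_
  rw [mem_slashFiber_iff_of_equiv ψ hb (by simpa [sgn] using hI)]
  have h1 : sgn (-1) = -1 := by simp [sgn]
  rw [h1, isSplitStructure_splitForm_neg_one_iff]
  simp only [conj_eq_iff]
  rfl

theorem isHomogeneousModel_slashFiber_one_neg (halt : ∀ u, η u u = 0)
    (h : ∀ u, (∀ v, η u v = 0) → u = 0) :
    IsHomogeneousModel (unitaryIncl m m) (glUnitaryHom m).range (slashFiber η 1 (-1)) := by
  obtain ⟨ψ, hb, hI⟩ := exists_unitary_equiv (finrank_euclideanSpace_fin) halt h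
  refine (isHomogeneousModel_skewInvolutions m).of_linearEquiv ψ (complexEnd _)
    (complexEnd_injective _) fun S => ?_
  rw [mem_slashFiber_iff_of_equiv ψ hb (by simpa [sgn] using hI)]
  have h1 : sgn 1 = 1 := by simp [sgn]
  rw [h1, isSplitStructure_hermForm_one_iff]
  simp only [conj_eq_iff]
  rfl

theorem isHomogeneousModel_slashFiberSig {n : ℕ} (hn : n ≤ m) (halt : ∀ u, η u u = 0)
    (h : ∀ u, (∀ v, η u v = 0) → u = 0) :
    IsHomogeneousModel (unitaryIncl m m) (unitaryProdHom m n hn).range (slashFiberSig η m n) := by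
  obtain ⟨ψ, hb, hI⟩ := exists_unitary_equiv (finrank_euclideanSpace_fin) halt h
  refine (isHomogeneousModel_skewComplexStructures hn).of_linearEquiv ψ (complexEnd _)
    (complexEnd_injective _) fun S => ?_
  have h1 : sgn (-1) = -1 := by simp [sgn]
  -- `b(I S x, x) = b(x, I S x)` because `b` is symmetric.
  have hsig : ∀ A : CMat m m, ψ.conj (complexEnd _ A) = S.toLinearMap →
      (HasSignature (betaForm η S) (4 * n) (4 * m - 4 * n) ↔
        HasSignature (hermForm (sigMatrix _ _ * (Complex.I • A))) (4 * n) (4 * m - 4 * n)) := by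
    intro A hA
    refine hasSignature_iff_of_equiv ψ (fun x => ?_) _ _
    have hS : S (ψ x) = ψ (A *ᵥ x) := by
      have := congrArg (fun f : ETModel (2 * m) →ₗ[ℝ] ETModel (2 * m) => f (ψ x)) hA
      rw [LinearEquiv.conj_apply_apply, ψ.symm_apply_apply] at this
      exact this.symm
    have hb' : ∀ a b : ETModel (2 * m), pairing _ a b = pairing _ b a := fun a b => by
      rw [pairing_apply, pairing_apply, add_comm]
    change pairing _ (opI η (-1) (S (ψ x))) (ψ x) = _
    rw [hS, hb', ← ContinuousLinearMap.coe_coe (opI η (-1)), hI, hb, mulI_apply,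
      ← Matrix.smul_mulVec, hermForm_mulVec_right]
  constructor
  · rintro ⟨hS, hS'⟩
    rw [mem_slashFiber_iff_of_equiv ψ hb (by simpa [sgn] using hI), h1,
      isSplitStructure_hermForm_neg_one_iff] at hS
    obtain ⟨A, hA, hAS⟩ := hS
    rw [conj_eq_iff] at hAS
    exact ⟨A, ⟨hA.1, hA.2.1, hA.2.2, (hsig A hAS).1 hS'⟩, hAS⟩
  · rintro ⟨A, hA, hAS⟩
    refine ⟨?_, (hsig A hAS).2 hA.2.2.2⟩
    rw [mem_slashFiber_iff_of_equiv ψ hb (by simpa [sgn] using hI), h1,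
      isSplitStructure_hermForm_neg_one_iff]
    exact ⟨A, ⟨hA.1, hA.2.1, hA.2.2.1⟩, (conj_eq_iff _ _ _).2 hAS⟩

end Fibers

/-! ### The bundles over a symplectic manifold -/

theorem isFiberBundleWithFiber_slashBundle {m : ℕ} {M : Type*} [TopologicalSpace M]
    [ChartedSpace (EuclideanSpace ℝ (Fin (2 * m))) M] [IsManifold (𝓡 (2 * m)) ∞ M]
    (Ω : SymplecticForm (2 * m) M) {V : Type*} [NormedAddCommGroup V] [NormedSpace ℝ V]
    {G : Type*} [Group G] {ρ : G → V} {H : Subgroup G} (lam ell : ℤˣ)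
    (hmodel : ∀ η : EuclideanSpace ℝ (Fin (2 * m)) →L[ℝ] EuclideanSpace ℝ (Fin (2 * m)) →L[ℝ] ℝ,
      (∀ u, η u u = 0) → (∀ u, (∀ v, η u v = 0) → u = 0) →
        IsHomogeneousModel ρ H (slashFiber η lam ell)) :
    IsFiberBundleWithFiber (slashBundle Ω lam ell) ρ H := by
  refine isFiberBundleWithFiber_of_model Ω (fun η => slashFiber η lam ell)
    (fun p η f hf S => ?_) hmodel
  have : T2Space (TangentSpace (𝓡 (2 * m)) p) :=
    inferInstanceAs (T2Space (EuclideanSpace ℝ (Fin (2 * m))))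
  have : FiniteDimensional ℝ (TangentSpace (𝓡 (2 * m)) p) :=
    inferInstanceAs (FiniteDimensional ℝ (EuclideanSpace ℝ (Fin (2 * m))))
  exact mem_slashFiber_conj_iff (Ω.nondegenerate p) f hf lam ell S

theorem isFiberBundleWithFiber_slashBundleSig {m : ℕ} {M : Type*} [TopologicalSpace M]
    [ChartedSpace (EuclideanSpace ℝ (Fin (2 * m))) M] [IsManifold (𝓡 (2 * m)) ∞ M]
    (Ω : SymplecticForm (2 * m) M) {n : ℕ} (hn : n ≤ m) :
    IsFiberBundleWithFiber (slashBundleSig Ω n) (unitaryIncl m m)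
      (unitaryProdHom m n hn).range := by
  refine isFiberBundleWithFiber_of_model Ω (fun η => slashFiberSig η m n)
    (fun p η f hf S => ?_) fun η => isHomogeneousModel_slashFiberSig hn
  have : T2Space (TangentSpace (𝓡 (2 * m)) p) :=
    inferInstanceAs (T2Space (EuclideanSpace ℝ (Fin (2 * m))))
  have : FiniteDimensional ℝ (TangentSpace (𝓡 (2 * m)) p) :=
    inferInstanceAs (FiniteDimensional ℝ (EuclideanSpace ℝ (Fin (2 * m))))
  exact mem_slashFiberSig_conj_iff (Ω.nondegenerate p) f hf m n S

theorem isSlashStructure_iff {d : ℕ} {M : Type*} [TopologicalSpace M]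
    [ChartedSpace (EuclideanSpace ℝ (Fin d)) M] [IsManifold (𝓡 d) ∞ M]
    (Ω : SymplecticForm d M) (lam ell : ℤˣ) (S : ∀ p : M, ET d p →L[ℝ] ET d p) :
    IsSlashStructure Ω lam ell S ↔
      IsSmoothSectionOf (slashBundle Ω lam ell) S ∧ IsCourantInvolutive lam S :=
  ⟨fun h => ⟨⟨h.gen.smooth, fun p => ⟨h.gen.linear p, h.compatible p⟩⟩, h.gen.involutive⟩,
    fun h => ⟨⟨h.1.1, fun p => (h.1.2 p).1, h.2⟩, fun p => (h.1.2 p).2⟩⟩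

theorem isSlashStructureSig_iff {m : ℕ} {M : Type*} [TopologicalSpace M]
    [ChartedSpace (EuclideanSpace ℝ (Fin (2 * m))) M] [IsManifold (𝓡 (2 * m)) ∞ M]
    (Ω : SymplecticForm (2 * m) M) (n : ℕ) (S : ∀ p : M, ET (2 * m) p →L[ℝ] ET (2 * m) p) :
    IsSlashStructureSig Ω n S ↔
      IsSmoothSectionOf (slashBundleSig Ω n) S ∧ IsCourantInvolutive (-1) S :=
  ⟨fun h => ⟨⟨h.slash.gen.smooth,
      fun p => ⟨⟨h.slash.gen.linear p, h.slash.compatible p⟩, h.sig p⟩⟩, h.slash.gen.involutive⟩,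
    fun h => ⟨⟨⟨h.1.1, fun p => (h.1.2 p).1.1, h.2⟩, fun p => (h.1.2 p).1.2⟩,
      fun p => (h.1.2 p).2⟩⟩

theorem mainTheorem2 (m : ℕ) (M : Type*) [TopologicalSpace M] [T2Space M]
    [SecondCountableTopology M] [ChartedSpace (EuclideanSpace ℝ (Fin (2 * m))) M]
    [IsManifold (𝓡 (2 * m)) ∞ M] (Ω : SymplecticForm (2 * m) M) :
    -- `(1, 1)`: fibre `GL(2m, ℝ) / (GL(m, ℝ) × GL(m, ℝ))`
    (IsFiberBundleWithFiber (slashBundle Ω 1 1) glIncl (glProdHom m).range ∧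
      ∀ S : ∀ p : M, ET (2 * m) p →L[ℝ] ET (2 * m) p, IsSlashStructure Ω 1 1 S ↔
        IsSmoothSectionOf (slashBundle Ω 1 1) S ∧ IsCourantInvolutive 1 S) ∧
    -- `(1, -1)`: fibre `U(m, m) / GL(m, ℂ)`
    (IsFiberBundleWithFiber (slashBundle Ω 1 (-1)) (unitaryIncl m m) (glUnitaryHom m).range ∧
      ∀ S : ∀ p : M, ET (2 * m) p →L[ℝ] ET (2 * m) p, IsSlashStructure Ω 1 (-1) S ↔
        IsSmoothSectionOf (slashBundle Ω 1 (-1)) S ∧ IsCourantInvolutive 1 S) ∧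
    -- `(-1, 1; n)`: fibre `U(m, m) / (U(n, m-n) × U(m-n, n))`
    (∀ (n : ℕ) (hn : n ≤ m),
      IsFiberBundleWithFiber (slashBundleSig Ω n) (unitaryIncl m m)
        (unitaryProdHom m n hn).range ∧
      ∀ S : ∀ p : M, ET (2 * m) p →L[ℝ] ET (2 * m) p, IsSlashStructureSig Ω n S ↔
        IsSmoothSectionOf (slashBundleSig Ω n) S ∧ IsCourantInvolutive (-1) S) ∧
    -- `(-1, -1)`: fibre `GL(2m, ℝ) / GL(m, ℂ)`
    (IsFiberBundleWithFiber (slashBundle Ω (-1) (-1)) glIncl (glRealHom m).range ∧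
      ∀ S : ∀ p : M, ET (2 * m) p →L[ℝ] ET (2 * m) p, IsSlashStructure Ω (-1) (-1) S ↔
        IsSmoothSectionOf (slashBundle Ω (-1) (-1)) S ∧ IsCourantInvolutive (-1) S) := by
  exact ⟨⟨isFiberBundleWithFiber_slashBundle Ω 1 1
        fun _ => isHomogeneousModel_slashFiber_one_one,
      isSlashStructure_iff Ω 1 1⟩,
    ⟨isFiberBundleWithFiber_slashBundle Ω 1 (-1)
        fun _ => isHomogeneousModel_slashFiber_one_neg,
      isSlashStructure_iff Ω 1 (-1)⟩,
    fun n hn => ⟨isFiberBundleWithFiber_slashBundleSig Ω hn, isSlashStructureSig_iff Ω n⟩,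
    ⟨isFiberBundleWithFiber_slashBundle Ω (-1) (-1)
        fun _ => isHomogeneousModel_slashFiber_neg_neg,
      isSlashStructure_iff Ω (-1) (-1)⟩⟩
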